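/- **Market.** Fix $N\ge 1$, $0\le l<u$ and $\eta>0$. Let $\mathcal F^\eta$ be the set of probability distributions $F$ on $[l,u]$ having a density $f$ that is continuous and strictly positive on $[l,u]$, satisfies $|f(p)-f(p')|\le\eta|p-p'|$ for $p,p'\in[l,u]$, and whose hazard rate $f/(1-F)$ is increasing on $[l,u)$. Let $b^*(F)=\arg\max_p p(1-F(p))$ and $q^*(F)=1-F(b^*(F))$. In every period $t=1,2,\dots$ there are $N$ buyers with independent valuations $v_{i,t}\sim F_i$, independent over time, where $F=\frac1N\sum_iF_i$; at price $p$ the quantity sold is $\frac1N\#\{i: v_{i,t}\ge p\}$. **Algorithm $\mathcal A_a$.** The parameters are a gain $a>0$, a noise width $\epsilon>0$, a compact set $\mathsf B\subset(0,\infty)\times(-\infty,0)$ containing $\bigl(2q^*(F),-q^*(F)/b^*(F)\bigr)$ for all $F\in\mathcal F^\eta$, a compact convex set $\mathcal B\subset(0,\infty)\times(-\infty,0)$ containing $\mathsf B$ in its interior, and a point $\hat\beta$ in the interior of $\mathsf B$. Starting from $\beta_0\in\mathsf B$, and writing $\beta_{t-1}=(\beta_{0,t-1},\beta_{1,t-1})$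 and $b_t=-\beta_{0,t-1}/(2\beta_{1,t-1})$, in period $t$ the price is $p_t=b_t+\epsilon_{1,t}$, where the $\epsilon_{1,t}$ are i.i.d. uniform on $[-\epsilon,\epsilon]$ (variance $\sigma_1^2=\epsilon^2/3$) and independent of the valuations; the quantity $q_t$ at price $p_t$ is observed, and $$\beta_t=\beta_{t-1}+a\begin{pmatrix}1&b_t\\ b_t&b_t^2+\sigma_1^2\end{pmatrix}^{-1}\begin{pmatrix}1\\p_t\end{pmatrix}\bigl(q_t-\beta_{0,t-1}-\beta_{1,t-1}p_t\bigr)$$ if the right-hand side lies in $\mathcal B$, and $\beta_t=\hat\beta$ otherwise. The forecast $\varphi(\beta_t)$ after $t$ periods is the price $b_{t+1}$ together with a quantity, which is either the mean quantity $\beta_{0,t}+\beta_{1,t}b_{t+1}=\beta_{0,t}/2$ predicted by the linear model, or the true mean quantity $1-F(b_{t+1}+\epsilon_{1,t+1})$ at the price charged next. All claims below hold for both choices. $|\cdot|$ is the Euclidean norm. **Theorem.** For every $F\in\mathcal F^\eta$ the maximizer $b^*(F)$ exists and is unique. Moreover $\mathsf B$, $\mathcal B$, $\hat\beta$ can be chosen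 such that the following hold. 1. For every $\mu>0$ there are a noise width $\epsilon(\mu)>0$ and $\tau(\mu)>0$, $\rho(\mu)>0$, $\bar a(\mu)>0$ such that for all $a\in(0,\bar a(\mu))$, with $T=\lceil\tau(\mu)/a\rceil$, $$\mathbb P\bigl(|\varphi(\beta_T)-(b^*(F),q^*(F))|>4\mu\bigr)\le e^{-\rho(\mu)T}$$ for all $F\in\mathcal F^\eta$, all $F_1,\dots,F_N$ with average $F$, and all initial estimates $\beta_0\in\mathsf B$. Here, as $\mu\downarrow0$, $\tau(\mu)$ is of exact order $-\log\mu$, and $\bar a(\mu)=O(-\mu/\log\mu)$. 2. The family $\mathcal A_a$ uniformly learns $\mathcal F^\eta$: for every $\mu>0$ there is a noise width $\epsilon(\mu)>0$, and for every $\mu>0$ and $\lambda\in(0,1)$ there are a gain $a(\mu,\lambda)>0$ and a time $\bar T(\mu,\lambda)\in\{0,1,2,\dots\}$ such that $\mathcal A_{a(\mu,\lambda)}$ with noise width $\epsilon(\mu)$ satisfies $$\mathbb P\bigl(|\varphi(\beta_{\bar T(\mu,\lambda)})-(b^*(F),q^*(F))|\ge\mu\bigr)\le\lambda$$ for all $F\in\mathcal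 F^\eta$, all $F_1,\dots,F_N$ with average $F$, and all $\beta_0\in\mathsf B$; and there are $k>0$ and $C$ with $\bar T(\mu,\lambda)\le C\,\frac{-\log\lambda}{\mu^k}$ for all $\mu\in(0,1]$ and $\lambda\in(0,\tfrac12]$. -/

import Mathlib

open MeasureTheory ProbabilityTheory Filter Topology Asymptotics
open scoped Matrix

noncomputable section

namespace MonopolyLearning

/-- `f` is a density of the distribution `m` with support `[l, u]`: it is continuous and strictly
positive on `[l, u]`, and the hazard rate `f / (1 - F)` is increasing there
(at `u` itself `1 - F` vanishes, so the hazard rate lives on `[l, u)`). -/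
structure HasIHRDensity (l u : ℝ) (m : Measure ℝ) (f : ℝ → ℝ) : Prop where
  isProb : IsProbabilityMeasure m
  density : m = (volume.restrict (Set.Icc l u)).withDensity (fun x => ENNReal.ofReal (f x))
  cont : ContinuousOn f (Set.Icc l u)
  pos : ∀ p ∈ Set.Icc l u, 0 < f p
  hazard : MonotoneOn (fun p => f p / (1 - cdf m p)) (Set.Ico l u)

/-- The class of distributions on `[l, u]` with increasing hazard rate whose density is
`η`-Lipschitz on `[l, u]`. -/
def lipschitzIHR (l u η : ℝ) : Set (Measure ℝ) :=
  {m | ∃ f : ℝ → ℝ, HasIHRDensity l u m f ∧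
    ∀ p ∈ Set.Icc l u, ∀ p' ∈ Set.Icc l u, |f p - f p'| ≤ η * |p - p'|}

/-- `b` maximizes the expected profit `p (1 - F p)`. -/
def IsOptimalPrice (m : Measure ℝ) (b : ℝ) : Prop :=
  ∀ p : ℝ, p * (1 - cdf m p) ≤ b * (1 - cdf m b)

/-- The optimal price `b*(F)` (a maximizer of the expected profit). -/
def optPrice (m : Measure ℝ) : ℝ := Classical.epsilon (IsOptimalPrice m)

/-- The expected quantity `q*(F) = 1 - F (b*(F))` at the optimal price. -/
def optQuantity (m : Measure ℝ) : ℝ := 1 - cdf m (optPrice m)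

/-- The linear demand `β 0 + β 1 * p` that supports the true optimum, i.e.
`q* = β 0 / 2` and `b* = -β 0 / (2 β 1)`. -/
def optBeta (m : Measure ℝ) : Fin 2 → ℝ :=
  ![2 * optQuantity m, -(optQuantity m / optPrice m)]

/-- The normalized aggregate distribution `F = (1/N) ∑ i, F i` of `N` buyers. -/
def aggregate {N : ℕ} (ν : Fin N → Measure ℝ) : Measure ℝ :=
  (N : ENNReal)⁻¹ • ∑ i, ν i

/-- The normalized quantity sold at price `p` to `N` buyers with valuations `v`. -/
def quantity {N : ℕ} (v : Fin N → ℝ) (p : ℝ) : ℝ :=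
  (∑ i, if p ≤ v i then (1 : ℝ) else 0) / N

/-- The uniform distribution on `[-ε, ε]`. -/
def noiseLaw (ε : ℝ) : Measure ℝ := cond volume (Set.Icc (-ε) ε)

/-- The shocks of period `t + 1` are `D t = (experimentation noise, valuations of the buyers)`.
The periods are i.i.d.; within a period the noise is uniform on `[-ε, ε]`, buyer `i` has valuation
distribution `ν i`, and all of these are independent. -/
structure IsShockProcess {Ω : Type} [MeasurableSpace Ω] (P : Measure Ω) {N : ℕ}
    (ν : Fin N → Measure ℝ) (ε : ℝ) (D : ℕ → Ω → ℝ × (Fin N → ℝ)) : Prop where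
  isProb : IsProbabilityMeasure P
  meas : ∀ t, Measurable (D t)
  indep : iIndepFun D P
  law : ∀ t, P.map (D t) = (noiseLaw ε).prod (Measure.pi ν)

/-- The optimal price for the linear demand `q = β 0 + β 1 * p`. -/
def linPrice (β : Fin 2 → ℝ) : ℝ := -β 0 / (2 * β 1)

/-- The second moment matrix of `(1, b + ε₁)`, where `ε₁` is uniform on `[-ε, ε]` and so has
variance `ε ^ 2 / 3`. -/
def momentMatrix (ε b : ℝ) : Matrix (Fin 2) (Fin 2) ℝ :=
  !![1, b; b, b ^ 2 + ε ^ 2 / 3]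

/-- One recursive least-squares update of `β` with gain `a`, from the observed price `p` and
quantity `q`. -/
def lsUpdate (ε a : ℝ) (β : Fin 2 → ℝ) (p q : ℝ) : Fin 2 → ℝ :=
  β + (a * (q - (β 0 + β 1 * p))) • ((momentMatrix ε (linPrice β))⁻¹ *ᵥ ![1, p])

/-- The projection facility: a compact set `core` of intercept-slope pairs containing every
linear demand that supports the optimum of some `m ∈ 𝓕`, a compact convex set `box` containing
`core` in its interior, and the point of `core` to which estimates leaving `box` are reset. -/
structure ProjectionFacility (𝓕 : Set (Measure ℝ)) where
  core : Set (Fin 2 → ℝ)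
  box : Set (Fin 2 → ℝ)
  reset : Fin 2 → ℝ
  core_compact : IsCompact core
  opt_mem_core : ∀ m ∈ 𝓕, optBeta m ∈ core
  box_compact : IsCompact box
  box_convex : Convex ℝ box
  core_subset : core ⊆ interior box
  box_sign : ∀ β ∈ box, 0 < β 0 ∧ β 1 < 0
  reset_mem : reset ∈ interior core

open Classical in
/-- The constant-gain algorithm: `estimate … t` is the estimate after `t` periods. In each period
the price is `-β 0 / (2 β 1)` plus the noise, the quantity is the realized demand, and `β` is
updated by least squares, or reset if the update leaves `box`. -/
def estimate {𝓕 : Set (Measure ℝ)} (pf : ProjectionFacility 𝓕) (ε a : ℝ) (β₀ : Fin 2 → ℝ) {N : ℕ}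
    (d : ℕ → ℝ × (Fin N → ℝ)) : ℕ → (Fin 2 → ℝ)
  | 0 => β₀
  | t + 1 =>
    let β := estimate pf ε a β₀ d t
    let p := linPrice β + (d t).1
    let β' := lsUpdate ε a β p (quantity (d t).2 p)
    if β' ∈ pf.box then β' else pf.reset

/-- The optimal price and the mean quantity forecast of the estimated linear model. -/
def modelForecast (β : Fin 2 → ℝ) (_e : ℝ) : ℝ × ℝ :=
  (linPrice β, β 0 + β 1 * linPrice β)

/-- The optimal price of the estimated linear model and the true mean quantity at the price that is
actually charged when the experimentation noise is `e`. -/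
def demandForecast (m : Measure ℝ) (β : Fin 2 → ℝ) (e : ℝ) : ℝ × ℝ :=
  (linPrice β, 1 - cdf m (linPrice β + e))

/-- Euclidean distance from a price-quantity pair to the true optimum `(b*(F), q*(F))`. -/
def distToOpt (m : Measure ℝ) (x : ℝ × ℝ) : ℝ :=
  Real.sqrt ((x.1 - optPrice m) ^ 2 + (x.2 - optQuantity m) ^ 2)

/-- Uniformly over all initial estimates in `core`, all `N`-buyer markets with aggregate
distribution in `𝓕`, and both ways of reading off the quantity forecast, the distance between the
forecast after `T` periods and the true optimum is `bad` with probability at most `δ`. -/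
def FailsWithProbAtMost {𝓕 : Set (Measure ℝ)} (pf : ProjectionFacility 𝓕) (N : ℕ) (ε a : ℝ) (T : ℕ)
    (bad : ℝ → Prop) (δ : ℝ) : Prop :=
  ∀ β₀ ∈ pf.core,
  ∀ ν : Fin N → Measure ℝ, (∀ i, IsProbabilityMeasure (ν i)) → aggregate ν ∈ 𝓕 →
  ∀ (Ω : Type) [MeasurableSpace Ω] (P : Measure Ω) (D : ℕ → Ω → ℝ × (Fin N → ℝ)),
    IsShockProcess P ν ε D →
  ∀ φ ∈ ({modelForecast, demandForecast (aggregate ν)} : Set ((Fin 2 → ℝ) → ℝ → ℝ × ℝ)),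
    P.real {ω | bad (distToOpt (aggregate ν)
      (φ (estimate pf ε a β₀ (fun t => D t ω) T) (D T ω).1))} ≤ δ

/-- Uniform learning: for all accuracies `μ` and confidence levels `1 - r` there are a noise width,
a gain and a stopping time `T μ r = O(-log r / μ ^ k)` at which the forecast is, uniformly over `𝓕`,
within `μ` of the optimum with probability at least `1 - r`. -/
def UniformlyLearns {𝓕 : Set (Measure ℝ)} (pf : ProjectionFacility 𝓕) (N : ℕ) : Prop :=
  ∃ (ε : ℝ → ℝ) (gain : ℝ → ℝ → ℝ) (T : ℝ → ℝ → ℕ),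
    (∀ μ > 0, 0 < ε μ ∧ ∀ r ∈ Set.Ioo (0 : ℝ) 1, 0 < gain μ r ∧
      FailsWithProbAtMost pf N (ε μ) (gain μ r) (T μ r) (fun d => μ ≤ d) r) ∧
    ∃ k > (0 : ℝ), ∃ C : ℝ, ∀ μ ∈ Set.Ioc (0 : ℝ) 1, ∀ r ∈ Set.Ioc (0 : ℝ) (1 / 2),
      (T μ r : ℝ) ≤ C * (-Real.log r / μ ^ k)

end MonopolyLearning

end

/-!
Describe an estimated linear demand by its optimal price `b` and by minus its slope `y`, so that
`b ^ 2 * y` is the profit it predicts. An increasing hazard rate makes the expected profit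
single-peaked, and the linear demand through the true optimum with the locally observed slope errs
on the side that pushes `b` towards the optimal price. Hence a Lyapunov function `V`, which combines
the one-sided squared distances of `b` from the optimal price with the entropy of the predicted
profit relative to the optimal one, contracts under the mean dynamics at a rate proportional to the
gain `a`, up to an error proportional to the noise width `ε`. Since `V` is larger outside the box
than at the reset point, resetting only decreases it. For `θ ≤ ε ^ 3 / a` the fluctuations of a
period are dominated by its drift also in the exponential moment of `θ * V`, and Markov's inequality
for `exp (θ * V)` after `T` periods gives a failure probability that is exponentially small in
`1 / a`, thus in `T`.
-/

noncomputable section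

namespace MonopolyLearning

lemma real_Ici_eq_one_sub_cdf (m : Measure ℝ) [IsProbabilityMeasure m] [NullSingletonClass m]
    (p : ℝ) : m.real (Set.Ici p) = 1 - cdf m p := by
  rw [← measureReal_congr Ioi_ae_eq_Ici, cdf_eq_real, ← Set.compl_Iic,
    probReal_compl_eq_one_sub measurableSet_Iic]

namespace HasIHRDensity

variable {l u η b p D : ℝ} {m : Measure ℝ} {f : ℝ → ℝ}

lemma nullSingletonClass (h : HasIHRDensity l u m f) : NullSingletonClass m where
  measure_singleton x := by
    rw [h.density]
    exact withDensity_absolutelyContinuous _ _ (measure_singleton x)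

lemma integrable_indicator (h : HasIHRDensity l u m f) :
    Integrable ((Set.Icc l u).indicator f) :=
  h.cont.integrableOn_Icc.integrable_indicator measurableSet_Icc

lemma indicator_nonneg (h : HasIHRDensity l u m f) (t : ℝ) : 0 ≤ (Set.Icc l u).indicator f t :=
  Set.indicator_nonneg (fun p hp => (h.pos p hp).le) t

lemma measureReal_eq_integral (h : HasIHRDensity l u m f) {s : Set ℝ} (hs : MeasurableSet s) :
    m.real s = ∫ t in s, (Set.Icc l u).indicator f t := by
  rw [setIntegral_indicator measurableSet_Icc, Set.inter_comm, measureReal_def]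
  conv_lhs => rw [h.density]
  rw [withDensity_apply _ hs, Measure.restrict_restrict hs, Set.inter_comm,
    integral_eq_lintegral_of_nonneg_ae]
  · filter_upwards [ae_restrict_mem (measurableSet_Icc.inter hs)] with t ht using (h.pos t ht.1).le
  · exact (h.cont.aestronglyMeasurable measurableSet_Icc).mono_set Set.inter_subset_left

lemma cdf_sub_cdf_eq_integral (h : HasIHRDensity l u m f) (x y : ℝ) :
    cdf m y - cdf m x = ∫ t in x..y, (Set.Icc l u).indicator f t := by
  have := h.isProb
  simp only [cdf_eq_real, h.measureReal_eq_integral measurableSet_Iic]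
  exact intervalIntegral.integral_Iic_sub_Iic h.integrable_indicator.integrableOn
    h.integrable_indicator.integrableOn

lemma continuous_cdf (h : HasIHRDensity l u m f) : Continuous (cdf m) := by
  have h0 := intervalIntegral.continuous_primitive
    (fun _ _ => h.integrable_indicator.intervalIntegrable) 0
  exact (h0.add_const (cdf m 0)).congr fun y => by rw [← h.cdf_sub_cdf_eq_integral]; ring

lemma cdf_of_le (h : HasIHRDensity l u m f) (hp : p ≤ l) : cdf m p = 0 := by
  have := h.isProb
  rw [cdf_eq_real, h.measureReal_eq_integral measurableSet_Iic, setIntegral_indicator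
    measurableSet_Icc]
  refine setIntegral_measure_zero _ (measure_mono_null (t := {p}) ?_ (measure_singleton p))
  exact fun x hx => le_antisymm hx.1 (hp.trans hx.2.1)

lemma cdf_of_ge (h : HasIHRDensity l u m f) (hp : u ≤ p) : cdf m p = 1 := by
  have := h.isProb
  have := h.nullSingletonClass
  suffices m.real (Set.Ici p) = 0 by linarith [real_Ici_eq_one_sub_cdf m p]
  rw [h.measureReal_eq_integral measurableSet_Ici, setIntegral_indicator measurableSet_Icc]
  refine setIntegral_measure_zero _ (measure_mono_null (t := {p}) ?_ (measure_singleton p))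
  exact fun x hx => le_antisymm (hx.2.2.trans hp) hx.1

lemma cdf_sub_cdf_le (h : HasIHRDensity l u m f) {x y d : ℝ} (hxy : x ≤ y)
    (hd : ∀ t ∈ Set.Icc x y, (Set.Icc l u).indicator f t ≤ d) :
    cdf m y - cdf m x ≤ d * (y - x) := by
  rw [h.cdf_sub_cdf_eq_integral, mul_comm, ← smul_eq_mul, ← intervalIntegral.integral_const]
  exact intervalIntegral.integral_mono_on hxy h.integrable_indicator.intervalIntegrable
    intervalIntegrable_const hd

lemma le_cdf_sub_cdf (h : HasIHRDensity l u m f) {x y d : ℝ} (hxy : x ≤ y)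
    (hd : ∀ t ∈ Set.Icc x y, d ≤ (Set.Icc l u).indicator f t) :
    d * (y - x) ≤ cdf m y - cdf m x := by
  rw [h.cdf_sub_cdf_eq_integral, mul_comm, ← smul_eq_mul, ← intervalIntegral.integral_const]
  exact intervalIntegral.integral_mono_on hxy intervalIntegrable_const
    h.integrable_indicator.intervalIntegrable hd

lemma survival_pos (h : HasIHRDensity l u m f) (hp : p < u) : 0 < 1 - cdf m p := by
  have hmono := monotone_cdf m (le_max_left p l)
  rcases le_or_gt u l with hul | hlu
  · rw [h.cdf_of_le (hp.le.trans hul)]; norm_num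
  have hlt : max p l < u := max_lt hp hlu
  have hpos : 0 < ∫ t in max p l..u, (Set.Icc l u).indicator f t := by
    refine intervalIntegral.intervalIntegral_pos_of_pos_on
      h.integrable_indicator.intervalIntegrable (fun t ht => ?_) hlt
    have ht' : t ∈ Set.Icc l u := ⟨(le_max_right p l).trans ht.1.le, ht.2.le⟩
    rw [Set.indicator_of_mem ht']
    exact h.pos t ht'
  rw [← h.cdf_sub_cdf_eq_integral, h.cdf_of_ge le_rfl] at hpos
  linarith

lemma hasDerivWithinAt_cdf (h : HasIHRDensity l u m f) (hlu : l ≤ u) (hp : p ∈ Set.Icc l u) :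
    HasDerivWithinAt (cdf m) (f p) (Set.Icc l u) p := by
  set g := Set.IccExtend hlu ((Set.Icc l u).domRestrict f)
  have hg : ∀ t ∈ Set.Icc l u, g t = f t := fun t ht => Set.IccExtend_of_mem _ _ ht
  have hderiv := (h.cont.domRestrict.Icc_extend' (h := hlu)).integral_hasStrictDerivAt l p
  change HasStrictDerivAt (fun x => ∫ t in l..x, g t) (g p) p at hderiv
  rw [hg p hp] at hderiv
  have hcdf : ∀ x ∈ Set.Icc l u, cdf m x = ∫ t in l..x, g t := fun x hx => by
    rw [← sub_zero (cdf m x), ← h.cdf_of_le le_rfl, h.cdf_sub_cdf_eq_integral]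
    refine intervalIntegral.integral_congr fun t ht => ?_
    rw [Set.uIcc_of_le hx.1] at ht
    have ht' : t ∈ Set.Icc l u := ⟨ht.1, ht.2.trans hx.2⟩
    rw [hg t ht', Set.indicator_of_mem ht']
  exact hderiv.hasDerivAt.hasDerivWithinAt.congr hcdf (hcdf p hp)

lemma exists_isOptimalPrice (h : HasIHRDensity l u m f) (hl : 0 ≤ l) (hlu : l ≤ u) :
    ∃ b, IsOptimalPrice m b := by
  have hcont : Continuous fun p => p * (1 - cdf m p) := by
    have := h.continuous_cdf
    fun_prop
  obtain ⟨b, -, hmax⟩ :=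
    isCompact_Icc.exists_isMaxOn (Set.nonempty_Icc.2 hlu) hcont.continuousOn
  refine ⟨b, fun p => ?_⟩
  have hprofit_l : l * (1 - cdf m l) ≤ b * (1 - cdf m b) := hmax (Set.left_mem_Icc.2 hlu)
  rw [h.cdf_of_le le_rfl] at hprofit_l
  rcases le_total p l with hpl | hlp
  · rw [h.cdf_of_le hpl]; linarith
  rcases le_total p u with hpu | hup
  · exact hmax ⟨hlp, hpu⟩
  · rw [h.cdf_of_ge hup]; linarith

lemma le_opt (h : HasIHRDensity l u m f) (hb : IsOptimalPrice m b) : l ≤ b := by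
  by_contra! hbl
  have := hb l
  rw [h.cdf_of_le le_rfl, h.cdf_of_le hbl.le] at this
  linarith

lemma opt_profit_pos (h : HasIHRDensity l u m f) (hb : IsOptimalPrice m b) (hl : 0 ≤ l)
    (hlu : l < u) : 0 < b * (1 - cdf m b) := by
  have hprofit := hb ((l + u) / 2)
  have := mul_pos (show 0 < (l + u) / 2 by linarith)
    (h.survival_pos (show (l + u) / 2 < u by linarith))
  linarith

lemma opt_lt (h : HasIHRDensity l u m f) (hb : IsOptimalPrice m b) (hl : 0 ≤ l) (hlu : l < u) :
    b < u := by
  by_contra! hub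
  have := h.opt_profit_pos hb hl hlu
  rw [h.cdf_of_ge hub] at this
  linarith

lemma opt_pos (h : HasIHRDensity l u m f) (hb : IsOptimalPrice m b) (hl : 0 ≤ l) (hlu : l < u) :
    0 < b :=
  pos_of_mul_pos_left (h.opt_profit_pos hb hl hlu) (h.survival_pos (h.opt_lt hb hl hlu)).le

lemma opt_variational_inequality (h : HasIHRDensity l u m f) (hb : IsOptimalPrice m b)
    (hbm : b ∈ Set.Icc l u) (hp : p ∈ Set.Icc l u) :
    (p - b) * (1 - cdf m b - b * f b) ≤ 0 := by
  have hderiv : HasDerivWithinAt (fun p => p * (1 - cdf m p)) (1 - cdf m b - b * f b)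
      (Set.Icc l u) b := by
    have hF := h.hasDerivWithinAt_cdf (hbm.1.trans hbm.2) hbm
    exact ((hasDerivWithinAt_id b _).mul (hF.const_sub 1)).congr_deriv (by simp; ring)
  have hmax : IsMaxOn (fun p => p * (1 - cdf m p)) (Set.Icc l u) b := fun p _ => hb p
  have hcone := sub_mem_posTangentConeAt_of_segment_subset
    ((convex_Icc l u).segment_subset hbm hp)
  simpa using hmax.localize.hasFDerivWithinAt_nonpos hderiv.hasFDerivWithinAt hcone

lemma survival_le_of_opt_le (h : HasIHRDensity l u m f) (hb : IsOptimalPrice m b) (hl : 0 ≤ l)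
    (hbp : b ≤ p) (hpu : p < u) : 1 - cdf m p ≤ b * f p := by
  have hlb := h.le_opt hb
  have hbu := hbp.trans_lt hpu
  have hfoc : 1 - cdf m b ≤ b * f b := by
    have := h.opt_variational_inequality hb ⟨hlb, hbu.le⟩ (Set.right_mem_Icc.2 (hlb.trans hbu.le))
    linarith [nonpos_of_mul_nonpos_right this (sub_pos.2 hbu)]
  have hhazard := h.hazard ⟨hlb, hbu⟩ ⟨hlb.trans hbp, hpu⟩ hbp
  have hSb := h.survival_pos hbu
  have hSp := h.survival_pos hpu
  beta_reduce at hhazard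
  rw [div_le_div_iff₀ hSb hSp] at hhazard
  refine le_of_mul_le_mul_left ?_ hSb
  have hb0 : 0 ≤ b := hl.trans hlb
  calc (1 - cdf m b) * (1 - cdf m p) ≤ b * f b * (1 - cdf m p) := by gcongr
    _ = b * (f b * (1 - cdf m p)) := mul_assoc _ _ _
    _ ≤ b * (f p * (1 - cdf m b)) := by gcongr
    _ = (1 - cdf m b) * (b * f p) := by ring

lemma le_survival_of_le_opt (h : HasIHRDensity l u m f) (hb : IsOptimalPrice m b) (hl : 0 ≤ l)
    (hbu : b < u) (hlb : l < b) (hlp : l ≤ p) (hpb : p ≤ b) : b * f p ≤ 1 - cdf m p := by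
  have hfoc : b * f b ≤ 1 - cdf m b := by
    have := h.opt_variational_inequality hb ⟨hlb.le, hbu.le⟩
      (Set.left_mem_Icc.2 (hlb.trans hbu).le)
    linarith [nonneg_of_mul_nonpos_right this (sub_neg.2 hlb)]
  have hpu := hpb.trans_lt hbu
  have hhazard := h.hazard ⟨hlp, hpu⟩ ⟨hlb.le, hbu⟩ hpb
  have hSb := h.survival_pos hbu
  have hSp := h.survival_pos hpu
  beta_reduce at hhazard
  rw [div_le_div_iff₀ hSp hSb] at hhazard
  refine le_of_mul_le_mul_left ?_ hSb
  have hb0 : 0 ≤ b := hl.trans hlb.le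
  calc (1 - cdf m b) * (b * f p) = b * (f p * (1 - cdf m b)) := by ring
    _ ≤ b * (f b * (1 - cdf m p)) := by gcongr
    _ = b * f b * (1 - cdf m p) := (mul_assoc _ _ _).symm
    _ ≤ (1 - cdf m b) * (1 - cdf m p) := by gcongr

lemma opt_le_opt (h : HasIHRDensity l u m f) {b' : ℝ} (hb : IsOptimalPrice m b)
    (hb' : IsOptimalPrice m b') (hl : 0 ≤ l) (hlu : l < u) : b' ≤ b := by
  by_contra! hlt
  have hlb := h.le_opt hb
  have hbu' := h.opt_lt hb' hl hlu
  have hup := h.survival_le_of_opt_le hb hl hlt.le hbu'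
  have hlow := h.le_survival_of_le_opt hb' hl hbu' (hlb.trans_lt hlt) (hlb.trans hlt.le) le_rfl
  have hf := h.pos b' ⟨hlb.trans hlt.le, hbu'.le⟩
  exact hlt.not_ge (le_of_mul_le_mul_right (hlow.trans hup) hf)

lemma existsUnique_isOptimalPrice (h : HasIHRDensity l u m f) (hl : 0 ≤ l) (hlu : l < u) :
    ∃! b, IsOptimalPrice m b := by
  obtain ⟨b, hb⟩ := h.exists_isOptimalPrice hl hlu.le
  exact ⟨b, hb, fun b' hb' => (h.opt_le_opt hb hb' hl hlu).antisymm (h.opt_le_opt hb' hb hl hlu)⟩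

lemma isOptimalPrice_optPrice (h : HasIHRDensity l u m f) (hl : 0 ≤ l) (hlu : l ≤ u) :
    IsOptimalPrice m (optPrice m) :=
  Classical.epsilon_spec (h.exists_isOptimalPrice hl hlu)

lemma abs_cdf_sub_cdf_le (h : HasIHRDensity l u m f) (hD : 0 ≤ D)
    (hfD : ∀ p ∈ Set.Icc l u, f p ≤ D) (x y : ℝ) : |cdf m y - cdf m x| ≤ D * |y - x| := by
  rw [h.cdf_sub_cdf_eq_integral, ← Real.norm_eq_abs]
  refine intervalIntegral.norm_integral_le_of_norm_le_const fun t _ => ?_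
  rw [Real.norm_of_nonneg (h.indicator_nonneg t)]
  exact Set.indicator_le' hfD (fun _ _ => hD) t

lemma le_opt_profit (h : HasIHRDensity l u m f) (hb : IsOptimalPrice m b) (hl : 0 ≤ l)
    (hD : 0 < D) (hfD : ∀ p ∈ Set.Icc l u, f p ≤ D) : 1 / (4 * D) ≤ b * (1 - cdf m b) := by
  have hcdf := h.abs_cdf_sub_cdf_le hD.le hfD l (l + 1 / (2 * D))
  rw [h.cdf_of_le le_rfl, sub_zero, add_sub_cancel_left, abs_of_nonneg (cdf_nonneg m _),
    abs_of_pos (show 0 < 1 / (2 * D) by positivity),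
    show D * (1 / (2 * D)) = 1 / 2 by field_simp] at hcdf
  calc 1 / (4 * D) = 1 / (2 * D) * (1 - 1 / 2) := by field_simp; norm_num
    _ ≤ (l + 1 / (2 * D)) * (1 - cdf m (l + 1 / (2 * D))) := by gcongr; linarith
    _ ≤ b * (1 - cdf m b) := hb _

lemma density_le (h : HasIHRDensity l u m f) (hlu : l < u)
    (hf : ∀ p ∈ Set.Icc l u, ∀ p' ∈ Set.Icc l u, |f p - f p'| ≤ η * |p - p'|)
    (hη : 0 ≤ η) (hp : p ∈ Set.Icc l u) : f p ≤ 1 / (u - l) + η * (u - l) := by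
  have hlow : ∀ t ∈ Set.Icc l u, f p - η * (u - l) ≤ (Set.Icc l u).indicator f t := fun t ht => by
    have hdist : |p - t| ≤ u - l := abs_sub_le_of_le_of_le hp.1 hp.2 ht.1 ht.2
    rw [Set.indicator_of_mem ht]
    linarith [le_abs_self (f p - f t), hf p hp t ht, mul_le_mul_of_nonneg_left hdist hη]
  have := h.le_cdf_sub_cdf hlu.le hlow
  rw [h.cdf_of_ge le_rfl, h.cdf_of_le le_rfl, sub_zero, ← le_div_iff₀ (sub_pos.2 hlu)] at this
  linarith

end HasIHRDensity

section Noise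

variable {ε b : ℝ} {m : Measure ℝ}

lemma isProbabilityMeasure_noiseLaw (hε : 0 < ε) : IsProbabilityMeasure (noiseLaw ε) := by
  apply cond_isProbabilityMeasure_of_finite
  · simp [hε]
  · simp

lemma ae_abs_le_noiseLaw (ε : ℝ) : ∀ᵐ e ∂noiseLaw ε, |e| ≤ ε := by
  have hac : noiseLaw ε ≪ volume.restrict (Set.Icc (-ε) ε) := Measure.smul_absolutelyContinuous
  apply hac.ae_le
  filter_upwards [ae_restrict_mem measurableSet_Icc] with e he using abs_le.2 he

lemma integral_noiseLaw (hε : 0 < ε) (g : ℝ → ℝ) :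
    ∫ e, g e ∂noiseLaw ε = (∫ e in -ε..ε, g e) / (2 * ε) := by
  unfold noiseLaw ProbabilityTheory.cond
  rw [integral_smul_measure, intervalIntegral.integral_of_le (by linarith),
    integral_Icc_eq_integral_Ioc, Real.volume_Icc, ENNReal.toReal_inv,
    ENNReal.toReal_ofReal (by linarith), smul_eq_mul, sub_neg_eq_add, ← two_mul]
  ring

lemma integral_id_noiseLaw (hε : 0 < ε) : ∫ e, e ∂noiseLaw ε = 0 := by
  simp [integral_noiseLaw hε fun e => e]

lemma integral_sq_noiseLaw (hε : 0 < ε) : ∫ e, e ^ 2 ∂noiseLaw ε = ε ^ 2 / 3 := by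
  rw [integral_noiseLaw hε, integral_pow]
  field_simp
  ring

lemma integrable_noiseLaw_of_abs_le (hε : 0 < ε) {g : ℝ → ℝ} (hg : Measurable g) {C : ℝ}
    (hC : ∀ e, |e| ≤ ε → |g e| ≤ C) : Integrable g (noiseLaw ε) := by
  have := isProbabilityMeasure_noiseLaw hε
  refine .of_bound hg.aestronglyMeasurable C ?_
  filter_upwards [ae_abs_le_noiseLaw ε] with e he using hC e he

@[fun_prop]
lemma measurable_cdf (m : Measure ℝ) : Measurable (cdf m) := (monotone_cdf m).measurable

lemma abs_cdf_le_one (m : Measure ℝ) (p : ℝ) : |cdf m p| ≤ 1 :=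
  abs_le.2 ⟨by linarith [cdf_nonneg m p], cdf_le_one m p⟩

lemma integrable_survival_noiseLaw (hε : 0 < ε) (m : Measure ℝ) (b : ℝ) :
    Integrable (fun e => 1 - cdf m (b + e)) (noiseLaw ε) :=
  integrable_noiseLaw_of_abs_le hε (by fun_prop) (C := 1) fun e _ =>
    abs_le.2 ⟨by linarith [cdf_le_one m (b + e)], by linarith [cdf_nonneg m (b + e)]⟩

lemma integrable_mul_cdf_noiseLaw (hε : 0 < ε) (m : Measure ℝ) (b : ℝ) :
    Integrable (fun e => e * cdf m (b + e)) (noiseLaw ε) :=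
  integrable_noiseLaw_of_abs_le hε (by fun_prop) (C := ε * 1) fun e he => by
    rw [abs_mul]
    exact mul_le_mul he (abs_cdf_le_one m _) (abs_nonneg _) hε.le

/-- The expected quantity when the price is `b` plus uniform noise on `[-ε, ε]`. -/
def meanDemand (m : Measure ℝ) (ε b : ℝ) : ℝ := ∫ e, (1 - cdf m (b + e)) ∂noiseLaw ε

/-- Minus the slope of the linear regression of the quantity on the price, when the price is `b`
plus uniform noise on `[-ε, ε]`. -/
def demandSlope (m : Measure ℝ) (ε b : ℝ) : ℝ := (∫ e, e * cdf m (b + e) ∂noiseLaw ε) / (ε ^ 2 / 3)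

lemma meanDemand_nonneg (m : Measure ℝ) (ε b : ℝ) : 0 ≤ meanDemand m ε b :=
  integral_nonneg fun e => sub_nonneg.2 (cdf_le_one m (b + e))

lemma meanDemand_le_one (hε : 0 < ε) (m : Measure ℝ) (b : ℝ) : meanDemand m ε b ≤ 1 := by
  have := isProbabilityMeasure_noiseLaw hε
  calc meanDemand m ε b ≤ ∫ _, 1 ∂noiseLaw ε :=
        integral_mono (integrable_survival_noiseLaw hε m b) (integrable_const 1)
          fun e => sub_le_self 1 (cdf_nonneg m (b + e))
    _ = 1 := by simp

lemma abs_meanDemand_sub_le (hε : 0 < ε) {D : ℝ} (hD : 0 ≤ D)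
    (hF : ∀ x y, |cdf m y - cdf m x| ≤ D * |y - x|) (b : ℝ) :
    |meanDemand m ε b - (1 - cdf m b)| ≤ D * ε := by
  have := isProbabilityMeasure_noiseLaw hε
  have heq : meanDemand m ε b - (1 - cdf m b)
      = ∫ e, (1 - cdf m (b + e) - (1 - cdf m b)) ∂noiseLaw ε := by
    rw [integral_sub (integrable_survival_noiseLaw hε m b) (integrable_const _)]
    simp [meanDemand]
  rw [heq, ← Real.norm_eq_abs]
  refine (norm_integral_le_of_norm_le_const (C := D * ε) ?_).trans_eq (by simp)
  filter_upwards [ae_abs_le_noiseLaw ε] with e he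
  calc ‖1 - cdf m (b + e) - (1 - cdf m b)‖ = |cdf m b - cdf m (b + e)| := by
        rw [Real.norm_eq_abs]; congr 1; ring
    _ ≤ D * |b - (b + e)| := hF _ _
    _ = D * |e| := by rw [sub_add_cancel_left, abs_neg]
    _ ≤ D * ε := by gcongr

lemma demandSlope_eq (hε : 0 < ε) (m : Measure ℝ) (b : ℝ) :
    demandSlope m ε b = (∫ e, e * (cdf m (b + e) - cdf m b) ∂noiseLaw ε) / (ε ^ 2 / 3) := by
  have hid : Integrable (fun e => e * cdf m b) (noiseLaw ε) :=
    (integrable_noiseLaw_of_abs_le hε measurable_id fun _ he => he).mul_const _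
  simp only [mul_sub]
  rw [integral_sub (integrable_mul_cdf_noiseLaw hε m b) hid, integral_mul_const,
    integral_id_noiseLaw hε, zero_mul, sub_zero, demandSlope]

lemma integrable_mul_cdf_sub_noiseLaw (hε : 0 < ε) (m : Measure ℝ) (b : ℝ) :
    Integrable (fun e => e * (cdf m (b + e) - cdf m b)) (noiseLaw ε) :=
  integrable_noiseLaw_of_abs_le hε (by fun_prop) (C := ε * (1 + 1)) fun e he => by
    rw [abs_mul]
    exact mul_le_mul he ((abs_sub _ _).trans (add_le_add (abs_cdf_le_one m _)
      (abs_cdf_le_one m _))) (abs_nonneg _) hε.le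

lemma integrable_const_mul_sq_noiseLaw (hε : 0 < ε) (d : ℝ) :
    Integrable (fun e => d * e ^ 2) (noiseLaw ε) :=
  (integrable_noiseLaw_of_abs_le hε (by fun_prop) (C := ε ^ 2) fun e he => by
    rw [abs_pow]; gcongr).const_mul d

end Noise

namespace HasIHRDensity

variable {l u η ε b p D d : ℝ} {m : Measure ℝ} {f : ℝ → ℝ}

lemma mul_cdf_sub_cdf_le (h : HasIHRDensity l u m f) {e : ℝ} (he : |e| ≤ ε)
    (hd : ∀ t ∈ Set.Icc (b - ε) (b + ε), (Set.Icc l u).indicator f t ≤ d) :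
    e * (cdf m (b + e) - cdf m b) ≤ d * e ^ 2 := by
  obtain ⟨he1, he2⟩ := abs_le.1 he
  rcases le_total 0 e with he0 | he0
  · have := h.cdf_sub_cdf_le (show b ≤ b + e by linarith)
      fun t ht => hd t ⟨by linarith [ht.1], by linarith [ht.2]⟩
    nlinarith
  · have := h.cdf_sub_cdf_le (show b + e ≤ b by linarith)
      fun t ht => hd t ⟨by linarith [ht.1], by linarith [ht.2]⟩
    nlinarith

lemma le_mul_cdf_sub_cdf (h : HasIHRDensity l u m f) {e : ℝ} (he : |e| ≤ ε)
    (hd : ∀ t ∈ Set.Icc (b - ε) (b + ε), d ≤ (Set.Icc l u).indicator f t) :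
    d * e ^ 2 ≤ e * (cdf m (b + e) - cdf m b) := by
  obtain ⟨he1, he2⟩ := abs_le.1 he
  rcases le_total 0 e with he0 | he0
  · have := h.le_cdf_sub_cdf (show b ≤ b + e by linarith)
      fun t ht => hd t ⟨by linarith [ht.1], by linarith [ht.2]⟩
    nlinarith
  · have := h.le_cdf_sub_cdf (show b + e ≤ b by linarith)
      fun t ht => hd t ⟨by linarith [ht.1], by linarith [ht.2]⟩
    nlinarith

lemma demandSlope_le (h : HasIHRDensity l u m f) (hε : 0 < ε)
    (hd : ∀ t ∈ Set.Icc (b - ε) (b + ε), (Set.Icc l u).indicator f t ≤ d) :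
    demandSlope m ε b ≤ d := by
  rw [demandSlope_eq hε, div_le_iff₀ (by positivity), ← integral_sq_noiseLaw hε,
    ← integral_const_mul]
  refine integral_mono_ae (integrable_mul_cdf_sub_noiseLaw hε m b)
    (integrable_const_mul_sq_noiseLaw hε d) ?_
  filter_upwards [ae_abs_le_noiseLaw ε] with e he using h.mul_cdf_sub_cdf_le he hd

lemma le_demandSlope (h : HasIHRDensity l u m f) (hε : 0 < ε)
    (hd : ∀ t ∈ Set.Icc (b - ε) (b + ε), d ≤ (Set.Icc l u).indicator f t) :
    d ≤ demandSlope m ε b := by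
  rw [demandSlope_eq hε, le_div_iff₀ (by positivity), ← integral_sq_noiseLaw hε,
    ← integral_const_mul]
  refine integral_mono_ae (integrable_const_mul_sq_noiseLaw hε d)
    (integrable_mul_cdf_sub_noiseLaw hε m b) ?_
  filter_upwards [ae_abs_le_noiseLaw ε] with e he using h.le_mul_cdf_sub_cdf he hd

lemma demandSlope_nonneg (h : HasIHRDensity l u m f) (hε : 0 < ε) (p : ℝ) :
    0 ≤ demandSlope m ε p :=
  h.le_demandSlope hε fun t _ => h.indicator_nonneg t

lemma meanDemand_sub_le_of_opt_add_le (h : HasIHRDensity l u m f) (hb : IsOptimalPrice m b)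
    (hl : 0 ≤ l) (hlu : l < u) (hε : 0 < ε) (hη : 0 ≤ η) (hD : 0 ≤ D)
    (hfD : ∀ p ∈ Set.Icc l u, f p ≤ D)
    (hf : ∀ p ∈ Set.Icc l u, ∀ p' ∈ Set.Icc l u, |f p - f p'| ≤ η * |p - p'|)
    (hbp : b + ε ≤ p) : meanDemand m ε p - b * demandSlope m ε p ≤ (2 * D + u * η) * ε := by
  have hlb := h.le_opt hb
  have hb0 := hl.trans hlb
  have hbu := h.opt_lt hb hl hlu
  have hA := (abs_le.1 (abs_meanDemand_sub_le hε hD (h.abs_cdf_sub_cdf_le hD hfD) p)).2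
  have huη : 0 ≤ u * η * ε := by have := hb0.trans hbu.le; positivity
  have hDε : 0 ≤ D * ε := by positivity
  rcases le_or_gt p (u - ε) with hpu | hup
  · have hG : f p - η * ε ≤ demandSlope m ε p := h.le_demandSlope hε fun t ht => by
      have htmem : t ∈ Set.Icc l u := ⟨by linarith [ht.1], by linarith [ht.2]⟩
      have hdist : |p - t| ≤ ε := abs_le.2 ⟨by linarith [ht.2], by linarith [ht.1]⟩
      rw [Set.indicator_of_mem htmem]
      linarith [le_abs_self (f p - f t), mul_le_mul_of_nonneg_left hdist hη,
        hf p ⟨by linarith, by linarith⟩ t htmem]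
    have hS := h.survival_le_of_opt_le hb hl (show b ≤ p by linarith) (show p < u by linarith)
    have hbG := mul_le_mul_of_nonneg_left hG hb0
    have hbη : b * (η * ε) ≤ u * (η * ε) := by gcongr
    linarith
  · have hS : 1 - cdf m p ≤ D * ε := by
      rcases le_total u p with hup' | hpu
      · rw [h.cdf_of_ge hup']; linarith
      · have hF := h.abs_cdf_sub_cdf_le hD hfD p u
        rw [h.cdf_of_ge le_rfl, abs_of_nonneg (sub_nonneg.2 hpu)] at hF
        calc 1 - cdf m p ≤ D * (u - p) := (le_abs_self _).trans hF
          _ ≤ D * ε := by gcongr; linarith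
    have hbG := mul_nonneg hb0 (h.demandSlope_nonneg hε p)
    linarith

lemma le_meanDemand_sub_of_add_le_opt (h : HasIHRDensity l u m f) (hb : IsOptimalPrice m b)
    (hl : 0 ≤ l) (hlu : l < u) (hε : 0 < ε) (hη : 0 ≤ η) (hD : 0 ≤ D)
    (hfD : ∀ p ∈ Set.Icc l u, f p ≤ D)
    (hf : ∀ p ∈ Set.Icc l u, ∀ p' ∈ Set.Icc l u, |f p - f p'| ≤ η * |p - p'|)
    (hpb : p + ε < b) : -((D + u * η) * ε) ≤ meanDemand m ε p - b * demandSlope m ε p := by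
  have hlb := h.le_opt hb
  have hb0 := hl.trans hlb
  have hbu := h.opt_lt hb hl hlu
  have hA := (abs_le.1 (abs_meanDemand_sub_le hε hD (h.abs_cdf_sub_cdf_le hD hfD) p)).1
  rcases hlb.eq_or_lt with rfl | hlb
  · have hG : demandSlope m ε p ≤ 0 := h.demandSlope_le hε fun t ht =>
      (Set.indicator_of_notMem (fun ht' => by linarith [ht.2, ht'.1]) f).le
    have hu0 := hb0.trans hlu.le
    have : 0 ≤ (D + u * η) * ε := by positivity
    linarith [meanDemand_nonneg m ε p, mul_nonpos_of_nonneg_of_nonpos hb0 hG]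
  · set p' := max p l
    have hp' : p' ∈ Set.Icc l u := ⟨le_max_right _ _, max_le (by linarith) hlu.le⟩
    have hf0 := h.pos p' hp'
    have hG : demandSlope m ε p ≤ f p' + η * ε := h.demandSlope_le hε fun t ht => by
      by_cases htmem : t ∈ Set.Icc l u
      · have hdist : |t - p'| ≤ ε := abs_le.2 ⟨by
          linarith [max_le (show p ≤ t + ε by linarith [ht.1]) (show l ≤ t + ε by
            linarith [htmem.1])], by linarith [ht.2, le_max_left p l]⟩
        rw [Set.indicator_of_mem htmem]
        linarith [le_abs_self (f t - f p'), mul_le_mul_of_nonneg_left hdist hη,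
          hf t htmem p' hp']
      · rw [Set.indicator_of_notMem htmem]
        positivity
    have hS := h.le_survival_of_le_opt hb hl hbu hlb hp'.1 (max_le (by linarith) hlb.le)
    have hcdf : cdf m p ≤ cdf m p' := monotone_cdf m (le_max_left _ _)
    have hbG := mul_le_mul_of_nonneg_left hG hb0
    have hbη : b * (η * ε) ≤ u * (η * ε) := by gcongr
    linarith

lemma sub_mul_meanDemand_sub_le (h : HasIHRDensity l u m f) (hb : IsOptimalPrice m b)
    (hl : 0 ≤ l) (hlu : l < u) (hε : 0 < ε) (hη : 0 ≤ η) (hD : 0 ≤ D)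
    (hfD : ∀ p ∈ Set.Icc l u, f p ≤ D)
    (hf : ∀ p ∈ Set.Icc l u, ∀ p' ∈ Set.Icc l u, |f p - f p'| ≤ η * |p - p'|)
    {P : ℝ} (hp : p ∈ Set.Icc 0 P) (huP : u ≤ P) :
    (p - b) * (meanDemand m ε p - b * demandSlope m ε p)
      ≤ (1 + P * D + P * (2 * D + u * η)) * ε := by
  have hb0 : 0 ≤ b := hl.trans (h.le_opt hb)
  have hbu := h.opt_lt hb hl hlu
  have hu0 : 0 ≤ u := hb0.trans hbu.le
  have hP0 : 0 ≤ P := hu0.trans huP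
  have hPD : 0 ≤ (1 + P * D) * ε := by positivity
  have hfar : 0 ≤ P * (2 * D + u * η) * ε := by positivity
  rcases le_or_gt (b + ε) p with hbp | hpb
  · have hright := h.meanDemand_sub_le_of_opt_add_le hb hl hlu hε hη hD hfD hf hbp
    calc _ ≤ (p - b) * ((2 * D + u * η) * ε) :=
          mul_le_mul_of_nonneg_left hright (by linarith)
      _ ≤ P * ((2 * D + u * η) * ε) := by gcongr; linarith [hp.2]
      _ ≤ _ := by linarith
  rcases lt_or_ge (p + ε) b with hpb' | hbp'
  · have hleft := h.le_meanDemand_sub_of_add_le_opt hb hl hlu hε hη hD hfD hf hpb'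
    calc _ = (b - p) * -(meanDemand m ε p - b * demandSlope m ε p) := by ring
      _ ≤ (b - p) * ((D + u * η) * ε) :=
          mul_le_mul_of_nonneg_left (by linarith) (by linarith)
      _ ≤ P * ((2 * D + u * η) * ε) := by gcongr <;> linarith [hp.1]
      _ ≤ _ := by linarith
  · have hG : demandSlope m ε p ≤ D := h.demandSlope_le hε fun t _ =>
      Set.indicator_apply_le' (fun ht => hfD t ht) fun _ => hD
    have hbG : b * demandSlope m ε p ≤ P * D :=
      mul_le_mul (hbu.le.trans huP) hG (h.demandSlope_nonneg hε p) hP0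
    have hbG0 : 0 ≤ b * demandSlope m ε p := mul_nonneg hb0 (h.demandSlope_nonneg hε p)
    have hmiss : |meanDemand m ε p - b * demandSlope m ε p| ≤ 1 + P * D := abs_le.2
      ⟨by linarith [meanDemand_nonneg m ε p], by linarith [meanDemand_le_one hε m p]⟩
    calc _ ≤ |p - b| * |meanDemand m ε p - b * demandSlope m ε p| :=
          (le_abs_self _).trans (abs_mul _ _).le
      _ ≤ ε * (1 + P * D) :=
          mul_le_mul (abs_le.2 ⟨by linarith, by linarith⟩) hmiss (abs_nonneg _) hε.le
      _ ≤ _ := by linarith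

end HasIHRDensity

/-- The restriction of a demand class to the quantitative properties on which the stability of
least-squares learning rests: the optimum lies in `[lo, hi] × [lo, 1]`, demand is Lipschitz, and the
linear demand through the optimum with the regression slope at another price misses the mean
quantity in the direction that pushes the estimated price back to the optimum, up to `O(ε)`. -/
structure HasStableDemand (lo hi L : ℝ) (m : Measure ℝ) : Prop where
  opt_mem : optPrice m ∈ Set.Icc lo hi
  lo_le_optQuantity : lo ≤ optQuantity m
  lipschitz : ∀ x y, |cdf m y - cdf m x| ≤ L * |y - x|
  sign : ∀ ε > 0, ∀ p ∈ Set.Icc 0 (2 * hi),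
    (p - optPrice m) * (meanDemand m ε p - optPrice m * demandSlope m ε p) ≤ L * ε

lemma exists_hasStableDemand {l u η : ℝ} (hl : 0 ≤ l) (hlu : l < u) (hη : 0 ≤ η) :
    ∃ lo hi L : ℝ, 0 < lo ∧ lo ≤ 1 ∧ 1 ≤ hi ∧ 0 ≤ L ∧
      ∀ m ∈ lipschitzIHR l u η, HasStableDemand lo hi L m := by
  set D := 1 / (u - l) + η * (u - l)
  have := sub_pos.2 hlu
  have hD : 0 < D := by positivity
  have hu : 0 < u := hl.trans_lt hlu
  set hi := max 1 u
  have hhi : 1 ≤ hi := le_max_left _ _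
  have huhi : u ≤ hi := le_max_right _ _
  set L := 1 + 2 * hi * D + 2 * hi * (2 * D + u * η)
  have hDL : D ≤ L := by
    have : 1 * D ≤ hi * D := by gcongr
    have : 0 ≤ 2 * hi * (2 * D + u * η) := by positivity
    linarith
  refine ⟨min 1 (1 / (4 * D) / hi), hi, L, by positivity, min_le_left _ _, hhi, hD.le.trans hDL,
    fun m ⟨f, h, hf⟩ => ?_⟩
  have hb := h.isOptimalPrice_optPrice hl hlu.le
  have hfD : ∀ p ∈ Set.Icc l u, f p ≤ D := fun p hp => h.density_le hlu hf hη hp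
  have hprofit := h.le_opt_profit hb hl hD hfD
  have hbu := h.opt_lt hb hl hlu
  have hb0 := h.opt_pos hb hl hlu
  have hS0 := h.survival_pos hbu
  refine ⟨⟨(min_le_right _ _).trans ?_, hbu.le.trans huhi⟩, (min_le_right _ _).trans ?_,
    fun x y => (h.abs_cdf_sub_cdf_le hD.le hfD x y).trans (by gcongr),
    fun ε hε p hp => h.sub_mul_meanDemand_sub_le hb hl hlu hε hη hD.le hfD hf hp (by linarith)⟩
  · calc 1 / (4 * D) / hi ≤ 1 / (4 * D) := div_le_self (by positivity) hhi
      _ ≤ optPrice m * (1 - cdf m (optPrice m)) := hprofit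
      _ ≤ optPrice m := mul_le_of_le_one_right hb0.le (by linarith [cdf_nonneg m (optPrice m)])
  · rw [div_le_iff₀ (by positivity)]
    calc 1 / (4 * D) ≤ optPrice m * (1 - cdf m (optPrice m)) := hprofit
      _ ≤ hi * optQuantity m := mul_le_mul_of_nonneg_right (hbu.le.trans huhi) hS0.le
      _ = optQuantity m * hi := mul_comm _ _

/-- The relative entropy `x - x₀ - x₀ log (x / x₀)` of two positive numbers, which vanishes only at
`x = x₀` and blows up as `x → 0` and as `x → ∞`. -/
def entropyGap (x₀ x : ℝ) : ℝ := x - x₀ - x₀ * Real.log (x / x₀)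

section EntropyGap

variable {x₀ x v : ℝ}

lemma entropyGap_nonneg (h₀ : 0 < x₀) (hx : 0 < x) : 0 ≤ entropyGap x₀ x := by
  have hlog := Real.log_le_sub_one_of_pos (div_pos hx h₀)
  calc (0 : ℝ) = x - x₀ - x₀ * (x / x₀ - 1) := by field_simp; ring
    _ ≤ entropyGap x₀ x := by unfold entropyGap; gcongr

lemma entropyGap_le_sq_div (h₀ : 0 < x₀) (hx : 0 < x) : entropyGap x₀ x ≤ (x - x₀) ^ 2 / x := by
  have hlog := Real.one_sub_inv_le_log_of_pos (div_pos hx h₀)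
  calc entropyGap x₀ x ≤ x - x₀ - x₀ * (1 - (x / x₀)⁻¹) := by unfold entropyGap; gcongr
    _ = (x - x₀) ^ 2 / x := by field_simp

lemma half_sub_le_entropyGap (h₀ : 0 < x₀) (hx : 0 < x) : x / 2 - x₀ ≤ entropyGap x₀ x := by
  have hlog : Real.log (x / x₀) ≤ x / x₀ / 2 := by
    have hhalf := Real.log_le_sub_one_of_pos (show 0 < x / x₀ / 2 by positivity)
    rw [Real.log_div (by positivity) two_ne_zero] at hhalf
    linarith [Real.log_two_lt_d9]
  calc x / 2 - x₀ = x - x₀ - x₀ * (x / x₀ / 2) := by field_simp; ring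
    _ ≤ entropyGap x₀ x := by unfold entropyGap; gcongr

lemma le_entropyGap_of_le_exp (h₀ : 0 < x₀) (hx : 0 < x)
    (hxv : x ≤ x₀ * Real.exp (-(1 + v / x₀))) : v ≤ entropyGap x₀ x := by
  have hlog : Real.log (x / x₀) ≤ -(1 + v / x₀) := by
    rwa [Real.log_le_iff_le_exp (by positivity), div_le_iff₀' h₀]
  calc v = -x₀ - x₀ * -(1 + v / x₀) := by field_simp; ring
    _ ≤ x - x₀ - x₀ * Real.log (x / x₀) := by gcongr; linarith

lemma sq_sub_le_entropyGap {X : ℝ} (h₀ : 0 < x₀) (hx : 0 < x) (h₀X : x₀ ≤ X) (hX : x ≤ X) :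
    (x - x₀) ^ 2 ≤ 4 * X * entropyGap x₀ x := by
  obtain ⟨r, hr, rfl⟩ : ∃ r, 0 < r ∧ x = r ^ 2 := ⟨√x, by positivity, (Real.sq_sqrt hx.le).symm⟩
  obtain ⟨s, hs, rfl⟩ : ∃ s, 0 < s ∧ x₀ = s ^ 2 := ⟨√x₀, by positivity, (Real.sq_sqrt h₀.le).symm⟩
  have hlog := Real.log_le_sub_one_of_pos (div_pos hr hs)
  have hgap : (r - s) ^ 2 ≤ entropyGap (s ^ 2) (r ^ 2) := by
    rw [entropyGap, ← div_pow, Real.log_pow, Nat.cast_two]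
    calc (r - s) ^ 2 = r ^ 2 - s ^ 2 - s ^ 2 * (2 * (r / s - 1)) := by field_simp; ring
      _ ≤ r ^ 2 - s ^ 2 - s ^ 2 * (2 * Real.log (r / s)) := by gcongr
  have hsum : (r + s) ^ 2 ≤ 4 * X := by nlinarith [sq_nonneg (r - s)]
  calc (r ^ 2 - s ^ 2) ^ 2 = (r + s) ^ 2 * (r - s) ^ 2 := by ring
    _ ≤ 4 * X * entropyGap (s ^ 2) (r ^ 2) :=
      mul_le_mul hsum hgap (sq_nonneg _) ((sq_nonneg _).trans hsum)

lemma entropyGap_add_le {k : ℝ} (h₀ : 0 < x₀) (hx : 0 < x) (hk : |k| ≤ x / 2) :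
    entropyGap x₀ (x + k) ≤ entropyGap x₀ x + (1 - x₀ / x) * k + 2 * x₀ / x ^ 2 * k ^ 2 := by
  have hk' := abs_le.1 hk
  have hxk : 0 < x + k := by linarith
  have hlog : k / x - 2 * (k / x) ^ 2 ≤ Real.log ((x + k) / x) := by
    refine le_trans ?_ (Real.one_sub_inv_le_log_of_pos (div_pos hxk hx))
    have hdiff : 1 - ((x + k) / x)⁻¹ - (k / x - 2 * (k / x) ^ 2)
        = k ^ 2 * (x + 2 * k) / (x ^ 2 * (x + k)) := by
      field_simp
      ring
    have : 0 ≤ x + 2 * k := by linarith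
    rw [← sub_nonneg, hdiff]
    positivity
  have hsplit : Real.log ((x + k) / x₀) = Real.log (x / x₀) + Real.log ((x + k) / x) := by
    rw [← Real.log_mul (by positivity) (by positivity)]
    congr 1
    field_simp
  rw [entropyGap, hsplit]
  calc x + k - x₀ - x₀ * (Real.log (x / x₀) + Real.log ((x + k) / x))
      ≤ x + k - x₀ - x₀ * (Real.log (x / x₀) + (k / x - 2 * (k / x) ^ 2)) := by gcongr
    _ = entropyGap x₀ x + (1 - x₀ / x) * k + 2 * x₀ / x ^ 2 * k ^ 2 := by
      unfold entropyGap
      field_simp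
      ring

end EntropyGap

lemma max_add_sq_le (t h : ℝ) : max (t + h) 0 ^ 2 ≤ max t 0 ^ 2 + 2 * max t 0 * h + h ^ 2 := by
  rcases max_cases t 0 with ⟨ht, _⟩ | ⟨ht, _⟩ <;>
  rcases max_cases (t + h) 0 with ⟨hth, _⟩ | ⟨hth, _⟩ <;> rw [ht, hth] <;> nlinarith

/-- The Lyapunov function of the mean dynamics, in the estimated optimal price `b`, minus the
estimated slope `y`, the true optimal price `b₀` and the true optimal profit `w₀`. The profit
`b ^ 2 * y` predicted by the linear model drifts towards `b * (1 - F b)`, so that the entropy term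
decreases except for an error of order `(b - b₀) ^ 2`, which the other two terms absorb. -/
def lyapunov (K E b₀ w₀ b y : ℝ) : ℝ :=
  K * max (b₀ - b) 0 ^ 2 + E * y * max (b - b₀) 0 ^ 2 + entropyGap w₀ (b ^ 2 * y)

/-- The derivative of `lyapunov` at `(b, y)` in the direction `((α + b * γ) / (2 * y), -γ)`, in
which a least-squares update moves the price and the slope. -/
def lyapunovDeriv (K E b₀ w₀ b y α γ : ℝ) : ℝ :=
  (E * max (b - b₀) 0 - K * max (b₀ - b) 0 / y) * (α + b * γ) - E * max (b - b₀) 0 ^ 2 * γ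
    + (1 - w₀ / (b ^ 2 * y)) * (b * α)

section Step

variable {K E b₀ w₀ b y α γ d : ℝ}

lemma max_sub_step_sq_le (hy : 0 < y) (hd : d * (2 * (y - γ)) = α + b * γ) :
    max (b₀ - (b + d)) 0 ^ 2 ≤ max (b₀ - b) 0 ^ 2 - max (b₀ - b) 0 / y * (α + b * γ)
      + (d ^ 2 - 2 * max (b₀ - b) 0 * γ * d / y) := by
  have hsq := max_add_sq_le (b₀ - b) (-d)
  have hlin : max (b₀ - b) 0 / y * (α + b * γ) + 2 * max (b₀ - b) 0 * γ * d / y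
      = 2 * max (b₀ - b) 0 * d := by
    rw [← hd]
    field_simp
    ring
  rw [show b₀ - b + -d = b₀ - (b + d) by ring] at hsq
  linarith

lemma mul_max_step_sub_sq_le (hyγ : γ ≤ y) (hd : d * (2 * (y - γ)) = α + b * γ) :
    (y - γ) * max (b + d - b₀) 0 ^ 2 ≤ y * max (b - b₀) 0 ^ 2 + max (b - b₀) 0 * (α + b * γ)
      - max (b - b₀) 0 ^ 2 * γ + (y - γ) * d ^ 2 := by
  have hsq := mul_le_mul_of_nonneg_left (max_add_sq_le (b - b₀) d) (sub_nonneg.2 hyγ)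
  rw [show b - b₀ + d = b + d - b₀ by ring] at hsq
  rw [← hd]
  linarith

lemma lyapunov_step_le (hK : 0 ≤ K) (hE : 0 ≤ E) (hw₀ : 0 < w₀) (hb : 0 < b) (hy : 0 < y)
    (hyγ : γ ≤ y) (hd : d * (2 * (y - γ)) = α + b * γ)
    (hk : |b * α + (y - γ) * d ^ 2| ≤ b ^ 2 * y / 2) :
    lyapunov K E b₀ w₀ (b + d) (y - γ) ≤ lyapunov K E b₀ w₀ b y + lyapunovDeriv K E b₀ w₀ b y α γ
      + (K * (d ^ 2 - 2 * max (b₀ - b) 0 * γ * d / y) + E * ((y - γ) * d ^ 2) + (y - γ) * d ^ 2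
        + 2 * w₀ / (b ^ 2 * y) ^ 2 * (b * α + (y - γ) * d ^ 2) ^ 2) := by
  have hleft := mul_le_mul_of_nonneg_left (max_sub_step_sq_le (b₀ := b₀) hy hd) hK
  have hright := mul_le_mul_of_nonneg_left (mul_max_step_sub_sq_le (b₀ := b₀) hyγ hd) hE
  have hprofit : (b + d) ^ 2 * (y - γ) = b ^ 2 * y + (b * α + (y - γ) * d ^ 2) := by
    linear_combination b * hd
  have hgap := entropyGap_add_le hw₀ (by positivity) hk
  have hdrop : (1 - w₀ / (b ^ 2 * y)) * ((y - γ) * d ^ 2) ≤ (y - γ) * d ^ 2 :=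
    mul_le_of_le_one_left (mul_nonneg (sub_nonneg.2 hyγ) (sq_nonneg d))
      (sub_le_self 1 (by positivity))
  unfold lyapunov lyapunovDeriv
  rw [hprofit, mul_div_assoc K]
  linarith

end Step

/-- Constants for the stability analysis of the demand classes of `HasStableDemand`: the weights
`K` and `E` of the Lyapunov function, an upper bound `R` of its value at the point to which
estimates are reset, the range `[y₁, y₂]` of minus the slope of admissible estimates, and a bound
`M` on the size of everything. Prices of admissible estimates range over `[lo / 4, 2 * hi]`, and
estimates are reset to the price `lo / 2` and the slope `-1`. -/
structure LyapunovConstants (lo hi L : ℝ) where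
  (K E R y₁ y₂ M : ℝ)
  lo_pos : 0 < lo
  lo_le_one : lo ≤ 1
  one_le_hi : 1 ≤ hi
  L_nonneg : 0 ≤ L
  K_drift : 32 * (1 + 2 * hi * L) ^ 2 * hi ≤ K * lo ^ 3
  K_exit : 16 * hi ^ 2 ≤ K * lo ^ 4
  le_R : K * hi ^ 2 + 4 * hi ^ 2 / lo ^ 2 ≤ R
  y₁_pos : 0 < y₁
  y₁_exit : 4 * hi ^ 2 * y₁ ≤ lo ^ 2 * Real.exp (-(1 + R / lo ^ 2))
  y₂_exit : 32 * (R + hi) ≤ lo ^ 2 * y₂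
  E_drift : 32 * (1 + 2 * hi * L) ^ 2 ≤ E * y₁ ^ 2 * lo ^ 2
  E_exit : 2 * R ≤ E * y₁
  K_le : K ≤ M
  E_le : E ≤ M
  hi_le : 2 * hi ≤ M
  L_le : 1 + 2 * hi * L ≤ M
  y₂_le : y₂ + 1 ≤ M
  le_M : 16 ≤ M * (lo ^ 2 * y₁)

lemma nonempty_lyapunovConstants {lo hi L : ℝ} (hlo : 0 < lo) (hlo1 : lo ≤ 1) (hhi : 1 ≤ hi)
    (hL : 0 ≤ L) : Nonempty (LyapunovConstants lo hi L) := by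
  obtain ⟨K, hK⟩ : ∃ K, max (32 * (1 + 2 * hi * L) ^ 2 * hi / lo ^ 3) (16 * hi ^ 2 / lo ^ 4) ≤ K :=
    ⟨_, le_rfl⟩
  rw [max_le_iff, div_le_iff₀ (by positivity), div_le_iff₀ (by positivity)] at hK
  set R := K * hi ^ 2 + 4 * hi ^ 2 / lo ^ 2
  set y₁ := lo ^ 2 * Real.exp (-(1 + R / lo ^ 2)) / (4 * hi ^ 2) with hy₁
  have hy₁_pos : 0 < y₁ := by positivity
  set y₂ := 32 * (R + hi) / lo ^ 2 with hy₂
  obtain ⟨E, hE⟩ : ∃ E, max (32 * (1 + 2 * hi * L) ^ 2 / (y₁ ^ 2 * lo ^ 2)) (2 * R / y₁) ≤ E :=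
    ⟨_, le_rfl⟩
  rw [max_le_iff, div_le_iff₀ (by positivity), div_le_iff₀ hy₁_pos, ← mul_assoc] at hE
  obtain ⟨M, hM⟩ := (Set.finite_range
    ![K, E, 2 * hi, 1 + 2 * hi * L, y₂ + 1, 16 / (lo ^ 2 * y₁)]).bddAbove
  have hM' : ∀ i, ![K, E, 2 * hi, 1 + 2 * hi * L, y₂ + 1, 16 / (lo ^ 2 * y₁)] i ≤ M :=
    fun i => hM (Set.mem_range_self i)
  refine ⟨⟨K, E, R, y₁, y₂, M, hlo, hlo1, hhi, hL, hK.1, hK.2, le_rfl, hy₁_pos, ?_, ?_, hE.1, hE.2,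
    hM' 0, hM' 1, hM' 2, hM' 3, hM' 4, (div_le_iff₀ (by positivity)).1 (hM' 5)⟩⟩
  · rw [hy₁, mul_div_cancel₀ _ (by positivity)]
  · rw [hy₂, mul_div_cancel₀ _ (by positivity)]

namespace LyapunovConstants

variable {lo hi L : ℝ} (c : LyapunovConstants lo hi L)

/-- The range of the optimal price `b` and of minus the slope `y` of an estimated linear demand
within which the projection facility keeps the estimates. -/
structure Admissible (b y : ℝ) : Prop where
  le_price : lo / 4 ≤ b
  price_le : b ≤ 2 * hi
  le_slope : c.y₁ ≤ y
  slope_le : y ≤ c.y₂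

lemma two_le_M : 2 ≤ c.M := by linarith [c.one_le_hi, c.hi_le]

lemma M_pos : 0 < c.M := by linarith [c.two_le_M]

lemma two_le_M_cube : 2 ≤ c.M ^ 3 := by
  nlinarith [c.two_le_M, one_le_pow₀ (show 1 ≤ c.M by linarith [c.two_le_M]) (n := 2)]

lemma sixteen_mul_sq_le_K : 16 * hi ^ 2 ≤ c.K := by
  have hK : 0 ≤ c.K :=
    nonneg_of_mul_nonneg_left ((by positivity : 0 ≤ 16 * hi ^ 2).trans c.K_exit)
      (pow_pos c.lo_pos 4)
  exact c.K_exit.trans (mul_le_of_le_one_right hK (pow_le_one₀ c.lo_pos.le c.lo_le_one))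

lemma sixteen_le_K : 16 ≤ c.K := by nlinarith [c.sixteen_mul_sq_le_K, c.one_le_hi]

lemma sixteen_le_R : 16 ≤ c.R := by
  have hK : 16 ≤ c.K * hi ^ 2 := by nlinarith [c.sixteen_le_K, one_le_pow₀ c.one_le_hi (n := 2)]
  have : 0 ≤ 4 * hi ^ 2 / lo ^ 2 := by positivity
  linarith [c.le_R]

lemma E_pos : 0 < c.E :=
  pos_of_mul_pos_left (by linarith [c.E_exit, c.sixteen_le_R]) c.y₁_pos.le

lemma L_le_M : L ≤ c.M := by nlinarith [c.L_le, c.one_le_hi, c.L_nonneg]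

lemma y₁_lt : c.y₁ < lo / (2 * hi) := by
  have hexp : lo ^ 2 * Real.exp (-(1 + c.R / lo ^ 2)) ≤ lo ^ 2 := by
    refine mul_le_of_le_one_right (sq_nonneg _) (Real.exp_le_one_iff.2 ?_)
    have : 0 ≤ c.R / lo ^ 2 := div_nonneg (by linarith [c.sixteen_le_R]) (sq_nonneg _)
    linarith
  have hlo := c.lo_pos
  have hhi := c.one_le_hi
  have hy₁ := c.y₁_pos
  have hlo2 : lo ^ 2 ≤ lo := pow_le_of_le_one hlo.le c.lo_le_one two_ne_zero
  have hhi2 : hi * c.y₁ ≤ hi ^ 2 * c.y₁ := by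
    gcongr
    exact le_self_pow₀ hhi two_ne_zero
  rw [lt_div_iff₀ (by positivity)]
  linarith [c.y₁_exit, mul_pos (zero_lt_one.trans_le hhi) hy₁]

lemma y₁_le_one : c.y₁ ≤ 1 :=
  c.y₁_lt.le.trans (div_le_one_of_le₀ (by linarith [c.lo_le_one, c.one_le_hi])
    (by linarith [c.one_le_hi]))

lemma one_le_y₂ : 1 ≤ c.y₂ := by
  nlinarith [c.y₂_exit, c.sixteen_le_R, c.one_le_hi, c.lo_pos, c.lo_le_one,
    pow_le_one₀ c.lo_pos.le c.lo_le_one (n := 2)]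

lemma sixteen_le_M_mul_y₁ : 16 ≤ c.M * c.y₁ :=
  c.le_M.trans (mul_le_mul_of_nonneg_left
    (mul_le_of_le_one_left c.y₁_pos.le (pow_le_one₀ c.lo_pos.le c.lo_le_one)) c.M_pos.le)

lemma sixteen_le_M_mul_lo : 16 ≤ c.M * lo := by
  refine c.le_M.trans (mul_le_mul_of_nonneg_left ?_ c.M_pos.le)
  calc lo ^ 2 * c.y₁ ≤ lo ^ 2 * 1 := by gcongr; exact c.y₁_le_one
    _ ≤ lo := by nlinarith [c.lo_pos, c.lo_le_one]

lemma two_mul_sq_mul_lt_of_mul_le_one {s : ℝ} (hs : 4 * c.M ^ 6 * s ≤ 1) :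
    2 * c.M ^ 2 * s < lo / 4 := by
  have hM := c.M_pos
  have hMlo : 16 * 2 ^ 3 ≤ lo * c.M ^ 4 := by
    calc 16 * 2 ^ 3 ≤ c.M * lo * c.M ^ 3 :=
          mul_le_mul c.sixteen_le_M_mul_lo (pow_le_pow_left₀ zero_le_two c.two_le_M 3)
            (by positivity) (by linarith [c.sixteen_le_M_mul_lo])
      _ = lo * c.M ^ 4 := by ring
  refine lt_of_mul_lt_mul_right (a := 2 * c.M ^ 4) ?_ (by positivity)
  calc 2 * c.M ^ 2 * s * (2 * c.M ^ 4) = 4 * c.M ^ 6 * s := by ring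
    _ < lo / 4 * (2 * c.M ^ 4) := by linarith

namespace Admissible

variable {c} {b y : ℝ} (hby : c.Admissible b y)

include hby

lemma price_pos : 0 < b := (div_pos c.lo_pos four_pos).trans_le hby.le_price

lemma slope_pos : 0 < y := c.y₁_pos.trans_le hby.le_slope

lemma price_le_M : b ≤ c.M := hby.price_le.trans c.hi_le

lemma slope_add_one_le_M : y + 1 ≤ c.M := by linarith [c.y₂_le, hby.slope_le]

lemma slope_le_M : y ≤ c.M := by linarith [hby.slope_add_one_le_M]

lemma one_div_slope_le_M : 1 / y ≤ c.M := by
  rw [div_le_iff₀ hby.slope_pos]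
  nlinarith [c.sixteen_le_M_mul_y₁, hby.le_slope, c.M_pos]

lemma lo_sq_mul_le_profit : lo ^ 2 * y / 16 ≤ b ^ 2 * y := by
  calc lo ^ 2 * y / 16 = (lo / 4) ^ 2 * y := by ring
    _ ≤ b ^ 2 * y := by
      have := hby.slope_pos
      have := c.lo_pos
      gcongr
      exact hby.le_price

lemma profit_pos : 0 < b ^ 2 * y := mul_pos (pow_pos hby.price_pos 2) hby.slope_pos

lemma one_div_profit_le_M : 1 / (b ^ 2 * y) ≤ c.M := by
  rw [div_le_iff₀ hby.profit_pos]
  have hM := c.M_pos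
  calc (1 : ℝ) ≤ c.M * (lo ^ 2 * c.y₁) / 16 := by linarith [c.le_M]
    _ = c.M * (lo ^ 2 * c.y₁ / 16) := by ring
    _ ≤ c.M * (lo ^ 2 * y / 16) := by gcongr; exact hby.le_slope
    _ ≤ c.M * (b ^ 2 * y) := by gcongr; exact hby.lo_sq_mul_le_profit

lemma profit_le : b ^ 2 * y ≤ c.M ^ 3 := by
  have := hby.price_pos
  have := hby.slope_pos
  calc b ^ 2 * y ≤ c.M ^ 2 * c.M := by gcongr; exacts [hby.price_le_M, hby.slope_le_M]
    _ = c.M ^ 3 := by ring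

variable {b₀ w₀ : ℝ}

lemma max_opt_sub_le (hb₀ : b₀ ∈ Set.Icc lo hi) : max (b₀ - b) 0 ≤ c.M :=
  max_le (by linarith [hb₀.2, hby.price_pos, c.hi_le, c.one_le_hi]) c.M_pos.le

lemma max_sub_opt_le (hb₀ : b₀ ∈ Set.Icc lo hi) : max (b - b₀) 0 ≤ c.M :=
  max_le (by linarith [hb₀.1, hby.price_le_M, c.lo_pos]) c.M_pos.le

end Admissible

end LyapunovConstants

namespace LyapunovConstants.Admissible

variable {lo hi L b₀ w₀ b y α γ s : ℝ} {c : LyapunovConstants lo hi L}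

lemma abs_add_mul_le (hby : c.Admissible b y) (hα : |α| ≤ s) (hγ : |γ| ≤ s) :
    |α + b * γ| ≤ 2 * c.M * s := by
  have hs : 0 ≤ s := (abs_nonneg _).trans hα
  calc |α + b * γ| ≤ |α| + |b * γ| := abs_add_le _ _
    _ = |α| + b * |γ| := by rw [abs_mul, abs_of_pos hby.price_pos]
    _ ≤ s + c.M * s := add_le_add hα (mul_le_mul hby.price_le_M hγ (abs_nonneg γ) c.M_pos.le)
    _ ≤ 2 * c.M * s := by nlinarith [c.two_le_M]

lemma abs_price_coeff_le (hby : c.Admissible b y) (hb₀ : b₀ ∈ Set.Icc lo hi) :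
    |c.E * max (b - b₀) 0 - c.K * max (b₀ - b) 0 / y| ≤ c.M ^ 2 + c.M ^ 3 := by
  have := c.two_le_M
  have := c.E_pos
  have := c.sixteen_le_K
  have := hby.slope_pos
  calc |c.E * max (b - b₀) 0 - c.K * max (b₀ - b) 0 / y|
      ≤ c.E * max (b - b₀) 0 + c.K * max (b₀ - b) 0 * (1 / y) := by
        rw [div_eq_mul_one_div]
        refine (abs_sub _ _).trans_eq ?_
        rw [abs_of_nonneg (by positivity), abs_of_nonneg (by positivity)]
    _ ≤ c.M * c.M + c.M * c.M * c.M := by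
        gcongr
        exacts [c.E_le, hby.max_sub_opt_le hb₀, c.K_le, hby.max_opt_sub_le hb₀,
          hby.one_div_slope_le_M]
    _ = c.M ^ 2 + c.M ^ 3 := by ring

lemma abs_profit_coeff_le (hby : c.Admissible b y) (hw₀ : w₀ ∈ Set.Icc (lo ^ 2) hi) :
    |1 - w₀ / (b ^ 2 * y)| ≤ 1 + c.M ^ 2 := by
  have := c.two_le_M
  have := hby.profit_pos
  have hw₀_nonneg : 0 ≤ w₀ := (sq_nonneg lo).trans hw₀.1
  calc |1 - w₀ / (b ^ 2 * y)| ≤ 1 + w₀ * (1 / (b ^ 2 * y)) := by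
        rw [div_eq_mul_one_div]
        refine (abs_sub _ _).trans_eq ?_
        rw [abs_one, abs_of_nonneg (by positivity)]
    _ ≤ 1 + c.M * c.M := by
        gcongr
        exacts [by linarith [hw₀.2, c.hi_le, c.one_le_hi], hby.one_div_profit_le_M]
    _ = 1 + c.M ^ 2 := by ring

lemma abs_lyapunovDeriv_le (hby : c.Admissible b y) (hb₀ : b₀ ∈ Set.Icc lo hi)
    (hw₀ : w₀ ∈ Set.Icc (lo ^ 2) hi) (hα : |α| ≤ s) (hγ : |γ| ≤ s) :
    |lyapunovDeriv c.K c.E b₀ w₀ b y α γ| ≤ 7 * c.M ^ 4 * s := by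
  have hs : 0 ≤ s := (abs_nonneg _).trans hα
  have hM := c.two_le_M
  have hslope : |c.E * max (b - b₀) 0 ^ 2 * γ| ≤ c.M * c.M ^ 2 * s := by
    have := c.E_pos
    rw [abs_mul, abs_of_nonneg (by positivity)]
    gcongr
    exacts [c.E_le, hby.max_sub_opt_le hb₀]
  have hprofit : |b * α| ≤ c.M * s := by
    rw [abs_mul, abs_of_pos hby.price_pos]
    exact mul_le_mul hby.price_le_M hα (abs_nonneg α) c.M_pos.le
  calc |lyapunovDeriv c.K c.E b₀ w₀ b y α γ|
      ≤ |(c.E * max (b - b₀) 0 - c.K * max (b₀ - b) 0 / y) * (α + b * γ)|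
        + |c.E * max (b - b₀) 0 ^ 2 * γ| + |(1 - w₀ / (b ^ 2 * y)) * (b * α)| :=
      (abs_add_le _ _).trans (by gcongr; exact abs_sub _ _)
    _ ≤ (c.M ^ 2 + c.M ^ 3) * (2 * c.M * s) + c.M * c.M ^ 2 * s + (1 + c.M ^ 2) * (c.M * s) := by
      rw [abs_mul, abs_mul (1 - _)]
      gcongr
      exacts [hby.abs_price_coeff_le hb₀, hby.abs_add_mul_le hα hγ, hby.abs_profit_coeff_le hw₀]
    _ = (2 * c.M ^ 4 + 4 * c.M ^ 3 + c.M) * s := by ring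
    _ ≤ 7 * c.M ^ 4 * s := by
      gcongr
      nlinarith [pow_pos c.M_pos 3, mul_le_mul_of_nonneg_left hM (pow_pos c.M_pos 3).le,
        one_le_pow₀ (show 1 ≤ c.M by linarith) (n := 2), c.M_pos]

lemma lyapunov_le (hby : c.Admissible b y) (hb₀ : b₀ ∈ Set.Icc lo hi)
    (hw₀ : w₀ ∈ Set.Icc (lo ^ 2) hi) : lyapunov c.K c.E b₀ w₀ b y ≤ 4 * c.M ^ 4 := by
  have hM := c.two_le_M
  have hlo := c.lo_pos
  have hw₀_pos : 0 < w₀ := (pow_pos hlo 2).trans_le hw₀.1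
  have hw₀_le : w₀ ≤ c.M := by linarith [hw₀.2, c.hi_le, c.one_le_hi]
  have hprofit := hby.profit_pos
  have hgap : entropyGap w₀ (b ^ 2 * y) ≤ c.M ^ 3 + c.M ^ 2 * c.M := by
    calc entropyGap w₀ (b ^ 2 * y) ≤ (b ^ 2 * y - w₀) ^ 2 / (b ^ 2 * y) :=
          entropyGap_le_sq_div hw₀_pos hprofit
      _ = b ^ 2 * y - 2 * w₀ + w₀ ^ 2 * (1 / (b ^ 2 * y)) := by
        have := hby.price_pos
        have := hby.slope_pos
        field_simp
        ring
      _ ≤ c.M ^ 3 + c.M ^ 2 * c.M := by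
        refine add_le_add (by linarith [hby.profit_le]) ?_
        gcongr
        exact hby.one_div_profit_le_M
  have hleft : c.K * max (b₀ - b) 0 ^ 2 ≤ c.M * c.M ^ 2 := by
    have := c.sixteen_le_K
    gcongr
    exacts [c.K_le, hby.max_opt_sub_le hb₀]
  have hright : c.E * y * max (b - b₀) 0 ^ 2 ≤ c.M * c.M * c.M ^ 2 := by
    have := c.E_pos
    have := hby.slope_pos
    gcongr
    exacts [c.E_le, hby.slope_le_M, hby.max_sub_opt_le hb₀]
  unfold lyapunov
  nlinarith [mul_le_mul_of_nonneg_left hM (pow_pos c.M_pos 3).le]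

variable {d : ℝ}

lemma half_slope_le_sub (hby : c.Admissible b y) (hγ : |γ| ≤ s) (hs : 4 * c.M ^ 6 * s ≤ 1) :
    y / 2 ≤ y - γ := by
  have hy := hby.slope_pos
  have hM := c.two_le_M
  have hMs : 2 * c.M * |γ| ≤ 1 := by
    calc 2 * c.M * |γ| ≤ 4 * c.M ^ 6 * s := by
          gcongr
          · norm_num
          · exact le_self_pow₀ (by linarith) (by norm_num)
      _ ≤ 1 := hs
  have h1 : 1 ≤ c.M * y := by
    have := hby.one_div_slope_le_M
    rwa [div_le_iff₀ hy] at this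
  have : |γ| ≤ y / 2 := le_of_mul_le_mul_left (by linarith) c.M_pos
  linarith [le_abs_self γ]

lemma abs_step_le (hby : c.Admissible b y) (hα : |α| ≤ s) (hγ : |γ| ≤ s)
    (hs : 4 * c.M ^ 6 * s ≤ 1) (hd : d * (2 * (y - γ)) = α + b * γ) : |d| ≤ 2 * c.M ^ 2 * s := by
  have hy := hby.slope_pos
  have hM := c.two_le_M
  have : 0 ≤ s := (abs_nonneg _).trans hα
  have hyγ := hby.half_slope_le_sub hγ hs
  have h1 : 1 ≤ c.M * y := by
    have := hby.one_div_slope_le_M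
    rwa [div_le_iff₀ hy] at this
  have hdy : |d| * y ≤ 2 * c.M * s :=
    calc |d| * y ≤ |d| * (2 * (y - γ)) := by gcongr; linarith
      _ = |α + b * γ| := by rw [← hd, abs_mul, abs_of_nonneg (by linarith : 0 ≤ 2 * (y - γ))]
      _ ≤ 2 * c.M * s := hby.abs_add_mul_le hα hγ
  calc |d| ≤ |d| * (c.M * y) := le_mul_of_one_le_right (abs_nonneg d) h1
    _ = c.M * (|d| * y) := by ring
    _ ≤ c.M * (2 * c.M * s) := by gcongr
    _ = 2 * c.M ^ 2 * s := by ring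

lemma abs_profit_step_le (hby : c.Admissible b y) (hα : |α| ≤ s) (hγ : |γ| ≤ s)
    (hs : 4 * c.M ^ 6 * s ≤ 1) (hd : d * (2 * (y - γ)) = α + b * γ) :
    |b * α + (y - γ) * d ^ 2| ≤ 2 * c.M * s := by
  have hM := c.two_le_M
  have hs0 : 0 ≤ s := (abs_nonneg _).trans hα
  have hb := hby.price_pos
  have hyγ := hby.half_slope_le_sub hγ hs
  have hy := hby.slope_pos
  have hd2 : (y - γ) * d ^ 2 ≤ c.M * s := by
    have habs : d ^ 2 * (2 * (y - γ)) ≤ (2 * c.M ^ 2 * s) * (2 * c.M * s) := by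
      calc d ^ 2 * (2 * (y - γ)) = d * (α + b * γ) := by rw [← hd]; ring
        _ ≤ |d| * |α + b * γ| := by rw [← abs_mul]; exact le_abs_self _
        _ ≤ (2 * c.M ^ 2 * s) * (2 * c.M * s) := by
          gcongr
          exacts [hby.abs_step_le hα hγ hs hd, hby.abs_add_mul_le hα hγ]
    have hsmall : 2 * c.M ^ 2 * s ≤ 1 := by
      refine le_trans ?_ hs
      gcongr <;> linarith
    nlinarith [mul_le_mul_of_nonneg_right hsmall (mul_nonneg c.M_pos.le hs0)]
  calc |b * α + (y - γ) * d ^ 2| ≤ |b * α| + |(y - γ) * d ^ 2| := abs_add_le _ _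
    _ = b * |α| + (y - γ) * d ^ 2 := by
      rw [abs_mul, abs_of_pos hb, abs_of_nonneg (mul_nonneg (by linarith) (sq_nonneg d))]
    _ ≤ c.M * s + c.M * s :=
      add_le_add (mul_le_mul hby.price_le_M hα (abs_nonneg α) c.M_pos.le) hd2
    _ = 2 * c.M * s := by ring

lemma abs_profit_step_le_half (hby : c.Admissible b y) (hα : |α| ≤ s) (hγ : |γ| ≤ s)
    (hs : 4 * c.M ^ 6 * s ≤ 1) (hd : d * (2 * (y - γ)) = α + b * γ) :
    |b * α + (y - γ) * d ^ 2| ≤ b ^ 2 * y / 2 := by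
  have hs0 : 0 ≤ s := (abs_nonneg _).trans hα
  have hM2 : 4 * c.M ^ 2 * s ≤ 1 := by
    refine le_trans ?_ hs
    gcongr
    exacts [by linarith [c.two_le_M], by norm_num]
  have h1 : 1 ≤ c.M * (b ^ 2 * y) := (div_le_iff₀ hby.profit_pos).1 hby.one_div_profit_le_M
  refine (hby.abs_profit_step_le hα hγ hs hd).trans (le_of_mul_le_mul_left ?_ c.M_pos)
  linarith

lemma left_remainder_le (hby : c.Admissible b y) (hb₀ : b₀ ∈ Set.Icc lo hi) (hα : |α| ≤ s)
    (hγ : |γ| ≤ s) (hs : 4 * c.M ^ 6 * s ≤ 1) (hd : d * (2 * (y - γ)) = α + b * γ) :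
    c.K * (d ^ 2 - 2 * max (b₀ - b) 0 * γ * d / y) ≤ c.M * (8 * c.M ^ 4 * s ^ 2) := by
  have hs0 : 0 ≤ s := (abs_nonneg _).trans hα
  have hM := c.M_pos
  have hdM := hby.abs_step_le hα hγ hs hd
  have hd2 : d ^ 2 ≤ 4 * c.M ^ 4 * s ^ 2 :=
    (sq_le_sq' (abs_le.1 hdM).1 (abs_le.1 hdM).2).trans_eq (by ring)
  have hcross : -(2 * max (b₀ - b) 0 * γ * d / y) ≤ 4 * c.M ^ 4 * s ^ 2 := by
    refine (neg_le_abs _).trans ?_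
    have htl : |max (b₀ - b) 0| ≤ c.M := by
      rw [abs_of_nonneg (le_max_right _ _)]
      exact hby.max_opt_sub_le hb₀
    calc |2 * max (b₀ - b) 0 * γ * d / y| = 2 * |max (b₀ - b) 0| * |γ| * |d| * (1 / y) := by
          rw [abs_div, abs_mul, abs_mul, abs_mul, abs_two, abs_of_pos hby.slope_pos,
            div_eq_mul_one_div]
      _ ≤ 2 * c.M * s * (2 * c.M ^ 2 * s) * c.M := by
        have := hby.slope_pos
        gcongr
        exact hby.one_div_slope_le_M
      _ = 4 * c.M ^ 4 * s ^ 2 := by ring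
  exact (mul_le_mul_of_nonneg_left (by linarith) (by linarith [c.sixteen_le_K])).trans
    (mul_le_mul_of_nonneg_right c.K_le (by positivity))

lemma lyapunov_step_le (hby : c.Admissible b y) (hb₀ : b₀ ∈ Set.Icc lo hi)
    (hw₀ : w₀ ∈ Set.Icc (lo ^ 2) hi) (hα : |α| ≤ s) (hγ : |γ| ≤ s) (hs : 4 * c.M ^ 6 * s ≤ 1)
    (hd : d * (2 * (y - γ)) = α + b * γ) :
    lyapunov c.K c.E b₀ w₀ (b + d) (y - γ) ≤ lyapunov c.K c.E b₀ w₀ b y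
      + lyapunovDeriv c.K c.E b₀ w₀ b y α γ + 14 * c.M ^ 6 * s ^ 2 := by
  have hM := c.two_le_M
  have hs0 : 0 ≤ s := (abs_nonneg _).trans hα
  have hy := hby.slope_pos
  have hyγ := hby.half_slope_le_sub hγ hs
  have hw₀_pos : 0 < w₀ := (pow_pos c.lo_pos 2).trans_le hw₀.1
  have hdM := hby.abs_step_le hα hγ hs hd
  have hkM := hby.abs_profit_step_le hα hγ hs hd
  have hd2 : d ^ 2 ≤ 4 * c.M ^ 4 * s ^ 2 :=
    (sq_le_sq' (abs_le.1 hdM).1 (abs_le.1 hdM).2).trans_eq (by ring)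
  have hk2 : (b * α + (y - γ) * d ^ 2) ^ 2 ≤ 4 * c.M ^ 2 * s ^ 2 :=
    (sq_le_sq' (abs_le.1 hkM).1 (abs_le.1 hkM).2).trans_eq (by ring)
  have hsq : (y - γ) * d ^ 2 ≤ c.M * (4 * c.M ^ 4 * s ^ 2) := by
    have hs1 : s ≤ 1 := by
      nlinarith [one_le_pow₀ (show 1 ≤ c.M by linarith) (n := 6)]
    gcongr
    linarith [hby.slope_add_one_le_M, neg_abs_le γ]
  have hgap : 2 * w₀ / (b ^ 2 * y) ^ 2 * (b * α + (y - γ) * d ^ 2) ^ 2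
      ≤ 2 * c.M * c.M ^ 2 * (4 * c.M ^ 2 * s ^ 2) := by
    have hprofit := hby.profit_pos
    rw [div_eq_mul_one_div, ← one_div_pow]
    gcongr
    exacts [by linarith [hw₀.2, c.hi_le, c.one_le_hi], hby.one_div_profit_le_M]
  have hright : c.E * ((y - γ) * d ^ 2) ≤ c.M * (c.M * (4 * c.M ^ 4 * s ^ 2)) :=
    mul_le_mul c.E_le hsq (mul_nonneg (by linarith) (sq_nonneg d)) c.M_pos.le
  have hM5 : 2 * (c.M ^ 5 * s ^ 2) ≤ c.M * (c.M ^ 5 * s ^ 2) := by gcongr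
  refine (MonopolyLearning.lyapunov_step_le (by linarith [c.sixteen_le_K]) c.E_pos.le hw₀_pos
    hby.price_pos hy (by linarith) hd (hby.abs_profit_step_le_half hα hγ hs hd)).trans ?_
  linarith [hby.left_remainder_le hb₀ hα hγ hs hd]

end LyapunovConstants.Admissible

lemma optQuantity_le_one (m : Measure ℝ) : optQuantity m ≤ 1 := sub_le_self 1 (cdf_nonneg m _)

namespace HasStableDemand

variable {lo hi L ε b : ℝ} {m : Measure ℝ} (h : HasStableDemand lo hi L m)

include h

lemma optProfit_mem (hlo : 0 < lo) : optPrice m * optQuantity m ∈ Set.Icc (lo ^ 2) hi := by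
  have hprice := h.opt_mem
  constructor
  · nlinarith [h.lo_le_optQuantity, hprice.1]
  · exact (mul_le_of_le_one_right (by linarith [hprice.1]) (optQuantity_le_one m)).trans hprice.2

lemma right_drift_le (hε : 0 < ε) (hb : b ∈ Set.Icc 0 (2 * hi)) (y : ℝ) :
    (b - optPrice m) * (meanDemand m ε b - b * demandSlope m ε b)
      - (b - optPrice m) ^ 2 * (y - demandSlope m ε b) ≤ L * ε - y * (b - optPrice m) ^ 2 := by
  linarith [h.sign ε hε b hb]

lemma le_left_drift (hlo : 0 < lo) (hhi : 1 ≤ hi) (hL : 0 ≤ L) (hε : 0 < ε)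
    (hb : b ∈ Set.Icc 0 (optPrice m)) :
    lo / hi * (optPrice m - b) ^ 2 - 2 * hi * L * ε
      ≤ (optPrice m - b) * (meanDemand m ε b - b * demandSlope m ε b) := by
  obtain ⟨hb0, hb1⟩ := hb
  obtain ⟨hopt, hopt'⟩ := h.opt_mem
  have hb₀ : 0 < optPrice m := by linarith
  set r := b / optPrice m with hr
  have hr0 : 0 ≤ r := by positivity
  have hr1 : r ≤ 1 := div_le_one_of_le₀ hb1 hb₀.le
  have hbr : b = r * optPrice m := by rw [hr]; field_simp
  have hquantity : lo - L * ε ≤ meanDemand m ε b := by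
    have hcdf := monotone_cdf m hb1
    have hq := h.lo_le_optQuantity
    unfold optQuantity at hq
    linarith [(abs_le.1 (abs_meanDemand_sub_le hε hL h.lipschitz b)).1]
  have hsign := mul_le_mul_of_nonneg_left (h.sign ε hε b ⟨hb0, by linarith⟩) hr0
  have hdist : lo / hi * (optPrice m - b) ^ 2 ≤ (1 - r) * (optPrice m - b) * lo := by
    rw [div_mul_eq_mul_div, div_le_iff₀ (by linarith)]
    have : (optPrice m - b) ^ 2 = (1 - r) * (optPrice m - b) * optPrice m := by rw [hbr]; ring
    rw [this]
    have : 0 ≤ (1 - r) * (optPrice m - b) * lo :=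
      mul_nonneg (mul_nonneg (by linarith) (by linarith)) hlo.le
    nlinarith
  have : 0 ≤ L * ε := by positivity
  have hdemand := mul_le_mul_of_nonneg_left hquantity
    (mul_nonneg (sub_nonneg.2 hr1) (sub_nonneg.2 hb1))
  have herr : (1 - r) * (optPrice m - b) * (L * ε) ≤ hi * (L * ε) := by
    gcongr
    nlinarith
  have hrhi : r * (L * ε) ≤ hi * (L * ε) := by
    gcongr
    linarith
  calc lo / hi * (optPrice m - b) ^ 2 - 2 * hi * L * ε
      ≤ (1 - r) * (optPrice m - b) * meanDemand m ε b
        - r * ((b - optPrice m) * (meanDemand m ε b - optPrice m * demandSlope m ε b)) := by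
        linarith
    _ = (optPrice m - b) * (meanDemand m ε b - b * demandSlope m ε b) := by
      linear_combination (optPrice m - b) * demandSlope m ε b * hbr

lemma abs_mul_meanDemand_sub_le (hlo : 0 < lo) (hL : 0 ≤ L) (hε : 0 < ε)
    (hb : b ∈ Set.Icc 0 (2 * hi)) :
    |b * meanDemand m ε b - optPrice m * optQuantity m|
      ≤ (1 + 2 * hi * L) * (|b - optPrice m| + ε) := by
  obtain ⟨hb0, hb1⟩ := hb
  have hhi : 0 ≤ 2 * hi := hb0.trans hb1
  have hq0 : 0 ≤ optQuantity m := hlo.le.trans h.lo_le_optQuantity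
  have hnoise : |b * (meanDemand m ε b - (1 - cdf m b))| ≤ 2 * hi * (L * ε) := by
    rw [abs_mul, abs_of_nonneg hb0]
    have := abs_meanDemand_sub_le hε hL h.lipschitz b
    gcongr
  have hcdf : |b * (cdf m (optPrice m) - cdf m b)| ≤ 2 * hi * (L * |b - optPrice m|) := by
    rw [abs_mul, abs_of_nonneg hb0, abs_sub_comm b]
    have := h.lipschitz b (optPrice m)
    gcongr
  have hprice : |(b - optPrice m) * optQuantity m| ≤ |b - optPrice m| := by
    rw [abs_mul, abs_of_nonneg hq0]
    exact mul_le_of_le_one_right (abs_nonneg _) (optQuantity_le_one m)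
  calc |b * meanDemand m ε b - optPrice m * optQuantity m|
      = |b * (meanDemand m ε b - (1 - cdf m b)) + b * (cdf m (optPrice m) - cdf m b)
          + (b - optPrice m) * optQuantity m| := by unfold optQuantity; congr 1; ring
    _ ≤ 2 * hi * (L * ε) + 2 * hi * (L * |b - optPrice m|) + |b - optPrice m| :=
      (abs_add_three _ _ _).trans (by gcongr)
    _ ≤ (1 + 2 * hi * L) * (|b - optPrice m| + ε) := by linarith

end HasStableDemand

lemma one_sub_div_mul_sub_le {w w₀ : ℝ} (hw : 0 < w) (v : ℝ) :
    (1 - w₀ / w) * (v - w) ≤ (v - w₀) ^ 2 / (2 * w) - (w - w₀) ^ 2 / w / 2 := by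
  have hsq : (v - w₀) ^ 2 / (2 * w) - (w - w₀) ^ 2 / w / 2 - (1 - w₀ / w) * (v - w)
      = (v - w) ^ 2 / (2 * w) := by
    field_simp
    ring
  have : 0 ≤ (v - w) ^ 2 / (2 * w) := by positivity
  linarith

namespace LyapunovConstants.Admissible

variable {lo hi L b y ε : ℝ} {m : Measure ℝ} {c : LyapunovConstants lo hi L}

lemma entropy_drift_le (hby : c.Admissible b y) (h : HasStableDemand lo hi L m) (hε : 0 < ε)
    (hε1 : ε ≤ 1) :
    (1 - optPrice m * optQuantity m / (b ^ 2 * y)) * (b * (meanDemand m ε b - b * y))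
      ≤ (1 + 2 * hi * L) ^ 2 * (b - optPrice m) ^ 2 / (b ^ 2 * y) + c.M ^ 3 * ε
        - entropyGap (optPrice m * optQuantity m) (b ^ 2 * y) / 2 := by
  have hw := hby.profit_pos
  have hL := c.L_nonneg
  have hhi : 0 < hi := one_pos.trans_le c.one_le_hi
  have hw₀ : 0 < optPrice m * optQuantity m :=
    (pow_pos c.lo_pos 2).trans_le (h.optProfit_mem c.lo_pos).1
  have hprofit : (b * meanDemand m ε b - optPrice m * optQuantity m) ^ 2
      ≤ 2 * ((1 + 2 * hi * L) ^ 2 * (b - optPrice m) ^ 2 + (1 + 2 * hi * L) ^ 2 * ε ^ 2) := by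
    have habs := h.abs_mul_meanDemand_sub_le c.lo_pos hL hε ⟨hby.price_pos.le, hby.price_le⟩
    calc (b * meanDemand m ε b - optPrice m * optQuantity m) ^ 2
        ≤ ((1 + 2 * hi * L) * (|b - optPrice m| + ε)) ^ 2 :=
          sq_le_sq' (abs_le.1 habs).1 (abs_le.1 habs).2
      _ = (1 + 2 * hi * L) ^ 2 * (|b - optPrice m| + ε) ^ 2 := by ring
      _ ≤ (1 + 2 * hi * L) ^ 2 * (2 * (|b - optPrice m| ^ 2 + ε ^ 2)) := by gcongr; exact add_sq_le
      _ = _ := by rw [sq_abs]; ring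
  have hnoise : (1 + 2 * hi * L) ^ 2 * ε ^ 2 / (b ^ 2 * y) ≤ c.M ^ 3 * ε := by
    have hM := c.M_pos
    calc (1 + 2 * hi * L) ^ 2 * ε ^ 2 / (b ^ 2 * y)
        = (1 + 2 * hi * L) ^ 2 * (1 / (b ^ 2 * y)) * ε ^ 2 := by ring
      _ ≤ c.M ^ 2 * c.M * ε := by
        gcongr
        exacts [c.L_le, hby.one_div_profit_le_M, pow_le_of_le_one hε.le hε1 two_ne_zero]
      _ = c.M ^ 3 * ε := by ring
  calc (1 - optPrice m * optQuantity m / (b ^ 2 * y)) * (b * (meanDemand m ε b - b * y))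
      = (1 - optPrice m * optQuantity m / (b ^ 2 * y)) * (b * meanDemand m ε b - b ^ 2 * y) := by
        ring
    _ ≤ 2 * ((1 + 2 * hi * L) ^ 2 * (b - optPrice m) ^ 2 + (1 + 2 * hi * L) ^ 2 * ε ^ 2)
          / (2 * (b ^ 2 * y)) - entropyGap (optPrice m * optQuantity m) (b ^ 2 * y) / 2 := by
      refine (one_sub_div_mul_sub_le hw _).trans ?_
      gcongr
      exact entropyGap_le_sq_div hw₀ hw
    _ ≤ _ := by
      rw [mul_div_mul_left _ _ two_ne_zero, add_div]
      gcongr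

lemma left_absorb (hby : c.Admissible b y) (t : ℝ) :
    (1 + 2 * hi * L) ^ 2 * t ^ 2 / (b ^ 2 * y) ≤ c.K / y * (lo / hi * t ^ 2) / 2 := by
  have hy := hby.slope_pos
  have hlo := c.lo_pos
  have hhi : 0 < hi := one_pos.trans_le c.one_le_hi
  have hM : (1 + 2 * hi * L) ^ 2 * 16 / lo ^ 2 ≤ c.K * (lo / hi) / 2 := by
    rw [div_le_div_iff₀ (by positivity) two_pos, mul_div_assoc', div_mul_eq_mul_div,
      le_div_iff₀ hhi]
    linarith [c.K_drift]
  calc (1 + 2 * hi * L) ^ 2 * t ^ 2 / (b ^ 2 * y)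
      ≤ (1 + 2 * hi * L) ^ 2 * t ^ 2 / (lo ^ 2 * y / 16) := by
        gcongr
        exact hby.lo_sq_mul_le_profit
    _ = (1 + 2 * hi * L) ^ 2 * 16 / lo ^ 2 * (t ^ 2 / y) := by field_simp
    _ ≤ c.K * (lo / hi) / 2 * (t ^ 2 / y) := by gcongr
    _ = c.K / y * (lo / hi * t ^ 2) / 2 := by ring

lemma right_absorb (hby : c.Admissible b y) (t : ℝ) :
    (1 + 2 * hi * L) ^ 2 * t ^ 2 / (b ^ 2 * y) ≤ c.E * y * t ^ 2 / 2 := by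
  have hy := hby.slope_pos
  have hlo := c.lo_pos
  have hE := c.E_pos
  have hEy : 32 * (1 + 2 * hi * L) ^ 2 ≤ c.E * y ^ 2 * lo ^ 2 := by
    refine c.E_drift.trans ?_
    have := c.y₁_pos
    gcongr
    exact hby.le_slope
  calc (1 + 2 * hi * L) ^ 2 * t ^ 2 / (b ^ 2 * y)
      ≤ (1 + 2 * hi * L) ^ 2 * t ^ 2 / (lo ^ 2 * y / 16) := by
        gcongr
        exact hby.lo_sq_mul_le_profit
    _ = 32 * (1 + 2 * hi * L) ^ 2 * (t ^ 2 / (2 * (lo ^ 2 * y))) := by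
        field_simp
        ring
    _ ≤ c.E * y ^ 2 * lo ^ 2 * (t ^ 2 / (2 * (lo ^ 2 * y))) := by gcongr
    _ = c.E * y * t ^ 2 / 2 := by field_simp

lemma mul_sq_div_M_cube_le (hby : c.Admissible b y) (t : ℝ) :
    c.K * t ^ 2 / c.M ^ 3 ≤ c.K / y * (lo / hi * t ^ 2) / 2 := by
  have hy := hby.slope_pos
  have hM := c.M_pos
  have hhi : 0 < hi := one_pos.trans_le c.one_le_hi
  have hK : 0 ≤ c.K := by linarith [c.sixteen_le_K]
  have hrate : 1 / c.M ^ 3 ≤ lo / (y * (2 * hi)) := by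
    rw [div_le_div_iff₀ (by positivity) (by positivity)]
    calc 1 * (y * (2 * hi)) ≤ 1 * (c.M * c.M) := by gcongr; exacts [hby.slope_le_M, c.hi_le]
      _ ≤ (c.M * lo) * (c.M * c.M) := by gcongr; linarith [c.sixteen_le_M_mul_lo]
      _ = lo * c.M ^ 3 := by ring
  calc c.K * t ^ 2 / c.M ^ 3 = c.K * t ^ 2 * (1 / c.M ^ 3) := by ring
    _ ≤ c.K * t ^ 2 * (lo / (y * (2 * hi))) := by gcongr
    _ = c.K / y * (lo / hi * t ^ 2) / 2 := by ring

lemma entropyGap_div_M_cube_le (hby : c.Admissible b y) {w₀ : ℝ}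
    (hw₀ : w₀ ∈ Set.Icc (lo ^ 2) hi) :
    entropyGap w₀ (b ^ 2 * y) / c.M ^ 3 ≤ entropyGap w₀ (b ^ 2 * y) / 2 := by
  have := entropyGap_nonneg ((pow_pos c.lo_pos 2).trans_le hw₀.1) hby.profit_pos
  have := c.two_le_M_cube
  gcongr

lemma lyapunovDeriv_meanDemand_le_of_le_opt (hby : c.Admissible b y) (h : HasStableDemand lo hi L m)
    (hε : 0 < ε) (hε1 : ε ≤ 1) (hb : b ≤ optPrice m) :
    lyapunovDeriv c.K c.E (optPrice m) (optPrice m * optQuantity m) b y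
        (meanDemand m ε b - b * y) (y - demandSlope m ε b)
      ≤ 3 * c.M ^ 3 * ε
        - lyapunov c.K c.E (optPrice m) (optPrice m * optQuantity m) b y / c.M ^ 3 := by
  have hM := c.two_le_M
  have := c.two_le_M_cube
  have hy := hby.slope_pos
  have hentropy := hby.entropy_drift_le h hε hε1
  have hgap := hby.entropyGap_div_M_cube_le (h.optProfit_mem c.lo_pos)
  unfold lyapunovDeriv lyapunov
  rw [max_eq_left (sub_nonneg.2 hb), max_eq_right (sub_nonpos.2 hb)]
  have hleft := mul_le_mul_of_nonneg_left (h.le_left_drift c.lo_pos c.one_le_hi c.L_nonneg hε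
    ⟨hby.price_pos.le, hb⟩) (show 0 ≤ c.K / y by have := c.sixteen_le_K; positivity)
  have hnoise : c.K / y * (2 * hi * L * ε) ≤ c.M * c.M * (c.M * ε) := by
    rw [div_eq_mul_one_div]
    exact mul_le_mul (mul_le_mul c.K_le hby.one_div_slope_le_M (by positivity) c.M_pos.le)
      (mul_le_mul_of_nonneg_right (by linarith [c.L_le]) hε.le)
      (mul_nonneg (mul_nonneg (by linarith [c.one_le_hi]) c.L_nonneg) hε.le) (by positivity)
  have habsorb := hby.left_absorb (optPrice m - b)
  have hdecay := hby.mul_sq_div_M_cube_le (optPrice m - b)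
  calc _ = -(c.K / y * ((optPrice m - b) * (meanDemand m ε b - b * demandSlope m ε b)))
        + (1 - optPrice m * optQuantity m / (b ^ 2 * y)) * (b * (meanDemand m ε b - b * y)) := by
        ring
    _ ≤ 3 * c.M ^ 3 * ε - (c.K * (optPrice m - b) ^ 2 / c.M ^ 3
        + entropyGap (optPrice m * optQuantity m) (b ^ 2 * y) / c.M ^ 3) := by
      rw [sub_sq_comm] at hentropy
      have : 0 ≤ c.M ^ 3 * ε := by positivity
      linarith
    _ = _ := by ring

lemma lyapunovDeriv_meanDemand_le_of_opt_le (hby : c.Admissible b y) (h : HasStableDemand lo hi L m)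
    (hε : 0 < ε) (hε1 : ε ≤ 1) (hb : optPrice m ≤ b) :
    lyapunovDeriv c.K c.E (optPrice m) (optPrice m * optQuantity m) b y
        (meanDemand m ε b - b * y) (y - demandSlope m ε b)
      ≤ 3 * c.M ^ 3 * ε
        - lyapunov c.K c.E (optPrice m) (optPrice m * optQuantity m) b y / c.M ^ 3 := by
  have hM := c.two_le_M
  have hM3 := c.two_le_M_cube
  have hy := hby.slope_pos
  have hentropy := hby.entropy_drift_le h hε hε1
  have hgap := hby.entropyGap_div_M_cube_le (h.optProfit_mem c.lo_pos)
  unfold lyapunovDeriv lyapunov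
  rw [max_eq_right (sub_nonpos.2 hb), max_eq_left (sub_nonneg.2 hb)]
  have hE := c.E_pos
  have hright := mul_le_mul_of_nonneg_left
    (h.right_drift_le hε ⟨hby.price_pos.le, hby.price_le⟩ y) hE.le
  have hnoise : c.E * (L * ε) ≤ c.M ^ 3 * ε := by
    have := c.L_nonneg
    calc c.E * (L * ε) ≤ c.M * (c.M * ε) := by gcongr; exacts [c.E_le, c.L_le_M]
      _ = c.M ^ 2 * ε := by ring
      _ ≤ c.M ^ 3 * ε := by gcongr <;> linarith
  have habsorb := hby.right_absorb (b - optPrice m)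
  have hdecay : c.E * y * (b - optPrice m) ^ 2 / c.M ^ 3
      ≤ c.E * y * (b - optPrice m) ^ 2 / 2 := by gcongr
  calc _ = c.E * ((b - optPrice m) * (meanDemand m ε b - b * demandSlope m ε b)
          - (b - optPrice m) ^ 2 * (y - demandSlope m ε b))
        + (1 - optPrice m * optQuantity m / (b ^ 2 * y)) * (b * (meanDemand m ε b - b * y)) := by
        ring
    _ ≤ 3 * c.M ^ 3 * ε - (c.E * y * (b - optPrice m) ^ 2 / c.M ^ 3
        + entropyGap (optPrice m * optQuantity m) (b ^ 2 * y) / c.M ^ 3) := by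
      have : 0 ≤ c.M ^ 3 * ε := by positivity
      linarith
    _ = _ := by ring

lemma lyapunovDeriv_meanDemand_le (hby : c.Admissible b y) (h : HasStableDemand lo hi L m)
    (hε : 0 < ε) (hε1 : ε ≤ 1) :
    lyapunovDeriv c.K c.E (optPrice m) (optPrice m * optQuantity m) b y
        (meanDemand m ε b - b * y) (y - demandSlope m ε b)
      ≤ 3 * c.M ^ 3 * ε
        - lyapunov c.K c.E (optPrice m) (optPrice m * optQuantity m) b y / c.M ^ 3 := by
  rcases le_total b (optPrice m) with hb | hb
  exacts [hby.lyapunovDeriv_meanDemand_le_of_le_opt h hε hε1 hb,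
    hby.lyapunovDeriv_meanDemand_le_of_opt_le h hε hε1 hb]

end LyapunovConstants.Admissible

namespace LyapunovConstants

variable {lo hi L b₀ w₀ b y : ℝ} (c : LyapunovConstants lo hi L)

lemma lyapunov_reset_le (hb₀ : b₀ ∈ Set.Icc lo hi) (hw₀ : w₀ ∈ Set.Icc (lo ^ 2) hi) :
    lyapunov c.K c.E b₀ w₀ (lo / 2) 1 ≤ c.K * (b₀ - lo / 2) ^ 2 + 4 * hi ^ 2 / lo ^ 2 := by
  have hlo := c.lo_pos
  have hw₀_pos : 0 < w₀ := (pow_pos hlo 2).trans_le hw₀.1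
  have hgap : entropyGap w₀ ((lo / 2) ^ 2 * 1) ≤ 4 * hi ^ 2 / lo ^ 2 := by
    calc entropyGap w₀ ((lo / 2) ^ 2 * 1)
        ≤ ((lo / 2) ^ 2 * 1 - w₀) ^ 2 / ((lo / 2) ^ 2 * 1) :=
          entropyGap_le_sq_div hw₀_pos (by positivity)
      _ ≤ hi ^ 2 / ((lo / 2) ^ 2 * 1) := by
        have := hw₀.2
        have := c.lo_le_one
        have := c.one_le_hi
        refine div_le_div_of_nonneg_right (sq_le_sq' ?_ ?_) (by positivity) <;> nlinarith
      _ = 4 * hi ^ 2 / lo ^ 2 := by field_simp; norm_num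
  rw [lyapunov, max_eq_left (by linarith [hb₀.1]), max_eq_right (by linarith [hb₀.1])]
  linarith

lemma lyapunov_reset_le_R (hb₀ : b₀ ∈ Set.Icc lo hi) (hw₀ : w₀ ∈ Set.Icc (lo ^ 2) hi) :
    lyapunov c.K c.E b₀ w₀ (lo / 2) 1 ≤ c.R := by
  refine (c.lyapunov_reset_le hb₀ hw₀).trans (le_trans ?_ c.le_R)
  have := c.sixteen_le_K
  have := c.lo_pos
  gcongr
  exacts [by linarith [hb₀.1], by linarith [hb₀.2]]

lemma entropyGap_le_lyapunov (hy : 0 < y) :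
    entropyGap w₀ (b ^ 2 * y) ≤ lyapunov c.K c.E b₀ w₀ b y := by
  have := c.sixteen_le_K
  have : 0 ≤ c.K * max (b₀ - b) 0 ^ 2 := by positivity
  have := c.E_pos
  have : 0 ≤ c.E * y * max (b - b₀) 0 ^ 2 := by positivity
  unfold lyapunov
  linarith

section Components

variable (hw₀ : 0 < w₀) (hb : 0 < b) (hy : 0 < y)

include hw₀ hb hy

lemma mul_sq_le_lyapunov_left : c.K * max (b₀ - b) 0 ^ 2 ≤ lyapunov c.K c.E b₀ w₀ b y := by
  have := entropyGap_nonneg hw₀ (show 0 < b ^ 2 * y by positivity)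
  have := c.E_pos
  have : 0 ≤ c.E * y * max (b - b₀) 0 ^ 2 := by positivity
  unfold lyapunov
  linarith

lemma mul_sq_le_lyapunov_right : c.E * y * max (b - b₀) 0 ^ 2 ≤ lyapunov c.K c.E b₀ w₀ b y := by
  have := entropyGap_nonneg hw₀ (show 0 < b ^ 2 * y by positivity)
  have := c.sixteen_le_K
  have : 0 ≤ c.K * max (b₀ - b) 0 ^ 2 := by positivity
  unfold lyapunov
  linarith

end Components

section Exit

variable (hb₀ : b₀ ∈ Set.Icc lo hi) (hw₀ : w₀ ∈ Set.Icc (lo ^ 2) hi)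

include hb₀ hw₀

lemma lyapunov_reset_le_of_price_lt (hb : 0 < b) (hy : 0 < y) (hexit : b < lo / 4) :
    lyapunov c.K c.E b₀ w₀ (lo / 2) 1 ≤ lyapunov c.K c.E b₀ w₀ b y := by
  have hlo := c.lo_pos
  have hK := c.sixteen_le_K
  refine le_trans ?_ (c.mul_sq_le_lyapunov_left ((pow_pos hlo 2).trans_le hw₀.1) hb hy)
  have hgain : 4 * hi ^ 2 / lo ^ 2 ≤ c.K * (lo ^ 2 / 4) := by
    rw [div_le_iff₀ (by positivity)]
    linarith [c.K_exit]
  calc lyapunov c.K c.E b₀ w₀ (lo / 2) 1 ≤ c.K * (b₀ - lo / 2) ^ 2 + c.K * (lo ^ 2 / 4) := by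
        linarith [c.lyapunov_reset_le hb₀ hw₀]
    _ = c.K * ((b₀ - lo / 2) ^ 2 + lo ^ 2 / 4) := by ring
    _ ≤ c.K * (b₀ - lo / 4) ^ 2 := by
      gcongr
      nlinarith [hb₀.1]
    _ ≤ c.K * max (b₀ - b) 0 ^ 2 := by
      gcongr
      exacts [by linarith [hb₀.1], le_max_of_le_left (by linarith)]

lemma lyapunov_reset_le_of_lt_price (hy : c.y₁ / 2 ≤ y) (hexit : 2 * hi < b) :
    lyapunov c.K c.E b₀ w₀ (lo / 2) 1 ≤ lyapunov c.K c.E b₀ w₀ b y := by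
  have hE := c.E_pos
  have hy₁ := c.y₁_pos
  have hhi := c.one_le_hi
  refine (c.lyapunov_reset_le_R hb₀ hw₀).trans (le_trans ?_ (c.mul_sq_le_lyapunov_right
    ((pow_pos c.lo_pos 2).trans_le hw₀.1) (by linarith) (by linarith)))
  calc c.R ≤ c.E * (c.y₁ / 2) * 1 ^ 2 := by linarith [c.E_exit]
    _ ≤ c.E * y * max (b - b₀) 0 ^ 2 := by
      have : 0 ≤ y := by linarith
      have : 1 ≤ max (b - b₀) 0 := le_max_of_le_left (by linarith [hb₀.2])
      gcongr

lemma lyapunov_reset_le_of_slope_lt (hb : 0 < b) (hb' : b ≤ 2 * hi) (hy : 0 < y)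
    (hexit : y < c.y₁) : lyapunov c.K c.E b₀ w₀ (lo / 2) 1 ≤ lyapunov c.K c.E b₀ w₀ b y := by
  have hlo := c.lo_pos
  have hR := c.sixteen_le_R
  have hw₀_pos : 0 < w₀ := (pow_pos hlo 2).trans_le hw₀.1
  refine (c.lyapunov_reset_le_R hb₀ hw₀).trans (le_trans ?_
    (c.entropyGap_le_lyapunov hy))
  refine le_entropyGap_of_le_exp hw₀_pos (by positivity) ?_
  calc b ^ 2 * y ≤ (2 * hi) ^ 2 * c.y₁ := by gcongr
    _ = 4 * hi ^ 2 * c.y₁ := by ring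
    _ ≤ lo ^ 2 * Real.exp (-(1 + c.R / lo ^ 2)) := c.y₁_exit
    _ ≤ w₀ * Real.exp (-(1 + c.R / w₀)) := by
      gcongr
      exacts [hw₀.1, hw₀.1]

lemma lyapunov_reset_le_of_lt_slope (hb : lo / 4 ≤ b) (hexit : c.y₂ < y) :
    lyapunov c.K c.E b₀ w₀ (lo / 2) 1 ≤ lyapunov c.K c.E b₀ w₀ b y := by
  have hlo := c.lo_pos
  have hy : 0 < y := by linarith [c.one_le_y₂]
  have hw₀_pos : 0 < w₀ := (pow_pos hlo 2).trans_le hw₀.1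
  have hprofit : 2 * (c.R + hi) ≤ b ^ 2 * y := by
    calc 2 * (c.R + hi) ≤ (lo / 4) ^ 2 * c.y₂ := by linarith [c.y₂_exit]
      _ ≤ b ^ 2 * y := by
        have := c.one_le_y₂
        gcongr
  refine (c.lyapunov_reset_le_R hb₀ hw₀).trans (le_trans ?_
    (c.entropyGap_le_lyapunov hy))
  refine le_trans ?_ (half_sub_le_entropyGap hw₀_pos (by linarith [c.sixteen_le_R, c.one_le_hi]))
  linarith [hw₀.2]

lemma lyapunov_reset_le_of_not_admissible (hb : 0 < b) (hy : c.y₁ / 2 ≤ y)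
    (hexit : ¬c.Admissible b y) :
    lyapunov c.K c.E b₀ w₀ (lo / 2) 1 ≤ lyapunov c.K c.E b₀ w₀ b y := by
  have hy_pos : 0 < y := by linarith [c.y₁_pos]
  by_contra! hlt
  refine hexit ⟨?_, ?_, ?_, ?_⟩ <;> by_contra! hout <;> refine hlt.not_ge ?_
  · exact c.lyapunov_reset_le_of_price_lt hb₀ hw₀ hb hy_pos hout
  · exact c.lyapunov_reset_le_of_lt_price hb₀ hw₀ hy hout
  · rcases le_or_gt b (2 * hi) with hb' | hb'
    exacts [c.lyapunov_reset_le_of_slope_lt hb₀ hw₀ hb hb' hy_pos hout,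
      c.lyapunov_reset_le_of_lt_price hb₀ hw₀ hy hb']
  · rcases le_or_gt (lo / 4) b with hb' | hb'
    exacts [c.lyapunov_reset_le_of_lt_slope hb₀ hw₀ hb' hout,
      c.lyapunov_reset_le_of_price_lt hb₀ hw₀ hb hy_pos hb']

end Exit

end LyapunovConstants

namespace LyapunovConstants.Admissible

variable {lo hi L ε b y : ℝ} {m : Measure ℝ} {c : LyapunovConstants lo hi L}
  (hby : c.Admissible b y) (h : HasStableDemand lo hi L m)

include hby h

lemma sq_sub_opt_le_lyapunov :
    (b - optPrice m) ^ 2 ≤ lyapunov c.K c.E (optPrice m) (optPrice m * optQuantity m) b y := by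
  have hw₀ := (pow_pos c.lo_pos 2).trans_le (h.optProfit_mem c.lo_pos).1
  rcases le_total b (optPrice m) with hb | hb
  · refine le_trans ?_ (c.mul_sq_le_lyapunov_left hw₀ hby.price_pos hby.slope_pos)
    rw [max_eq_left (sub_nonneg.2 hb), sub_sq_comm]
    exact le_mul_of_one_le_left (sq_nonneg _) (by linarith [c.sixteen_le_K])
  · refine le_trans ?_ (c.mul_sq_le_lyapunov_right hw₀ hby.price_pos hby.slope_pos)
    rw [max_eq_left (sub_nonneg.2 hb)]
    have hEy : c.E * c.y₁ ≤ c.E * y := mul_le_mul_of_nonneg_left hby.le_slope c.E_pos.le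
    exact le_mul_of_one_le_left (sq_nonneg _) (by linarith [c.E_exit, c.sixteen_le_R])

lemma sq_model_quantity_sub_le :
    (b * y - optQuantity m) ^ 2
      ≤ 9 * c.M ^ 5 * lyapunov c.K c.E (optPrice m) (optPrice m * optQuantity m) b y := by
  set V := lyapunov c.K c.E (optPrice m) (optPrice m * optQuantity m) b y
  have hM := c.two_le_M
  have hM3 := c.two_le_M_cube
  have hb := hby.price_pos
  have hw₀ := h.optProfit_mem c.lo_pos
  have hprice := hby.sq_sub_opt_le_lyapunov h
  have hprofit : (b ^ 2 * y - optPrice m * optQuantity m) ^ 2 ≤ 4 * c.M ^ 3 * V := by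
    have hw₀_le : optPrice m * optQuantity m ≤ c.M ^ 3 :=
      calc _ ≤ c.M := by linarith [hw₀.2, c.hi_le, c.one_le_hi]
        _ ≤ c.M ^ 3 := le_self_pow₀ (by linarith) three_ne_zero
    refine (sq_sub_le_entropyGap ((pow_pos c.lo_pos 2).trans_le hw₀.1) hby.profit_pos hw₀_le
      hby.profit_le).trans ?_
    gcongr
    exact c.entropyGap_le_lyapunov hby.slope_pos
  have hquantity : ((optPrice m - b) * optQuantity m) ^ 2 ≤ V := by
    rw [mul_pow, ← sub_sq_comm]
    exact (mul_le_of_le_one_right (sq_nonneg _) (pow_le_one₀ (c.lo_pos.le.trans h.lo_le_optQuantity)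
      (optQuantity_le_one m))).trans hprice
  have hV : 0 ≤ V := (sq_nonneg _).trans hprice
  have hbM : 1 ≤ c.M * b := by nlinarith [c.sixteen_le_M_mul_lo, hby.le_price]
  calc (b * y - optQuantity m) ^ 2 ≤ (c.M * b) ^ 2 * (b * y - optQuantity m) ^ 2 :=
        le_mul_of_one_le_left (sq_nonneg _) (one_le_pow₀ hbM)
    _ = c.M ^ 2 * (b ^ 2 * y - optPrice m * optQuantity m
          + (optPrice m - b) * optQuantity m) ^ 2 := by ring
    _ ≤ c.M ^ 2 * (2 * (4 * c.M ^ 3 * V + V)) := by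
      gcongr
      exact add_sq_le.trans (by gcongr)
    _ = (8 * c.M ^ 5 + c.M ^ 2 * 2) * V := by ring
    _ ≤ 9 * c.M ^ 5 * V := by
      gcongr
      nlinarith [mul_le_mul_of_nonneg_left hM3 (sq_nonneg c.M)]

lemma sq_true_quantity_sub_le {e : ℝ} (he : |e| ≤ ε) :
    (1 - cdf m (b + e) - optQuantity m) ^ 2 ≤ 2 * c.M ^ 2
      * (lyapunov c.K c.E (optPrice m) (optPrice m * optQuantity m) b y + ε ^ 2) := by
  have := c.L_nonneg
  have habs : |1 - cdf m (b + e) - optQuantity m| ≤ c.M * |b - optPrice m + e| := by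
    calc |1 - cdf m (b + e) - optQuantity m| = |cdf m (optPrice m) - cdf m (b + e)| := by
          unfold optQuantity
          congr 1
          ring
      _ ≤ L * |optPrice m - (b + e)| := h.lipschitz _ _
      _ = L * |b - optPrice m + e| := by rw [abs_sub_comm]; congr 2; ring
      _ ≤ c.M * |b - optPrice m + e| := by gcongr; exact c.L_le_M
  calc (1 - cdf m (b + e) - optQuantity m) ^ 2 ≤ (c.M * |b - optPrice m + e|) ^ 2 :=
        sq_le_sq' (abs_le.1 habs).1 (abs_le.1 habs).2
    _ = c.M ^ 2 * (b - optPrice m + e) ^ 2 := by rw [mul_pow, sq_abs]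
    _ ≤ c.M ^ 2 * (2 * ((b - optPrice m) ^ 2 + e ^ 2)) := by gcongr; exact add_sq_le
    _ ≤ c.M ^ 2 * (2 * (lyapunov c.K c.E (optPrice m) (optPrice m * optQuantity m) b y
          + ε ^ 2)) := by
      have he2 : e ^ 2 ≤ ε ^ 2 := sq_le_sq' (abs_le.1 he).1 (abs_le.1 he).2
      have hsum := add_le_add (hby.sq_sub_opt_le_lyapunov h) he2
      gcongr
    _ = _ := by ring

end LyapunovConstants.Admissible

/-- The linear demands with optimal price in `[b₁, b₂]` and slope in `[-y₂, -y₁]`. The bounds on the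
optimal price `-β 0 / (2 * β 1)` are multiplied out, which makes the set convex. -/
def demandBox (b₁ b₂ y₁ y₂ : ℝ) : Set (Fin 2 → ℝ) :=
  {β | (y₁ ≤ -β 1 ∧ -β 1 ≤ y₂) ∧ 2 * b₁ * -β 1 ≤ β 0 ∧ β 0 ≤ 2 * b₂ * -β 1}

section DemandBox

variable {b₁ b₂ y₁ y₂ : ℝ} {β : Fin 2 → ℝ}

lemma linPrice_eq (β : Fin 2 → ℝ) : linPrice β = β 0 / (2 * -β 1) := by
  rw [linPrice, mul_neg, div_neg, neg_div]

lemma linPrice_mul_neg_slope (hβ : β 1 ≠ 0) : linPrice β * -β 1 = β 0 / 2 := by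
  unfold linPrice
  field_simp

lemma demandBox_sign (hb₁ : 0 < b₁) (hy₁ : 0 < y₁) (hβ : β ∈ demandBox b₁ b₂ y₁ y₂) :
    0 < β 0 ∧ β 1 < 0 := by
  have hslope : 0 < -β 1 := hy₁.trans_le hβ.1.1
  exact ⟨(by positivity : 0 < 2 * b₁ * -β 1).trans_le hβ.2.1, neg_pos.1 hslope⟩

lemma mem_demandBox_iff (hβ : β 1 < 0) :
    β ∈ demandBox b₁ b₂ y₁ y₂ ↔ -β 1 ∈ Set.Icc y₁ y₂ ∧ linPrice β ∈ Set.Icc b₁ b₂ := by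
  have hslope : 0 < 2 * -β 1 := by linarith
  rw [linPrice_eq, Set.mem_Icc, Set.mem_Icc, le_div_iff₀ hslope, div_le_iff₀ hslope,
    ← mul_assoc, ← mul_assoc, mul_comm b₁, mul_comm b₂]
  rfl

lemma isClosed_demandBox : IsClosed (demandBox b₁ b₂ y₁ y₂) := by
  simp only [demandBox, Set.ofPred_and]
  refine (IsClosed.inter ?_ ?_).inter (IsClosed.inter ?_ ?_) <;>
    exact isClosed_le (by fun_prop) (by fun_prop)

lemma isCompact_demandBox (hb₁ : 0 ≤ b₁) (hb₂ : 0 ≤ b₂) : IsCompact (demandBox b₁ b₂ y₁ y₂) := by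
  refine (isCompact_Icc (a := ![2 * b₁ * y₁, -y₂]) (b := ![2 * b₂ * y₂, -y₁])).of_isClosed_subset
    isClosed_demandBox fun β hβ => ⟨?_, ?_⟩ <;> simp only [Pi.le_def, Fin.forall_fin_two,
      Matrix.cons_val_zero, Matrix.cons_val_one, Matrix.cons_val_fin_one]
  · exact ⟨(mul_le_mul_of_nonneg_left hβ.1.1 (by positivity)).trans hβ.2.1, neg_le.1 hβ.1.2⟩
  · exact ⟨hβ.2.2.trans (mul_le_mul_of_nonneg_left hβ.1.2 (by positivity)), le_neg.1 hβ.1.1⟩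

lemma convex_demandBox : Convex ℝ (demandBox b₁ b₂ y₁ y₂) := by
  rintro β ⟨⟨hy₁, hy₂⟩, hb₁, hb₂⟩ β' ⟨⟨hy₁', hy₂'⟩, hb₁', hb₂'⟩ s t hs ht hst
  simp only [demandBox, Set.mem_ofPred_eq, Pi.add_apply, Pi.smul_apply, smul_eq_mul]
  refine ⟨⟨?_, ?_⟩, ?_, ?_⟩
  · linear_combination s * hy₁ + t * hy₁' - y₁ * hst
  · linear_combination s * hy₂ + t * hy₂' + y₂ * hst
  · linear_combination s * hb₁ + t * hb₁'
  · linear_combination s * hb₂ + t * hb₂'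

lemma demandBox_subset_interior {b₁' b₂' y₁' y₂' : ℝ} (hy₁' : 0 < y₁') (hb₁ : b₁ < b₁')
    (hb₂ : b₂' < b₂) (hy₁ : y₁ < y₁') (hy₂ : y₂' < y₂) :
    demandBox b₁' b₂' y₁' y₂' ⊆ interior (demandBox b₁ b₂ y₁ y₂) := by
  have hopen : IsOpen {β : Fin 2 → ℝ |
      (y₁ < -β 1 ∧ -β 1 < y₂) ∧ 2 * b₁ * -β 1 < β 0 ∧ β 0 < 2 * b₂ * -β 1} := by
    simp only [Set.ofPred_and]
    refine (IsOpen.inter ?_ ?_).inter (IsOpen.inter ?_ ?_) <;>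
      exact isOpen_lt (by fun_prop) (by fun_prop)
  refine subset_trans (fun β ⟨⟨h1, h2⟩, h3, h4⟩ => ?_) (interior_maximal (fun β hβ =>
    ⟨⟨hβ.1.1.le, hβ.1.2.le⟩, hβ.2.1.le, hβ.2.2.le⟩) hopen)
  have hslope : 0 < -β 1 := hy₁'.trans_le h1
  exact ⟨⟨hy₁.trans_le h1, h2.trans_lt hy₂⟩,
    (by gcongr : 2 * b₁ * -β 1 < 2 * b₁' * -β 1).trans_le h3,
    h4.trans_lt (by gcongr : 2 * b₂' * -β 1 < 2 * b₂ * -β 1)⟩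

end DemandBox

lemma HasStableDemand.optBeta_mem_demandBox {lo hi L : ℝ} {m : Measure ℝ}
    (h : HasStableDemand lo hi L m) (hlo : 0 < lo) (hhi : 0 < hi) :
    optBeta m ∈ demandBox (lo / 3) (3 * hi / 2) (lo / (2 * hi)) (2 / lo) := by
  have hprice : 0 < optPrice m := hlo.trans_le h.opt_mem.1
  have hquantity : 0 < optQuantity m := hlo.trans_le h.lo_le_optQuantity
  have hslope : optBeta m 1 < 0 := neg_lt_zero.2 (div_pos hquantity hprice)
  have hlin : linPrice (optBeta m) = optPrice m := by
    simp only [linPrice, optBeta, Matrix.cons_val_zero, Matrix.cons_val_one,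
      Matrix.cons_val_fin_one]
    field_simp
  rw [mem_demandBox_iff hslope, hlin]
  refine ⟨⟨?_, ?_⟩, by linarith [h.opt_mem.1], by linarith [h.opt_mem.2]⟩ <;>
    simp only [optBeta, Matrix.cons_val_one, Matrix.cons_val_fin_one, neg_neg]
  · gcongr
    exacts [h.lo_le_optQuantity, by linarith [h.opt_mem.2]]
  · gcongr
    exacts [by linarith [optQuantity_le_one m], h.opt_mem.1]

namespace LyapunovConstants

variable {lo hi L : ℝ} (c : LyapunovConstants lo hi L)

lemma lt_y₂ : 2 / lo < c.y₂ := by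
  rw [div_lt_iff₀ c.lo_pos]
  have := mul_le_mul_of_nonneg_left (pow_le_of_le_one c.lo_pos.le c.lo_le_one two_ne_zero)
    (zero_le_one.trans c.one_le_y₂)
  linarith [c.y₂_exit, c.sixteen_le_R, c.one_le_hi]

/-- The projection facility whose box consists of the admissible linear demands of `c`. -/
def projectionFacility {𝓕 : Set (Measure ℝ)} (h : ∀ m ∈ 𝓕, HasStableDemand lo hi L m) :
    ProjectionFacility 𝓕 where
  core := demandBox (lo / 3) (3 * hi / 2) (lo / (2 * hi)) (2 / lo)
  box := demandBox (lo / 4) (2 * hi) c.y₁ c.y₂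
  reset := ![lo, -1]
  core_compact := isCompact_demandBox (by linarith [c.lo_pos]) (by linarith [c.one_le_hi])
  opt_mem_core m hm := (h m hm).optBeta_mem_demandBox c.lo_pos (by linarith [c.one_le_hi])
  box_compact := isCompact_demandBox (by linarith [c.lo_pos]) (by linarith [c.one_le_hi])
  box_convex := convex_demandBox
  core_subset := demandBox_subset_interior (c.y₁_pos.trans c.y₁_lt) (by linarith [c.lo_pos])
    (by linarith [c.one_le_hi]) c.y₁_lt c.lt_y₂
  box_sign _ := demandBox_sign (by linarith [c.lo_pos]) c.y₁_pos
  reset_mem := by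
    have hlo := c.lo_pos
    have hlo1 := c.lo_le_one
    have hhi := c.one_le_hi
    refine demandBox_subset_interior (b₁' := lo / 2) (b₂' := lo / 2) (y₁' := 1) (y₂' := 1) one_pos
      (by linarith) (by linarith) ((div_lt_one (by linarith)).2 (by linarith))
      ((one_lt_div hlo).2 (by linarith)) ?_
    simp [demandBox, mul_div_cancel₀]

variable {𝓕 : Set (Measure ℝ)} (h : ∀ m ∈ 𝓕, HasStableDemand lo hi L m) {β : Fin 2 → ℝ}

lemma mem_projectionFacility_box_iff (hβ : β 1 < 0) :
    β ∈ (c.projectionFacility h).box ↔ c.Admissible (linPrice β) (-β 1) := by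
  refine (mem_demandBox_iff hβ).trans ⟨fun hβ' => ?_, fun hβ' => ?_⟩
  · exact ⟨hβ'.2.1, hβ'.2.2, hβ'.1.1, hβ'.1.2⟩
  · exact ⟨⟨hβ'.le_slope, hβ'.slope_le⟩, hβ'.le_price, hβ'.price_le⟩

lemma admissible_of_mem_box (hβ : β ∈ (c.projectionFacility h).box) :
    c.Admissible (linPrice β) (-β 1) :=
  (c.mem_projectionFacility_box_iff h ((c.projectionFacility h).box_sign β hβ).2).1 hβ

end LyapunovConstants

section Quantity

variable {N : ℕ} {ν : Fin N → Measure ℝ}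

lemma quantity_mem_Icc (v : Fin N → ℝ) (p : ℝ) : quantity v p ∈ Set.Icc 0 1 := by
  unfold quantity
  refine ⟨by positivity, div_le_one_of_le₀ ?_ (Nat.cast_nonneg N)⟩
  rw [Finset.sum_boole]
  exact_mod_cast (Finset.card_filter_le _ _).trans_eq (Finset.card_fin N)

lemma measurable_quantity : Measurable fun z : (Fin N → ℝ) × ℝ => quantity z.1 z.2 := by
  refine Measurable.div_const (Finset.measurable_sum _ fun i _ => ?_) _
  exact Measurable.ite (measurableSet_le (by fun_prop) (by fun_prop)) (by fun_prop) (by fun_prop)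

lemma integral_quantity [∀ i, IsProbabilityMeasure (ν i)] [IsProbabilityMeasure (aggregate ν)]
    [NullSingletonClass (aggregate ν)] (p : ℝ) :
    ∫ v, quantity v p ∂Measure.pi ν = 1 - cdf (aggregate ν) p := by
  have hint (i : Fin N) : Integrable (fun v : Fin N → ℝ => if p ≤ v i then (1 : ℝ) else 0)
      (Measure.pi ν) :=
    .of_bound (C := 1) (Measurable.ite (measurableSet_le (by fun_prop) (by fun_prop))
      (by fun_prop) (by fun_prop)).aestronglyMeasurable (.of_forall fun v => by split_ifs <;> simp)
  have hbuyer (i : Fin N) : ∫ v : Fin N → ℝ, (if p ≤ v i then (1 : ℝ) else 0) ∂Measure.pi ν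
      = (ν i).real (Set.Ici p) := by
    rw [← (measurePreserving_eval ν i).measureReal_preimage measurableSet_Ici.nullMeasurableSet,
      ← integral_indicator_one (measurableSet_Ici.preimage (measurable_pi_apply i))]
    rfl
  rw [← real_Ici_eq_one_sub_cdf]
  simp only [quantity, aggregate]
  rw [integral_div, integral_finsetSum _ fun i _ => hint i, measureReal_ennreal_smul_apply,
    measureReal_def, Measure.finsetSum_apply, ENNReal.toReal_sum fun i _ => measure_ne_top _ _,
    ENNReal.toReal_inv, ENNReal.toReal_natCast, div_eq_inv_mul]
  simp only [hbuyer, measureReal_def]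

lemma integrable_quantity [∀ i, IsProbabilityMeasure (ν i)] (p : ℝ) :
    Integrable (fun v => quantity v p) (Measure.pi ν) := by
  refine .of_bound (C := 1) (measurable_quantity.comp
    (measurable_id.prodMk measurable_const)).aestronglyMeasurable (.of_forall fun v => ?_)
  rw [Real.norm_eq_abs, abs_of_nonneg (quantity_mem_Icc v p).1]
  exact (quantity_mem_Icc v p).2

end Quantity

/-- The error of the linear demand with price `b` and slope `-y` in forecasting the quantity, when
the shocks are `z`. -/
def forecastError {N : ℕ} (b y : ℝ) (z : ℝ × (Fin N → ℝ)) : ℝ :=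
  quantity z.2 (b + z.1) - b * y + y * z.1

section ForecastError

variable {N : ℕ} {ν : Fin N → Measure ℝ} {ε b y : ℝ}

@[fun_prop]
lemma measurable_forecastError : Measurable (forecastError (N := N) b y) := by
  have : Measurable fun z : ℝ × (Fin N → ℝ) => quantity z.2 (b + z.1) :=
    measurable_quantity.comp (f := fun z : ℝ × (Fin N → ℝ) => (z.2, b + z.1)) (by fun_prop)
  unfold forecastError
  fun_prop

lemma abs_forecastError_le (hb : 0 ≤ b) (hy : 0 ≤ y) {z : ℝ × (Fin N → ℝ)} (hz : |z.1| ≤ ε) :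
    |forecastError b y z| ≤ 1 + b * y + y * ε := by
  obtain ⟨hq₀, hq₁⟩ := quantity_mem_Icc z.2 (b + z.1)
  have hnoise := mul_le_mul_of_nonneg_left (abs_le.1 hz).1 hy
  have hnoise' := mul_le_mul_of_nonneg_left (abs_le.1 hz).2 hy
  have hby := mul_nonneg hb hy
  unfold forecastError
  exact abs_le.2 ⟨by linarith, by linarith⟩

lemma ae_abs_fst_le [∀ i, IsProbabilityMeasure (ν i)] (hε : 0 < ε) :
    ∀ᵐ z ∂(noiseLaw ε).prod (Measure.pi ν), |z.1| ≤ ε := by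
  have := isProbabilityMeasure_noiseLaw hε
  exact Measure.quasiMeasurePreserving_fst.ae (ae_abs_le_noiseLaw ε)

lemma integral_residual_mul_noiseLaw (hε : 0 < ε) (m : Measure ℝ) (b y s t : ℝ) :
    ∫ e, (1 - cdf m (b + e) - b * y + y * e) * (s + t * e) ∂noiseLaw ε
      = s * (meanDemand m ε b - b * y) + t * (ε ^ 2 / 3) * (y - demandSlope m ε b) := by
  have := isProbabilityMeasure_noiseLaw hε
  have hexpand (e : ℝ) : (1 - cdf m (b + e) - b * y + y * e) * (s + t * e)
      = s * (1 - cdf m (b + e)) - t * (e * cdf m (b + e))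
        + ((s * y + t * (1 - b * y)) * e + t * y * e ^ 2 - s * (b * y)) := by ring
  have hdemand := (integrable_survival_noiseLaw hε m b).const_mul s
  have hslope := (integrable_mul_cdf_noiseLaw hε m b).const_mul t
  have hmarket : Integrable (fun e => s * (1 - cdf m (b + e))
      - t * (e * cdf m (b + e))) (noiseLaw ε) := hdemand.sub hslope
  have hlin := (integrable_noiseLaw_of_abs_le hε (g := fun e => e) measurable_id
    fun _ he => he).const_mul (s * y + t * (1 - b * y))
  have hsq := integrable_const_mul_sq_noiseLaw hε (t * y)
  have hnoise : Integrable (fun e => (s * y + t * (1 - b * y)) * e + t * y * e ^ 2)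
      (noiseLaw ε) := hlin.add hsq
  have hmodel : Integrable (fun e => (s * y + t * (1 - b * y)) * e + t * y * e ^ 2 - s * (b * y))
      (noiseLaw ε) := hnoise.sub (integrable_const _)
  simp only [hexpand]
  rw [integral_add hmarket hmodel, integral_sub hdemand hslope,
    integral_sub hnoise (integrable_const _), integral_add hlin hsq,
    integral_const_mul, integral_const_mul, integral_const_mul _ fun e : ℝ => e,
    integral_const_mul, integral_id_noiseLaw hε, integral_sq_noiseLaw hε, integral_const,
    probReal_univ, one_smul, meanDemand, demandSlope]
  field_simp
  ring

variable [∀ i, IsProbabilityMeasure (ν i)] [IsProbabilityMeasure (aggregate ν)]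
  [NullSingletonClass (aggregate ν)]

lemma integral_forecastError_right (e : ℝ) :
    ∫ v, forecastError b y (e, v) ∂Measure.pi ν
      = 1 - cdf (aggregate ν) (b + e) - b * y + y * e := by
  simp only [forecastError, sub_add]
  rw [integral_sub (integrable_quantity _) (integrable_const _), integral_quantity,
    integral_const, probReal_univ, one_smul]

lemma integral_forecastError_mul (hε : 0 < ε) (hb : 0 ≤ b) (hy : 0 ≤ y) (s t : ℝ) :
    ∫ z, forecastError b y z * (s + t * z.1) ∂(noiseLaw ε).prod (Measure.pi ν)
      = s * (meanDemand (aggregate ν) ε b - b * y)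
        + t * (ε ^ 2 / 3) * (y - demandSlope (aggregate ν) ε b) := by
  have := isProbabilityMeasure_noiseLaw hε
  have hbound : ∀ᵐ z ∂(noiseLaw ε).prod (Measure.pi ν),
      ‖forecastError b y z * (s + t * z.1)‖ ≤ (1 + b * y + y * ε) * (|s| + |t| * ε) := by
    filter_upwards [ae_abs_fst_le hε] with z hz
    rw [norm_mul]
    refine mul_le_mul (abs_forecastError_le hb hy hz) ((norm_add_le _ _).trans ?_)
      (norm_nonneg _) (by positivity)
    rw [norm_mul]
    exact add_le_add le_rfl (mul_le_mul_of_nonneg_left hz (abs_nonneg t))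
  rw [integral_prod _ (.of_bound (by fun_prop) _ hbound)]
  simp only [integral_mul_const, integral_forecastError_right]
  exact integral_residual_mul_noiseLaw hε (aggregate ν) b y s t

end ForecastError

lemma inv_momentMatrix_mulVec {ε : ℝ} (hε : ε ≠ 0) (b e : ℝ) :
    (momentMatrix ε b)⁻¹ *ᵥ ![1, b + e] = ![1 - b * (3 * e / ε ^ 2), 3 * e / ε ^ 2] := by
  have hdet : (momentMatrix ε b).det = ε ^ 2 / 3 := by
    rw [momentMatrix, Matrix.det_fin_two_of]
    ring
  rw [Matrix.inv_def, hdet, momentMatrix, Matrix.adjugate_fin_two_of, Ring.inverse_eq_inv']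
  ext i
  fin_cases i <;> simp [Matrix.mulVec, dotProduct, Fin.sum_univ_two] <;> field_simp <;> ring

open Classical in
/-- One period of the constant-gain algorithm, as a map of the estimate and the shocks. -/
def lsStep {𝓕 : Set (Measure ℝ)} (pf : ProjectionFacility 𝓕) (ε a : ℝ) {N : ℕ} (β : Fin 2 → ℝ)
    (z : ℝ × (Fin N → ℝ)) : Fin 2 → ℝ :=
  if lsUpdate ε a β (linPrice β + z.1) (quantity z.2 (linPrice β + z.1)) ∈ pf.box then
    lsUpdate ε a β (linPrice β + z.1) (quantity z.2 (linPrice β + z.1)) else pf.reset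

section Step

variable {𝓕 : Set (Measure ℝ)} (pf : ProjectionFacility 𝓕) {N : ℕ} {ε a : ℝ} {β : Fin 2 → ℝ}

lemma lsStep_mem_box (z : ℝ × (Fin N → ℝ)) : lsStep pf ε a β z ∈ pf.box := by
  unfold lsStep
  split_ifs with h
  exacts [h, interior_subset (pf.core_subset (interior_subset pf.reset_mem))]

@[fun_prop]
lemma measurable_linPrice : Measurable linPrice := by
  unfold linPrice
  fun_prop

lemma measurable_lsStep (hε : ε ≠ 0) :
    Measurable (Function.uncurry (lsStep pf ε a (N := N))) := by
  have hquantity : Measurable fun w : (Fin 2 → ℝ) × ℝ × (Fin N → ℝ) =>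
      quantity w.2.2 (linPrice w.1 + w.2.1) :=
    measurable_quantity.comp (f := fun w : (Fin 2 → ℝ) × ℝ × (Fin N → ℝ) =>
      (w.2.2, linPrice w.1 + w.2.1)) (by fun_prop)
  have hupdate : Measurable fun w : (Fin 2 → ℝ) × ℝ × (Fin N → ℝ) =>
      lsUpdate ε a w.1 (linPrice w.1 + w.2.1) (quantity w.2.2 (linPrice w.1 + w.2.1)) := by
    simp only [lsUpdate, inv_momentMatrix_mulVec hε]
    refine measurable_pi_iff.2 fun i => ?_
    fin_cases i <;> simp only [Matrix.smul_cons, smul_eq_mul, Matrix.smul_empty, Fin.zero_eta,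
      Fin.mk_one, Pi.add_apply, Matrix.cons_val_zero, Matrix.cons_val_one,
      Matrix.cons_val_fin_one] <;> fun_prop
  exact Measurable.ite (hupdate pf.box_compact.isClosed.measurableSet) hupdate measurable_const

lemma lsUpdate_quantity (hε : ε ≠ 0) (hβ : β 1 ≠ 0) (z : ℝ × (Fin N → ℝ)) :
    lsUpdate ε a β (linPrice β + z.1) (quantity z.2 (linPrice β + z.1))
      = β + (a * forecastError (linPrice β) (-β 1) z)
        • ![1 - linPrice β * (3 * z.1 / ε ^ 2), 3 * z.1 / ε ^ 2] := by
  have hintercept : β 0 = 2 * (linPrice β * -β 1) := by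
    rw [linPrice_mul_neg_slope hβ]
    ring
  rw [lsUpdate, inv_momentMatrix_mulVec hε, forecastError]
  congr 3
  linear_combination -hintercept

lemma linPrice_add_smul (hβ : β 1 ≠ 0) {α γ : ℝ} (hγ : -β 1 - α * γ ≠ 0) :
    (linPrice (β + α • ![1 - linPrice β * γ, γ]) - linPrice β) * (2 * (-β 1 - α * γ))
      = α + linPrice β * (α * γ) := by
  have hγ' : -(β 1 + α * γ) ≠ 0 := by rwa [neg_add']
  have hintercept : β 0 = 2 * (linPrice β * -β 1) := by
    rw [linPrice_mul_neg_slope hβ]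
    ring
  rw [linPrice_eq (β + _)]
  simp only [Pi.add_apply, Pi.smul_apply, smul_eq_mul, Matrix.cons_val_zero, Matrix.cons_val_one,
    Matrix.cons_val_fin_one]
  rw [sub_mul, ← neg_add', div_mul_cancel₀ _ (mul_ne_zero two_ne_zero hγ')]
  linear_combination hintercept

end Step

namespace LyapunovConstants

variable {lo hi L : ℝ} (c : LyapunovConstants lo hi L)

/-- The Lyapunov function of the estimates, in a market with aggregate distribution `m`. -/
def estimateLyapunov (m : Measure ℝ) (β : Fin 2 → ℝ) : ℝ :=
  lyapunov c.K c.E (optPrice m) (optPrice m * optQuantity m) (linPrice β) (-β 1)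

@[fun_prop]
lemma measurable_estimateLyapunov (m : Measure ℝ) : Measurable (c.estimateLyapunov m) := by
  unfold estimateLyapunov lyapunov entropyGap
  fun_prop

/-- The first-order change of the Lyapunov function at the estimate `β` when the shocks are `z`. -/
def lyapunovIncrement (m : Measure ℝ) (ε a : ℝ) {N : ℕ} (β : Fin 2 → ℝ) (z : ℝ × (Fin N → ℝ)) : ℝ :=
  lyapunovDeriv c.K c.E (optPrice m) (optPrice m * optQuantity m) (linPrice β) (-β 1)
    (a * forecastError (linPrice β) (-β 1) z)
    (a * forecastError (linPrice β) (-β 1) z * (3 * z.1 / ε ^ 2))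

@[fun_prop]
lemma measurable_lyapunovIncrement (m : Measure ℝ) (ε a : ℝ) {N : ℕ} (β : Fin 2 → ℝ) :
    Measurable (c.lyapunovIncrement m ε a (N := N) β) := by
  unfold lyapunovIncrement lyapunovDeriv
  fun_prop

variable {𝓕 : Set (Measure ℝ)} (h𝓕 : ∀ m ∈ 𝓕, HasStableDemand lo hi L m) {N : ℕ} {ε a s : ℝ}
  {m : Measure ℝ} {β : Fin 2 → ℝ} {z : ℝ × (Fin N → ℝ)}

lemma estimateLyapunov_reset_le (h : HasStableDemand lo hi L m) (hβ : β 1 < 0)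
    (hprice : 0 < linPrice β) (hslope : c.y₁ / 2 ≤ -β 1)
    (hexit : β ∉ (c.projectionFacility h𝓕).box) :
    c.estimateLyapunov m (c.projectionFacility h𝓕).reset ≤ c.estimateLyapunov m β := by
  have hreset : linPrice (c.projectionFacility h𝓕).reset = lo / 2
      ∧ -(c.projectionFacility h𝓕).reset 1 = 1 := by
    simp [projectionFacility, linPrice]
  rw [estimateLyapunov, hreset.1, hreset.2]
  exact c.lyapunov_reset_le_of_not_admissible h.opt_mem (h.optProfit_mem c.lo_pos) hprice hslope
    (mt (c.mem_projectionFacility_box_iff h𝓕 hβ).2 hexit)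

lemma estimateLyapunov_lsStep_le (h : HasStableDemand lo hi L m)
    (hβ : β ∈ (c.projectionFacility h𝓕).box) (hε : ε ≠ 0) (hs : 4 * c.M ^ 6 * s ≤ 1)
    (hα : |a * forecastError (linPrice β) (-β 1) z| ≤ s)
    (hγ : |a * forecastError (linPrice β) (-β 1) z * (3 * z.1 / ε ^ 2)| ≤ s) :
    c.estimateLyapunov m (lsStep (c.projectionFacility h𝓕) ε a β z) ≤ c.estimateLyapunov m β
      + c.lyapunovIncrement m ε a β z + 14 * c.M ^ 6 * s ^ 2 := by
  have hadm := c.admissible_of_mem_box h𝓕 hβ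
  have hβ₁ : β 1 < 0 := neg_pos.1 hadm.slope_pos
  set α := a * forecastError (linPrice β) (-β 1) z
  set γ := 3 * z.1 / ε ^ 2
  set β' := β + α • ![1 - linPrice β * γ, γ] with hβ'
  have hβ'₁ : -β' 1 = -β 1 - α * γ := by
    simp only [hβ', Pi.add_apply, Pi.smul_apply, smul_eq_mul, Matrix.cons_val_one,
      Matrix.cons_val_fin_one, neg_add']
  have hslope := hadm.half_slope_le_sub hγ hs
  have hslope_pos : 0 < -β 1 - α * γ := (half_pos hadm.slope_pos).trans_le hslope
  have hd := linPrice_add_smul hβ₁.ne hslope_pos.ne'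
  have hle : c.estimateLyapunov m β' ≤ c.estimateLyapunov m β
      + c.lyapunovIncrement m ε a β z + 14 * c.M ^ 6 * s ^ 2 := by
    have := hadm.lyapunov_step_le h.opt_mem (h.optProfit_mem c.lo_pos) hα hγ hs hd
    rwa [add_sub_cancel, ← hβ'₁] at this
  unfold lsStep
  rw [lsUpdate_quantity hε hβ₁.ne, ← hβ']
  split_ifs with hbox
  · exact hle
  have hprice : 0 < linPrice β' := by
    have hstep := neg_le_of_abs_le (hadm.abs_step_le hα hγ hs hd)
    linarith [hadm.le_price, c.two_mul_sq_mul_lt_of_mul_le_one hs]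
  exact (c.estimateLyapunov_reset_le h𝓕 h (by linarith) hprice
    (by linarith [hadm.le_slope]) hbox).trans hle

end LyapunovConstants

lemma lintegral_exp_mul_le_of_abs_le {Z : Type*} [MeasurableSpace Z] {Λ : Measure Z}
    [IsProbabilityMeasure Λ] {W : Z → ℝ} {w : ℝ} (hW : AEMeasurable W Λ)
    (hw : ∀ᵐ z ∂Λ, |W z| ≤ w) (θ : ℝ) :
    ∫⁻ z, ENNReal.ofReal (Real.exp (θ * W z)) ∂Λ
      ≤ ENNReal.ofReal (Real.exp (θ * ∫ z, W z ∂Λ + θ ^ 2 * w ^ 2 / 2)) := by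
  have hIcc : ∀ᵐ z ∂Λ, W z ∈ Set.Icc (-w) w := hw.mono fun z => abs_le.1
  rw [← ofReal_integral_eq_lintegral_ofReal (integrable_exp_mul_of_mem_Icc hW hIcc)
    (.of_forall fun z => (Real.exp_pos _).le)]
  refine ENNReal.ofReal_le_ofReal ?_
  have hoeffding := (hasSubgaussianMGF_of_mem_Icc hW hIcc).mgf_le θ
  have hvariance : (((‖w - -w‖₊ / 2) ^ 2 : NNReal) : ℝ) = w ^ 2 := by
    rw [sub_neg_eq_add, ← two_mul, NNReal.coe_pow, NNReal.coe_div, coe_nnnorm, norm_mul]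
    simp
  rw [hvariance] at hoeffding
  simp only [sub_eq_add_neg, mgf_add_const, mul_neg, Real.exp_neg] at hoeffding
  rw [← div_eq_mul_inv, div_le_iff₀ (Real.exp_pos _), ← Real.exp_add] at hoeffding
  exact hoeffding.trans_eq (by ring_nf)

lemma exists_lyapunovDeriv_eq (K E b₀ w₀ b y : ℝ) :
    ∃ k k', ∀ α γ, lyapunovDeriv K E b₀ w₀ b y α γ = k * α + k' * γ :=
  ⟨E * max (b - b₀) 0 - K * max (b₀ - b) 0 / y + (1 - w₀ / (b ^ 2 * y)) * b,
    (E * max (b - b₀) 0 - K * max (b₀ - b) 0 / y) * b - E * max (b - b₀) 0 ^ 2,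
    fun α γ => by unfold lyapunovDeriv; ring⟩

namespace LyapunovConstants

variable {lo hi L : ℝ} {c : LyapunovConstants lo hi L} {N : ℕ} {ε a b y : ℝ}

namespace Admissible

lemma abs_forecastError_le (hby : c.Admissible b y) (hε1 : ε ≤ 1) {z : ℝ × (Fin N → ℝ)}
    (hz : |z.1| ≤ ε) : |forecastError b y z| ≤ c.M ^ 2 := by
  have hy := hby.slope_pos
  calc |forecastError b y z| ≤ 1 + b * y + y * ε :=
        MonopolyLearning.abs_forecastError_le hby.price_pos.le hy.le hz
    _ ≤ 1 + c.M * y + y * 1 := by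
        gcongr
        exact hby.price_le_M
    _ ≤ c.M ^ 2 := by nlinarith [hby.slope_add_one_le_M, c.two_le_M]

lemma abs_mul_forecastError_le (hby : c.Admissible b y) (ha : 0 ≤ a) (hε : 0 < ε) (hε1 : ε ≤ 1)
    {z : ℝ × (Fin N → ℝ)} (hz : |z.1| ≤ ε) :
    |a * forecastError b y z| ≤ 3 * a * c.M ^ 2 / ε
      ∧ |a * forecastError b y z * (3 * z.1 / ε ^ 2)| ≤ 3 * a * c.M ^ 2 / ε := by
  have hα : |a * forecastError b y z| ≤ a * c.M ^ 2 := by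
    rw [abs_mul, abs_of_nonneg ha]
    gcongr
    exact hby.abs_forecastError_le hε1 hz
  constructor
  · rw [le_div_iff₀ hε]
    have : 0 ≤ a * c.M ^ 2 := by positivity
    nlinarith [abs_nonneg (a * forecastError b y z)]
  · have hregressor : |3 * z.1 / ε ^ 2| ≤ 3 * ε / ε ^ 2 := by
      rw [abs_div, abs_mul, abs_of_pos three_pos, abs_of_nonneg (sq_nonneg ε)]
      gcongr
    rw [abs_mul]
    calc _ ≤ a * c.M ^ 2 * (3 * ε / ε ^ 2) := by gcongr
      _ = 3 * a * c.M ^ 2 / ε := by field_simp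

end Admissible

variable (c)

lemma integral_lyapunovIncrement {ν : Fin N → Measure ℝ} [∀ i, IsProbabilityMeasure (ν i)]
    [IsProbabilityMeasure (aggregate ν)] [NullSingletonClass (aggregate ν)] (hε : 0 < ε)
    {β : Fin 2 → ℝ} (hb : 0 ≤ linPrice β) (hy : 0 ≤ -β 1) (m : Measure ℝ) (a : ℝ) :
    ∫ z, c.lyapunovIncrement m ε a β z ∂(noiseLaw ε).prod (Measure.pi ν)
      = a * lyapunovDeriv c.K c.E (optPrice m) (optPrice m * optQuantity m) (linPrice β) (-β 1)
          (meanDemand (aggregate ν) ε (linPrice β) - linPrice β * -β 1)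
          (-β 1 - demandSlope (aggregate ν) ε (linPrice β)) := by
  obtain ⟨k, k', hlinear⟩ := exists_lyapunovDeriv_eq c.K c.E (optPrice m)
    (optPrice m * optQuantity m) (linPrice β) (-β 1)
  calc _ = ∫ z, forecastError (linPrice β) (-β 1) z * (a * k + a * k' * (3 / ε ^ 2) * z.1)
        ∂(noiseLaw ε).prod (Measure.pi ν) := by
        simp only [lyapunovIncrement, hlinear]
        congr 1 with z
        ring
    _ = _ := by
        rw [integral_forecastError_mul hε hb hy, hlinear]
        field_simp

variable {𝓕 : Set (Measure ℝ)} (h𝓕 : ∀ m ∈ 𝓕, HasStableDemand lo hi L m)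
  {ν : Fin N → Measure ℝ} [∀ i, IsProbabilityMeasure (ν i)] [IsProbabilityMeasure (aggregate ν)]
  [NullSingletonClass (aggregate ν)] {θ : ℝ} {β : Fin 2 → ℝ}

lemma lintegral_exp_lyapunovIncrement_le (h : HasStableDemand lo hi L (aggregate ν))
    (hβ : c.Admissible (linPrice β) (-β 1)) (hε : 0 < ε) (hε1 : ε ≤ 1) (ha : 0 ≤ a) (hθ : 0 ≤ θ) :
    ∫⁻ z, ENNReal.ofReal (Real.exp (θ * c.lyapunovIncrement (aggregate ν) ε a β z))
        ∂(noiseLaw ε).prod (Measure.pi ν)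
      ≤ ENNReal.ofReal (Real.exp
          (θ * (a * (3 * c.M ^ 3 * ε - c.estimateLyapunov (aggregate ν) β / c.M ^ 3))
            + θ ^ 2 * (7 * c.M ^ 4 * (3 * a * c.M ^ 2 / ε)) ^ 2 / 2)) := by
  have := isProbabilityMeasure_noiseLaw hε
  refine (lintegral_exp_mul_le_of_abs_le (w := 7 * c.M ^ 4 * (3 * a * c.M ^ 2 / ε))
    (by fun_prop) ?_ θ).trans (ENNReal.ofReal_le_ofReal (Real.exp_le_exp.2 ?_))
  · filter_upwards [ae_abs_fst_le hε] with z hz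
    obtain ⟨hα, hγ⟩ := hβ.abs_mul_forecastError_le ha hε hε1 hz
    exact hβ.abs_lyapunovDeriv_le h.opt_mem (h.optProfit_mem c.lo_pos) hα hγ
  · rw [c.integral_lyapunovIncrement hε hβ.price_pos.le hβ.slope_pos.le]
    gcongr
    exact hβ.lyapunovDeriv_meanDemand_le h hε hε1

lemma second_order_terms_le (hε : 0 < ε) (ha : 0 ≤ a) (haε : a ≤ ε ^ 3) (hθ : 0 ≤ θ)
    (hθa : θ * a ≤ ε ^ 3) :
    θ * (14 * c.M ^ 6 * (3 * a * c.M ^ 2 / ε) ^ 2 + a * (3 * c.M ^ 3 * ε))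
        + θ ^ 2 * (7 * c.M ^ 4 * (3 * a * c.M ^ 2 / ε)) ^ 2 / 2
      ≤ θ * (a / c.M ^ 3 * (350 * c.M ^ 15 * ε)) := by
  have hM := c.two_le_M
  have := c.M_pos
  have hremainder : 14 * c.M ^ 6 * (3 * a * c.M ^ 2 / ε) ^ 2 ≤ 126 * c.M ^ 12 * (a * ε) := by
    calc 14 * c.M ^ 6 * (3 * a * c.M ^ 2 / ε) ^ 2 = 126 * c.M ^ 10 * (a * a / ε ^ 2) := by ring
      _ ≤ 126 * c.M ^ 12 * (a * ε ^ 3 / ε ^ 2) := by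
        gcongr
        exacts [by linarith, by norm_num]
      _ = 126 * c.M ^ 12 * (a * ε) := by field_simp
  have hdrift : a * (3 * c.M ^ 3 * ε) ≤ 3 * c.M ^ 12 * (a * ε) := by
    calc a * (3 * c.M ^ 3 * ε) = 3 * c.M ^ 3 * (a * ε) := by ring
      _ ≤ 3 * c.M ^ 12 * (a * ε) := by
        gcongr
        exacts [by linarith, by norm_num]
  have hvariance : θ ^ 2 * (7 * c.M ^ 4 * (3 * a * c.M ^ 2 / ε)) ^ 2 / 2
      ≤ θ * (221 * c.M ^ 12 * (a * ε)) := by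
    calc _ = θ * (441 / 2 * c.M ^ 12 * (θ * a * a / ε ^ 2)) := by ring
      _ ≤ θ * (221 * c.M ^ 12 * (ε ^ 3 * a / ε ^ 2)) := by
        gcongr
        norm_num
      _ = θ * (221 * c.M ^ 12 * (a * ε)) := by field_simp
  calc _ ≤ θ * (126 * c.M ^ 12 * (a * ε) + 3 * c.M ^ 12 * (a * ε))
        + θ * (221 * c.M ^ 12 * (a * ε)) := by gcongr
    _ = θ * (a / c.M ^ 3 * (350 * c.M ^ 15 * ε)) := by
      field_simp
      ring

lemma lintegral_exp_estimateLyapunov_le (h : HasStableDemand lo hi L (aggregate ν))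
    (hβ : β ∈ (c.projectionFacility h𝓕).box) (hε : 0 < ε) (hε1 : ε ≤ 1) (ha : 0 ≤ a)
    (haε : 12 * c.M ^ 8 * a ≤ ε ^ 3) (hθ : 0 ≤ θ) (hθa : θ * a ≤ ε ^ 3) :
    ∫⁻ z, ENNReal.ofReal (Real.exp (θ * c.estimateLyapunov (aggregate ν)
        (lsStep (c.projectionFacility h𝓕) ε a β z))) ∂(noiseLaw ε).prod (Measure.pi ν)
      ≤ ENNReal.ofReal (Real.exp (θ * ((1 - a / c.M ^ 3) * c.estimateLyapunov (aggregate ν) β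
          + a / c.M ^ 3 * (350 * c.M ^ 15 * ε)))) := by
  have hM := c.two_le_M
  have hadm := c.admissible_of_mem_box h𝓕 hβ
  set V := c.estimateLyapunov (aggregate ν) β
  set s := 3 * a * c.M ^ 2 / ε with hs
  have hs_small : 4 * c.M ^ 6 * s ≤ 1 := by
    have hε3 : ε ^ 3 ≤ ε := pow_le_of_le_one hε.le hε1 three_ne_zero
    rw [hs, ← mul_div_assoc, div_le_one₀ hε]
    linarith
  have ha3 : a ≤ ε ^ 3 := by nlinarith [one_le_pow₀ (show 1 ≤ c.M by linarith) (n := 8)]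
  calc _ ≤ ∫⁻ z, ENNReal.ofReal (Real.exp (θ * (V + 14 * c.M ^ 6 * s ^ 2))) * ENNReal.ofReal
          (Real.exp (θ * c.lyapunovIncrement (aggregate ν) ε a β z))
        ∂(noiseLaw ε).prod (Measure.pi ν) := by
        refine lintegral_mono_ae ?_
        filter_upwards [ae_abs_fst_le hε] with z hz
        obtain ⟨hα, hγ⟩ := hadm.abs_mul_forecastError_le ha hε hε1 hz
        rw [← ENNReal.ofReal_mul (Real.exp_pos _).le, ← Real.exp_add, ← mul_add]
        gcongr
        exact (c.estimateLyapunov_lsStep_le h𝓕 h hβ hε.ne' hs_small hα hγ).trans_eq (by ring)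
    _ ≤ ENNReal.ofReal (Real.exp (θ * (V + 14 * c.M ^ 6 * s ^ 2))) * ENNReal.ofReal (Real.exp
          (θ * (a * (3 * c.M ^ 3 * ε - V / c.M ^ 3)) + θ ^ 2 * (7 * c.M ^ 4 * s) ^ 2 / 2)) := by
        rw [lintegral_const_mul _ (by fun_prop)]
        gcongr
        exact c.lintegral_exp_lyapunovIncrement_le h hadm hε hε1 ha hθ
    _ ≤ _ := by
        rw [← ENNReal.ofReal_mul (Real.exp_pos _).le, ← Real.exp_add]
        gcongr
        have := c.second_order_terms_le hε ha ha3 hθ hθa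
        linear_combination this

end LyapunovConstants

section Recursion

variable {Ω S Z : Type*} [MeasurableSpace S] [mZ : MeasurableSpace Z] {step : S → Z → S} {s₀ : S}
  {X : ℕ → Ω → S} {D : ℕ → Ω → Z}

lemma measurable_recursion (hstep : Measurable (Function.uncurry step)) (hX0 : X 0 = fun _ => s₀)
    (hX : ∀ t ω, X (t + 1) ω = step (X t ω) (D t ω)) (t : ℕ) :
    Measurable[⨆ i ∈ Set.Iio t, mZ.comap (D i)] (X t) := by
  induction t with
  | zero =>
    rw [hX0]
    exact measurable_const
  | succ t ih =>
    have hpast : Measurable[⨆ i ∈ Set.Iio (t + 1), mZ.comap (D i)] (X t) :=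
      ih.mono (biSup_mono fun i hi => hi.trans t.lt_succ_self) le_rfl
    have hnew : Measurable[⨆ i ∈ Set.Iio (t + 1), mZ.comap (D i)] (D t) :=
      Measurable.mono (comap_measurable (D t))
        (le_biSup (fun i => mZ.comap (D i)) (Set.mem_Iio.2 t.lt_succ_self)) le_rfl
    rw [funext (hX t)]
    exact hstep.comp (hpast.prodMk hnew)

variable [MeasurableSpace Ω] {P : Measure Ω}

lemma indepFun_recursion (hstep : Measurable (Function.uncurry step)) (hX0 : X 0 = fun _ => s₀)
    (hX : ∀ t ω, X (t + 1) ω = step (X t ω) (D t ω)) (hD : ∀ t, Measurable (D t))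
    (hindep : iIndepFun D P) (t : ℕ) : IndepFun (X t) (D t) P := by
  have := indep_iSup_of_disjoint (S := Set.Iio t) (T := {t})
    (fun i => (hD i).comap_le) hindep (Set.disjoint_singleton_right.2 (lt_irrefl t : t ∉ Set.Iio t))
  rw [iSup_singleton] at this
  exact indep_of_indep_of_le_left this (measurable_recursion hstep hX0 hX t).comap_le

variable [IsProbabilityMeasure P] {Λ : Measure Z} [IsProbabilityMeasure Λ]

lemma lintegral_recursion_succ (hstep : Measurable (Function.uncurry step))
    (hX0 : X 0 = fun _ => s₀) (hX : ∀ t ω, X (t + 1) ω = step (X t ω) (D t ω))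
    (hD : ∀ t, Measurable (D t)) (hindep : iIndepFun D P) (t : ℕ) (hlaw : P.map (D t) = Λ)
    {φ : S → ENNReal} (hφ : Measurable φ) :
    ∫⁻ ω, φ (X (t + 1) ω) ∂P = ∫⁻ ω, ∫⁻ z, φ (step (X t ω) z) ∂Λ ∂P := by
  have hXm : Measurable (X t) := (measurable_recursion hstep hX0 hX t).mono
    (iSup₂_le fun i _ => (hD i).comap_le) le_rfl
  have hjoint := (indepFun_iff_map_prod_eq_prod_map_map hXm.aemeasurable
    (hD t).aemeasurable).1 (indepFun_recursion hstep hX0 hX hD hindep t)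
  have hm : Measurable fun p : S × Z => φ (step p.1 p.2) := hφ.comp hstep
  have := Measure.isProbabilityMeasure_map (μ := P) hXm.aemeasurable
  calc ∫⁻ ω, φ (X (t + 1) ω) ∂P = ∫⁻ p, φ (step p.1 p.2) ∂(P.map fun ω => (X t ω, D t ω)) := by
        rw [lintegral_map hm (hXm.prodMk (hD t))]
        simp only [hX]
    _ = ∫⁻ ω, ∫⁻ z, φ (step (X t ω) z) ∂Λ ∂P := by
        rw [hjoint, hlaw, lintegral_prod _ hm.aemeasurable,
          lintegral_map hm.lintegral_prod_right' hXm]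

lemma lintegral_exp_recursion_le (hstep : Measurable (Function.uncurry step))
    (hX0 : X 0 = fun _ => s₀) (hX : ∀ t ω, X (t + 1) ω = step (X t ω) (D t ω))
    (hD : ∀ t, Measurable (D t)) (hindep : iIndepFun D P) (hlaw : ∀ t, P.map (D t) = Λ)
    {V : S → ℝ} (hV : Measurable V) {B : Set S} (hXB : ∀ t ω, X t ω ∈ B) {Θ γ e : ℝ}
    (hγ : γ ∈ Set.Icc 0 1) (he : 0 ≤ e)
    (hdrift : ∀ s ∈ B, ∀ θ ∈ Set.Icc 0 Θ, ∫⁻ z, ENNReal.ofReal (Real.exp (θ * V (step s z))) ∂Λ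
      ≤ ENNReal.ofReal (Real.exp (θ * ((1 - γ) * V s + γ * e))))
    (t : ℕ) {θ : ℝ} (hθ : θ ∈ Set.Icc 0 Θ) :
    ∫⁻ ω, ENNReal.ofReal (Real.exp (θ * V (X t ω))) ∂P
      ≤ ENNReal.ofReal (Real.exp (θ * ((1 - γ) ^ t * V s₀ + e))) := by
  induction t generalizing θ with
  | zero =>
    simp only [hX0, lintegral_const, measure_univ, mul_one, pow_zero, one_mul]
    have := hθ.1
    gcongr
    linarith
  | succ t ih =>
    have hXm : Measurable (X t) := (measurable_recursion hstep hX0 hX t).mono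
      (iSup₂_le fun i _ => (hD i).comap_le) le_rfl
    have hθ' : θ * (1 - γ) ∈ Set.Icc 0 Θ := ⟨mul_nonneg hθ.1 (sub_nonneg.2 hγ.2),
      (mul_le_of_le_one_right hθ.1 (by linarith [hγ.1])).trans hθ.2⟩
    calc ∫⁻ ω, ENNReal.ofReal (Real.exp (θ * V (X (t + 1) ω))) ∂P
        = ∫⁻ ω, ∫⁻ z, ENNReal.ofReal (Real.exp (θ * V (step (X t ω) z))) ∂Λ ∂P :=
          lintegral_recursion_succ hstep hX0 hX hD hindep t (hlaw t)
            (φ := fun s => ENNReal.ofReal (Real.exp (θ * V s))) (by fun_prop)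
      _ ≤ ∫⁻ ω, ENNReal.ofReal (Real.exp (θ * ((1 - γ) * V (X t ω) + γ * e))) ∂P :=
          lintegral_mono fun ω => hdrift _ (hXB t ω) θ hθ
      _ = (∫⁻ ω, ENNReal.ofReal (Real.exp (θ * (1 - γ) * V (X t ω))) ∂P)
            * ENNReal.ofReal (Real.exp (θ * (γ * e))) := by
          rw [← lintegral_mul_const _ (by fun_prop)]
          simp only [← ENNReal.ofReal_mul (Real.exp_pos _).le, ← Real.exp_add, mul_add, mul_assoc]
      _ ≤ ENNReal.ofReal (Real.exp (θ * (1 - γ) * ((1 - γ) ^ t * V s₀ + e)))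
            * ENNReal.ofReal (Real.exp (θ * (γ * e))) := by
          gcongr
          exact ih hθ'
      _ = ENNReal.ofReal (Real.exp (θ * ((1 - γ) ^ (t + 1) * V s₀ + e))) := by
          rw [← ENNReal.ofReal_mul (Real.exp_pos _).le, ← Real.exp_add]
          ring_nf

end Recursion

lemma measureReal_lt_le_of_lintegral_exp_le {Ω : Type*} [MeasurableSpace Ω] {P : Measure Ω}
    {Y : Ω → ℝ} (hY : Measurable Y) {θ u v : ℝ} (hθ : 0 ≤ θ)
    (h : ∫⁻ ω, ENNReal.ofReal (Real.exp (θ * Y ω)) ∂P ≤ ENNReal.ofReal (Real.exp (θ * u))) :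
    P.real {ω | v < Y ω} ≤ Real.exp (-(θ * (v - u))) := by
  have hsub : {ω | v < Y ω} ⊆ {ω | ENNReal.ofReal (Real.exp (θ * v))
      ≤ ENNReal.ofReal (Real.exp (θ * Y ω))} := fun ω (hω : v < Y ω) => by
    change ENNReal.ofReal _ ≤ ENNReal.ofReal _
    gcongr
  refine ENNReal.toReal_le_of_le_ofReal (Real.exp_pos _).le ?_
  calc P {ω | v < Y ω}
      ≤ (∫⁻ ω, ENNReal.ofReal (Real.exp (θ * Y ω)) ∂P) / ENNReal.ofReal (Real.exp (θ * v)) :=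
        (measure_mono hsub).trans (meas_ge_le_lintegral_div (by fun_prop) (by positivity)
          ENNReal.ofReal_ne_top)
    _ ≤ ENNReal.ofReal (Real.exp (θ * u)) / ENNReal.ofReal (Real.exp (θ * v)) := by gcongr
    _ = ENNReal.ofReal (Real.exp (-(θ * (v - u)))) := by
        rw [← ENNReal.ofReal_div_of_pos (Real.exp_pos _), ← Real.exp_sub]
        ring_nf

lemma sq_distToOpt (m : Measure ℝ) (x : ℝ × ℝ) :
    distToOpt m x ^ 2 = (x.1 - optPrice m) ^ 2 + (x.2 - optQuantity m) ^ 2 :=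
  Real.sq_sqrt (by positivity)

section Estimate

variable {𝓕 : Set (Measure ℝ)} {ε a : ℝ} {N : ℕ} {β₀ : Fin 2 → ℝ}

lemma estimate_mem_box (pf : ProjectionFacility 𝓕) (hβ₀ : β₀ ∈ pf.box)
    (d : ℕ → ℝ × (Fin N → ℝ)) (t : ℕ) : estimate pf ε a β₀ d t ∈ pf.box := by
  cases t with
  | zero => exact hβ₀
  | succ t => exact lsStep_mem_box pf (d t)

lemma measurable_estimate {Ω : Type} [MeasurableSpace Ω] {P : Measure Ω} {ν : Fin N → Measure ℝ}
    {D : ℕ → Ω → ℝ × (Fin N → ℝ)} (pf : ProjectionFacility 𝓕) (hε : ε ≠ 0)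
    (hD : IsShockProcess P ν ε D) (t : ℕ) :
    Measurable fun ω => estimate pf ε a β₀ (fun i => D i ω) t :=
  (measurable_recursion (X := fun t ω => estimate pf ε a β₀ (fun i => D i ω) t)
    (measurable_lsStep pf hε) rfl (fun _ _ => rfl) t).mono
      (iSup₂_le fun i _ => (hD.meas i).comap_le) le_rfl

end Estimate

namespace LyapunovConstants

variable {lo hi L : ℝ} (c : LyapunovConstants lo hi L) {𝓕 : Set (Measure ℝ)}
  (h𝓕 : ∀ m ∈ 𝓕, HasStableDemand lo hi L m) {ε a v d : ℝ}

lemma sq_distToOpt_le {m : Measure ℝ} (h : HasStableDemand lo hi L m) {β : Fin 2 → ℝ}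
    (hβ : c.Admissible (linPrice β) (-β 1)) {e : ℝ} (he : |e| ≤ ε)
    {φ : (Fin 2 → ℝ) → ℝ → ℝ × ℝ} (hφ : φ ∈ ({modelForecast, demandForecast m} : Set _)) :
    distToOpt m (φ β e) ^ 2 ≤ 10 * c.M ^ 5 * (c.estimateLyapunov m β + ε ^ 2) := by
  have hM := c.two_le_M
  have hprice : _ ≤ c.estimateLyapunov m β := hβ.sq_sub_opt_le_lyapunov h
  have hV : 0 ≤ c.estimateLyapunov m β := (sq_nonneg _).trans hprice
  have hM5 : c.M ^ 2 ≤ c.M ^ 5 := pow_le_pow_right₀ (by linarith) (by norm_num)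
  have hM5' : 1 ≤ c.M ^ 5 := one_le_pow₀ (by linarith)
  rw [sq_distToOpt]
  rcases hφ with rfl | rfl
  · have hmodel : (modelForecast β e).2 = linPrice β * -β 1 := by
      have := linPrice_mul_neg_slope (neg_pos.1 hβ.slope_pos).ne
      simp only [modelForecast]
      linarith
    have hquantity : _ ≤ 9 * c.M ^ 5 * c.estimateLyapunov m β := hβ.sq_model_quantity_sub_le h
    rw [hmodel]
    calc _ ≤ 1 * c.estimateLyapunov m β + 9 * c.M ^ 5 * c.estimateLyapunov m β := by
          rw [one_mul]
          exact add_le_add hprice hquantity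
      _ ≤ c.M ^ 5 * c.estimateLyapunov m β + 9 * c.M ^ 5 * c.estimateLyapunov m β := by gcongr
      _ = 10 * c.M ^ 5 * (c.estimateLyapunov m β + 0) := by ring
      _ ≤ _ := by gcongr; positivity
  · have hquantity : _ ≤ 2 * c.M ^ 2 * (c.estimateLyapunov m β + ε ^ 2) :=
      hβ.sq_true_quantity_sub_le h he
    calc _ ≤ 1 * (c.estimateLyapunov m β + 0) + 2 * c.M ^ 2 * (c.estimateLyapunov m β + ε ^ 2) := by
          rw [one_mul, add_zero]
          exact add_le_add hprice hquantity
      _ ≤ c.M ^ 5 * (c.estimateLyapunov m β + ε ^ 2)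
          + 2 * c.M ^ 5 * (c.estimateLyapunov m β + ε ^ 2) := by gcongr; positivity
      _ ≤ _ := by nlinarith [mul_nonneg (pow_nonneg c.M_pos.le 5) (add_nonneg hV (sq_nonneg ε))]

variable {N : ℕ} {ν : Fin N → Measure ℝ} [∀ i, IsProbabilityMeasure (ν i)]
  [IsProbabilityMeasure (aggregate ν)] [NullSingletonClass (aggregate ν)]
  {Ω : Type} [MeasurableSpace Ω] {P : Measure Ω} {D : ℕ → Ω → ℝ × (Fin N → ℝ)} {β₀ : Fin 2 → ℝ}

lemma measureReal_lt_estimateLyapunov_le (h : HasStableDemand lo hi L (aggregate ν))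
    (hD : IsShockProcess P ν ε D) (hβ₀ : β₀ ∈ (c.projectionFacility h𝓕).box) (hε : 0 < ε)
    (hε1 : ε ≤ 1) (ha : 0 < a) (haε : 12 * c.M ^ 8 * a ≤ ε ^ 3) (T : ℕ) (v : ℝ) :
    P.real {ω | v < c.estimateLyapunov (aggregate ν)
        (estimate (c.projectionFacility h𝓕) ε a β₀ (fun t => D t ω) T)}
      ≤ Real.exp (-(ε ^ 3 / a * (v - ((1 - a / c.M ^ 3) ^ T * (4 * c.M ^ 4)
          + 350 * c.M ^ 15 * ε)))) := by
  have := hD.isProb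
  have := isProbabilityMeasure_noiseLaw hε
  have hM := c.M_pos
  have hΘ : 0 ≤ ε ^ 3 / a := by positivity
  have hγ : a / c.M ^ 3 ∈ Set.Icc 0 1 := by
    refine ⟨by positivity, (div_le_one₀ (by positivity)).2 ?_⟩
    have hM8 : 1 ≤ c.M ^ 8 := one_le_pow₀ (by linarith [c.two_le_M])
    have hε3 : ε ^ 3 ≤ 1 := pow_le_one₀ hε.le hε1
    nlinarith [c.two_le_M_cube]
  have hexp := lintegral_exp_recursion_le (measurable_lsStep (c.projectionFacility h𝓕) hε.ne')
    (X := fun t ω => estimate (c.projectionFacility h𝓕) ε a β₀ (fun i => D i ω) t) (Θ := ε ^ 3 / a)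
    (e := 350 * c.M ^ 15 * ε) rfl
    (fun _ _ => rfl) hD.meas hD.indep hD.law (c.measurable_estimateLyapunov (aggregate ν))
    (fun t ω => estimate_mem_box _ hβ₀ _ t) hγ (by positivity)
    (fun β hβ θ hθ => c.lintegral_exp_estimateLyapunov_le h𝓕 h hβ hε hε1 ha.le haε hθ.1
      ((le_div_iff₀ ha).1 hθ.2)) T (Set.right_mem_Icc.2 hΘ)
  refine (measureReal_lt_le_of_lintegral_exp_le ((c.measurable_estimateLyapunov _).comp
    (measurable_estimate _ hε.ne' hD T)) hΘ hexp).trans ?_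
  have hV₀ : c.estimateLyapunov (aggregate ν) β₀ ≤ 4 * c.M ^ 4 :=
    (c.admissible_of_mem_box h𝓕 hβ₀).lyapunov_le h.opt_mem (h.optProfit_mem c.lo_pos)
  have := pow_nonneg (sub_nonneg.2 hγ.2) T
  gcongr

lemma failsWithProbAtMost (h𝓕' : ∀ m ∈ 𝓕, IsProbabilityMeasure m ∧ NullSingletonClass m)
    (N : ℕ) {T : ℕ} (hε : 0 < ε) (hε1 : ε ≤ 1) (ha : 0 < a) (haε : 12 * c.M ^ 8 * a ≤ ε ^ 3)
    (hT : (1 - a / c.M ^ 3) ^ T * (4 * c.M ^ 4) ≤ v / 4) (hv : 350 * c.M ^ 15 * ε ≤ v / 4)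
    (hd : 0 ≤ d) (hvd : 20 * c.M ^ 5 * v ≤ d ^ 2) :
    FailsWithProbAtMost (c.projectionFacility h𝓕) N ε a T (fun x => d < x)
      (Real.exp (-(ε ^ 3 * v / (2 * a)))) := by
  intro β₀ hβ₀ ν hν hmem Ω _ P D hD φ hφ
  have := hD.isProb
  have h := h𝓕 _ hmem
  obtain ⟨_, _⟩ := h𝓕' _ hmem
  have hβ₀' := interior_subset ((c.projectionFacility h𝓕).core_subset hβ₀)
  have hM := c.two_le_M
  have hεv : ε ^ 2 ≤ v := by
    have hM15 : 1 ≤ c.M ^ 15 := one_le_pow₀ (by linarith)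
    have : ε ^ 2 ≤ ε := pow_le_of_le_one hε.le hε1 two_ne_zero
    nlinarith
  have hnoise : ∀ᵐ ω ∂P, |(D T ω).1| ≤ ε :=
    ae_of_ae_map (hD.meas T).aemeasurable (hD.law T ▸ ae_abs_fst_le hε)
  calc _ ≤ P.real {ω | v < c.estimateLyapunov (aggregate ν)
          (estimate (c.projectionFacility h𝓕) ε a β₀ (fun t => D t ω) T)} := by
        refine ENNReal.toReal_mono (measure_ne_top _ _) (measure_mono_ae ?_)
        filter_upwards [hnoise] with ω hω (hbad : d < _)
        change v < _
        by_contra! hVv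
        have hbox := estimate_mem_box (ε := ε) (a := a) _ hβ₀' (fun t => D t ω) T
        have hdist := c.sq_distToOpt_le h (c.admissible_of_mem_box h𝓕 hbox) hω hφ
        refine (pow_lt_pow_left₀ hbad hd two_ne_zero).not_ge ((hdist.trans ?_).trans hvd)
        calc _ ≤ 10 * c.M ^ 5 * (v + v) := by gcongr
          _ = 20 * c.M ^ 5 * v := by ring
    _ ≤ _ := c.measureReal_lt_estimateLyapunov_le h𝓕 h hD hβ₀' hε hε1 ha haε T v
    _ ≤ Real.exp (-(ε ^ 3 / a * (v / 2))) := by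
        gcongr
        linarith
    _ = _ := by
        congr 2
        field_simp

end LyapunovConstants

/-- A guarantee for small gains: the algorithm with noise width `noise * μ ^ 2` and any gain
`a < gain * μ ^ 6` misses the optimum by more than `μ` after `time * -log μ / a` periods with
probability at most `exp (-decay * μ ^ 8 / a)`. -/
structure LearningRate {𝓕 : Set (Measure ℝ)} (pf : ProjectionFacility 𝓕) (N : ℕ) where
  noise : ℝ
  time : ℝ
  decay : ℝ
  gain : ℝ
  noise_pos : 0 < noise
  time_pos : 0 < time
  decay_pos : 0 < decay
  gain_pos : 0 < gain
  gain_le_one : gain ≤ 1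
  fails : ∀ μ ∈ Set.Ioc (0 : ℝ) (1 / 2), ∀ a ∈ Set.Ioo 0 (gain * μ ^ 6),
    FailsWithProbAtMost pf N (noise * μ ^ 2) a ⌈time * -Real.log μ / a⌉₊ (fun d => μ < d)
      (Real.exp (-(decay * μ ^ 8 / a)))

lemma one_half_le_neg_log {x : ℝ} (hx : x ∈ Set.Ioc (0 : ℝ) (1 / 2)) : 1 / 2 ≤ -Real.log x := by
  have h := Real.log_le_log hx.1 hx.2
  rw [one_div, Real.log_inv] at h
  linarith [Real.log_two_gt_d9]

lemma one_sub_pow_le_sq_div {x B μ : ℝ} (hx1 : x ≤ 1) (hB : 1 ≤ B)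
    (hμ : μ ∈ Set.Ioc (0 : ℝ) (1 / 2)) {T : ℕ}
    (hT : (2 + 2 * Real.log B) * -Real.log μ ≤ x * T) : (1 - x) ^ T ≤ μ ^ 2 / B := by
  have hlogB : 0 ≤ Real.log B := Real.log_nonneg hB
  have hlogμ := one_half_le_neg_log hμ
  calc (1 - x) ^ T ≤ Real.exp (-x) ^ T :=
        pow_le_pow_left₀ (sub_nonneg.2 hx1) (Real.one_sub_le_exp_neg x) T
    _ ≤ Real.exp (2 * Real.log μ - Real.log B) := by
        rw [← Real.exp_nat_mul]
        exact Real.exp_le_exp.2 (by nlinarith)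
    _ = μ ^ 2 / B := by
        rw [Real.exp_sub, Real.exp_log (by linarith), two_mul, Real.exp_add, Real.exp_log hμ.1, sq]

namespace LyapunovConstants

variable {lo hi L : ℝ} (c : LyapunovConstants lo hi L)

lemma lyapunov_decay_le {a μ : ℝ} (ha : 0 < a) (ha1 : a ≤ 1) (hμ : μ ∈ Set.Ioc (0 : ℝ) (1 / 2)) :
    (1 - a / c.M ^ 3)
        ^ ⌈c.M ^ 3 * (2 + 2 * Real.log (320 * c.M ^ 9)) * -Real.log μ / a⌉₊ * (4 * c.M ^ 4)
      ≤ μ ^ 2 / (20 * c.M ^ 5) / 4 := by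
  have hM := c.two_le_M
  have hM9 : 1 ≤ c.M ^ 9 := one_le_pow₀ (by linarith)
  have hM3 : 1 ≤ c.M ^ 3 := one_le_pow₀ (by linarith)
  have hpow := one_sub_pow_le_sq_div (x := a / c.M ^ 3) (B := 320 * c.M ^ 9)
    ((div_le_one₀ (by positivity)).2 (ha1.trans hM3)) (by linarith) hμ
    (T := ⌈c.M ^ 3 * (2 + 2 * Real.log (320 * c.M ^ 9)) * -Real.log μ / a⌉₊) (by
      rw [← div_le_iff₀' (by positivity)]
      refine le_of_eq_of_le ?_ (Nat.le_ceil _)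
      field_simp)
  calc _ ≤ μ ^ 2 / (320 * c.M ^ 9) * (4 * c.M ^ 4) := by gcongr
    _ = _ := by field_simp; ring

/-- The noise width, relative to `μ ^ 2`, at which the drift error of the Lyapunov function is a
quarter of the target level `μ ^ 2 / (20 * M ^ 5)`. -/
def noiseScale : ℝ := 1 / (28000 * c.M ^ 20)

lemma noiseScale_pos : 0 < c.noiseScale := by
  have := c.M_pos
  unfold noiseScale
  positivity

lemma noiseScale_le_one : c.noiseScale ≤ 1 := by
  have hM20 : 1 ≤ c.M ^ 20 := one_le_pow₀ (by linarith [c.two_le_M])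
  exact div_le_one_of_le₀ (by linarith) (by positivity)

/-- The constants come from balancing the contraction `(1 - a / M ^ 3) ^ T` of the Lyapunov function
and its drift error of order `ε` against the target level `μ ^ 2 / (20 * M ^ 5)`. -/
def learningRate {𝓕 : Set (Measure ℝ)} (h𝓕 : ∀ m ∈ 𝓕, HasStableDemand lo hi L m)
    (h𝓕' : ∀ m ∈ 𝓕, IsProbabilityMeasure m ∧ NullSingletonClass m) (N : ℕ) :
    LearningRate (c.projectionFacility h𝓕) N where
  noise := c.noiseScale
  time := c.M ^ 3 * (2 + 2 * Real.log (320 * c.M ^ 9))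
  decay := c.noiseScale ^ 3 / (40 * c.M ^ 5)
  gain := c.noiseScale ^ 3 / (12 * c.M ^ 8)
  noise_pos := c.noiseScale_pos
  time_pos := by
    have hM9 : 1 ≤ c.M ^ 9 := one_le_pow₀ (by linarith [c.two_le_M])
    have := Real.log_nonneg (by linarith : 1 ≤ 320 * c.M ^ 9)
    have := c.M_pos
    positivity
  decay_pos := div_pos (pow_pos c.noiseScale_pos 3) (by have := c.M_pos; positivity)
  gain_pos := div_pos (pow_pos c.noiseScale_pos 3) (by have := c.M_pos; positivity)
  gain_le_one := by
    have hM8 : 1 ≤ c.M ^ 8 := one_le_pow₀ (by linarith [c.two_le_M])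
    exact div_le_one_of_le₀
      ((pow_le_one₀ c.noiseScale_pos.le c.noiseScale_le_one).trans (by linarith)) (by positivity)
  fails μ hμ a ha := by
    have hM := c.two_le_M
    have hμ0 := hμ.1
    have hM8 : 1 ≤ c.M ^ 8 := one_le_pow₀ (by linarith)
    have hκ := c.noiseScale_pos
    have hε1 : c.noiseScale * μ ^ 2 ≤ 1 :=
      mul_le_one₀ c.noiseScale_le_one (by positivity) (pow_le_one₀ hμ0.le (by linarith [hμ.2]))
    have haε : 12 * c.M ^ 8 * a ≤ (c.noiseScale * μ ^ 2) ^ 3 := by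
      have := ha.2.le
      rw [div_mul_eq_mul_div, le_div_iff₀ (by positivity)] at this
      linarith
    have ha1 : a ≤ 1 := by
      have : (c.noiseScale * μ ^ 2) ^ 3 ≤ 1 := pow_le_one₀ (by positivity) hε1
      nlinarith [ha.1]
    have hfail := c.failsWithProbAtMost h𝓕 (v := μ ^ 2 / (20 * c.M ^ 5)) (d := μ) h𝓕' N
      (by positivity) hε1 ha.1 haε (c.lyapunov_decay_le ha.1 ha1 hμ)
      (le_of_eq (by unfold noiseScale; field_simp; norm_num)) hμ0.le (le_of_eq (by field_simp))
    convert hfail using 3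
    have := ha.1.ne'
    field_simp
    norm_num

end LyapunovConstants

section

variable {𝓕 : Set (Measure ℝ)} {pf : ProjectionFacility 𝓕} {N : ℕ}

lemma FailsWithProbAtMost.mono {ε a : ℝ} {T : ℕ} {bad bad' : ℝ → Prop} {δ δ' : ℝ}
    (h : FailsWithProbAtMost pf N ε a T bad δ) (hbad : ∀ d, bad' d → bad d) (hδ : δ ≤ δ') :
    FailsWithProbAtMost pf N ε a T bad' δ' := by
  intro β₀ hβ₀ ν hν hmem Ω _ P D hD φ hφ
  have := hD.isProb
  exact (measureReal_mono fun ω hω => hbad _ hω).trans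
    ((h β₀ hβ₀ ν hν hmem Ω P D hD φ hφ).trans hδ)

end

lemma min_one_half_mem_Ioc {x : ℝ} (hx : 0 < x) : min x (1 / 2) ∈ Set.Ioc (0 : ℝ) (1 / 2) :=
  ⟨by positivity, min_le_right _ _⟩

lemma neg_log_min_one_half_pos {x : ℝ} (hx : 0 < x) : 0 < -Real.log (min x (1 / 2)) := by
  linarith [one_half_le_neg_log (min_one_half_mem_Ioc hx)]

lemma eventually_min_one_half_eq : ∀ᶠ μ in 𝓝[>] (0 : ℝ), min μ (1 / 2) = μ := by
  filter_upwards [Ioc_mem_nhdsGT (show (0 : ℝ) < 1 / 2 by norm_num)] with μ hμ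
  exact min_eq_left hμ.2

lemma neg_log_le_inv {x : ℝ} (hx : 0 < x) : -Real.log x ≤ x⁻¹ := by
  rw [← Real.log_inv]
  exact (Real.log_le_sub_one_of_pos (inv_pos.2 hx)).trans (by linarith)

lemma natCeil_div_le {x a : ℝ} (hx : 0 ≤ x) (ha : 0 < a) (ha1 : a ≤ 1) :
    (⌈x / a⌉₊ : ℝ) ≤ (x + 1) / a := by
  rw [add_div]
  exact (Nat.ceil_lt_add_one (by positivity)).le.trans
    (by gcongr; exact (one_le_div₀ ha).2 ha1)

namespace LearningRate

variable {𝓕 : Set (Measure ℝ)} {pf : ProjectionFacility 𝓕} {N : ℕ} (R : LearningRate pf N)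

/-- The noise width for accuracy `μ`; accuracies above `1 / 2` are treated as `1 / 2`, here and in
`horizon`, `exponent` and `maxGain`. -/
def noiseWidth (μ : ℝ) : ℝ := R.noise * min μ (1 / 2) ^ 2

/-- The number of periods needed for accuracy `μ`, times the gain. -/
def horizon (μ : ℝ) : ℝ := R.time * -Real.log (min μ (1 / 2))

/-- The exponential rate per period at which the failure probability for accuracy `μ` decays. -/
def exponent (μ : ℝ) : ℝ := R.decay * min μ (1 / 2) ^ 8 / (R.horizon μ + 1)

/-- The bound below which gains achieve accuracy `μ`. -/
def maxGain (μ : ℝ) : ℝ := R.gain * min μ (1 / 2) ^ 6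

/-- A gain for which accuracy `μ` is achieved with probability `1 - r`. -/
def confidenceGain (μ r : ℝ) : ℝ :=
  min R.gain R.decay / 2 * min μ (1 / 2) ^ 8 / (1 - Real.log r)

lemma noiseWidth_pos {μ : ℝ} (hμ : 0 < μ) : 0 < R.noiseWidth μ := by
  have := R.noise_pos
  unfold noiseWidth
  positivity

lemma horizon_pos {μ : ℝ} (hμ : 0 < μ) : 0 < R.horizon μ :=
  mul_pos R.time_pos (neg_log_min_one_half_pos hμ)

lemma exponent_pos {μ : ℝ} (hμ : 0 < μ) : 0 < R.exponent μ := by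
  have := R.decay_pos
  have := R.horizon_pos hμ
  unfold exponent
  positivity

lemma maxGain_pos {μ : ℝ} (hμ : 0 < μ) : 0 < R.maxGain μ := by
  have := R.gain_pos
  unfold maxGain
  positivity

lemma confidenceGain_pos {μ r : ℝ} (hμ : 0 < μ) (hr : r ∈ Set.Ioo (0 : ℝ) 1) :
    0 < R.confidenceGain μ r := by
  have := R.gain_pos
  have := R.decay_pos
  have : 0 < 1 - Real.log r := by linarith [Real.log_neg hr.1 hr.2]
  unfold confidenceGain
  positivity

lemma failsWithProbAtMost {μ : ℝ} (hμ : 0 < μ) {a : ℝ} (ha : a ∈ Set.Ioo 0 (R.maxGain μ)) :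
    FailsWithProbAtMost pf N (R.noiseWidth μ) a ⌈R.horizon μ / a⌉₊ (fun d => μ < d)
      (Real.exp (-(R.decay * min μ (1 / 2) ^ 8 / a))) :=
  (R.fails _ (min_one_half_mem_Ioc hμ) a ha).mono (fun _ => (min_le_left _ _).trans_lt) le_rfl

lemma exponent_mul_natCeil_le {μ : ℝ} (hμ : 0 < μ) {a : ℝ} (ha : a ∈ Set.Ioo 0 (R.maxGain μ)) :
    R.exponent μ * ⌈R.horizon μ / a⌉₊ ≤ R.decay * min μ (1 / 2) ^ 8 / a := by
  have hmin := min_one_half_mem_Ioc hμ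
  have hH := R.horizon_pos hμ
  have ha1 : a ≤ 1 := ha.2.le.trans (mul_le_one₀ R.gain_le_one (pow_nonneg hmin.1.le 6)
    (pow_le_one₀ hmin.1.le (by linarith [hmin.2])))
  calc _ ≤ R.exponent μ * ((R.horizon μ + 1) / a) :=
        mul_le_mul_of_nonneg_left (natCeil_div_le hH.le ha.1 ha1) (R.exponent_pos hμ).le
    _ = _ := div_mul_div_cancel₀ (by positivity)

lemma failsWithProbAtMost_exp {μ : ℝ} (hμ : 0 < μ) {a : ℝ} (ha : a ∈ Set.Ioo 0 (R.maxGain μ)) :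
    FailsWithProbAtMost pf N (R.noiseWidth μ) a ⌈R.horizon μ / a⌉₊ (fun d => 4 * μ < d)
      (Real.exp (-(R.exponent μ * ⌈R.horizon μ / a⌉₊))) :=
  (R.failsWithProbAtMost hμ ha).mono (fun d hd => by linarith)
    (Real.exp_le_exp.2 (neg_le_neg (R.exponent_mul_natCeil_le hμ ha)))

lemma horizon_isTheta : R.horizon =Θ[𝓝[>] 0] fun μ => -Real.log μ := by
  refine IsTheta.trans (EventuallyEq.isTheta (g := fun μ => R.time * -Real.log μ) ?_)
    ((isTheta_refl _ _).const_mul_left R.time_pos.ne')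
  filter_upwards [eventually_min_one_half_eq] with μ hμ
  rw [horizon, hμ]

lemma pow_six_isBigO : (fun μ : ℝ => μ ^ 6) =O[𝓝[>] 0] fun μ => -(μ / Real.log μ) := by
  refine IsBigO.of_bound' ?_
  filter_upwards [Ioc_mem_nhdsGT (show (0 : ℝ) < 1 / 2 by norm_num)] with μ hμ
  have hμ0 := hμ.1
  have hlog : 0 < -Real.log μ := by linarith [one_half_le_neg_log hμ]
  rw [← div_neg, Real.norm_of_nonneg (by positivity), Real.norm_of_nonneg (by positivity),
    le_div_iff₀ hlog]
  calc μ ^ 6 * -Real.log μ ≤ μ ^ 6 * μ⁻¹ := by gcongr; exact neg_log_le_inv hμ0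
    _ = μ ^ 5 := by field_simp
    _ ≤ μ := pow_le_of_le_one hμ0.le (by linarith [hμ.2]) (by norm_num)

lemma maxGain_isBigO : R.maxGain =O[𝓝[>] 0] fun μ => -(μ / Real.log μ) := by
  refine (EventuallyEq.isBigO (f₂ := fun μ => R.gain * μ ^ 6) ?_).trans
    (pow_six_isBigO.const_mul_left _)
  filter_upwards [eventually_min_one_half_eq] with μ hμ
  rw [maxGain, hμ]

lemma confidenceGain_mem_Ioo {μ r : ℝ} (hμ : 0 < μ) (hr : r ∈ Set.Ioo (0 : ℝ) 1) :
    R.confidenceGain μ r ∈ Set.Ioo 0 (R.maxGain μ) := by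
  refine ⟨R.confidenceGain_pos hμ hr, ?_⟩
  have hmin := min_one_half_mem_Ioc hμ
  have hgain := R.gain_pos
  have hdecay := R.decay_pos
  have hlog := Real.log_neg hr.1 hr.2
  have hν := hmin.1
  calc R.confidenceGain μ r ≤ min R.gain R.decay / 2 * min μ (1 / 2) ^ 8 :=
        div_le_self (by positivity) (by linarith)
    _ ≤ R.gain / 2 * min μ (1 / 2) ^ 6 := by
        gcongr ?_ / 2 * ?_
        · exact min_le_left _ _
        · exact pow_le_pow_of_le_one hν.le (by linarith [hmin.2]) (by norm_num)
    _ < R.maxGain μ := by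
        unfold maxGain
        gcongr
        exact half_lt_self hgain

lemma exp_neg_decay_div_confidenceGain_le {μ r : ℝ} (hμ : 0 < μ) (hr : r ∈ Set.Ioo (0 : ℝ) 1) :
    Real.exp (-(R.decay * min μ (1 / 2) ^ 8 / R.confidenceGain μ r)) ≤ r := by
  have hdecay := R.decay_pos
  have hlog : 0 < 1 - Real.log r := by linarith [Real.log_neg hr.1 hr.2]
  have := (min_one_half_mem_Ioc hμ).1
  rw [← Real.le_log_iff_exp_le hr.1, neg_le, le_div_iff₀ (R.confidenceGain_pos hμ hr)]
  calc -Real.log r * R.confidenceGain μ r ≤ (1 - Real.log r) * R.confidenceGain μ r := by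
        gcongr
        · exact (R.confidenceGain_pos hμ hr).le
        · linarith
    _ = min R.gain R.decay / 2 * min μ (1 / 2) ^ 8 := by
        rw [confidenceGain]
        field_simp
    _ ≤ R.decay * min μ (1 / 2) ^ 8 := by
        gcongr
        linarith [min_le_right R.gain R.decay]

lemma natCeil_horizon_div_confidenceGain_le {μ r : ℝ} (hμ : μ ∈ Set.Ioc (0 : ℝ) 1)
    (hr : r ∈ Set.Ioc (0 : ℝ) (1 / 2)) :
    (⌈R.horizon (μ / 2) / R.confidenceGain (μ / 2) r⌉₊ : ℝ)
      ≤ (2 ^ 10 * 3 * R.time / min R.gain R.decay + 2) * (-Real.log r / μ ^ 9) := by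
  have hμ0 := hμ.1
  have hgain := R.gain_pos
  have hdecay := R.decay_pos
  have htime := R.time_pos
  have hlog := one_half_le_neg_log hr
  have hmin : min (μ / 2) (1 / 2) = μ / 2 := min_eq_left (by linarith [hμ.2])
  have hpos := R.confidenceGain_pos (half_pos hμ0) ⟨hr.1, by linarith [hr.2]⟩
  have hquot : R.horizon (μ / 2) / R.confidenceGain (μ / 2) r
      ≤ 2 ^ 10 * 3 * R.time / min R.gain R.decay * (-Real.log r / μ ^ 9) := by
    have hinv := neg_log_le_inv (half_pos hμ0)
    have hsum : 1 - Real.log r ≤ 3 * -Real.log r := by linarith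
    rw [horizon, confidenceGain, hmin]
    calc _ ≤ R.time * (μ / 2)⁻¹
          / (min R.gain R.decay / 2 * (μ / 2) ^ 8 / (3 * -Real.log r)) := by
          gcongr
          linarith
      _ = _ := by
          field_simp
  have hone : 1 ≤ 2 * (-Real.log r / μ ^ 9) := by
    rw [← mul_div_assoc, one_le_div₀ (by positivity)]
    exact (pow_le_one₀ hμ0.le hμ.2).trans (by linarith)
  linarith [Nat.ceil_lt_add_one (div_nonneg (R.horizon_pos (half_pos hμ0)).le hpos.le)]

end LearningRate

lemma LearningRate.uniformlyLearns {𝓕 : Set (Measure ℝ)} {pf : ProjectionFacility 𝓕} {N : ℕ}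
    (R : LearningRate pf N) : UniformlyLearns pf N := by
  refine ⟨fun μ => R.noiseWidth (μ / 2), fun μ => R.confidenceGain (μ / 2),
    fun μ r => ⌈R.horizon (μ / 2) / R.confidenceGain (μ / 2) r⌉₊,
    fun μ hμ => ⟨R.noiseWidth_pos (half_pos hμ), fun r hr =>
      ⟨R.confidenceGain_pos (half_pos hμ) hr, ?_⟩⟩, 9, by norm_num,
    2 ^ 10 * 3 * R.time / min R.gain R.decay + 2, fun μ hμ r hr => ?_⟩
  · exact (R.failsWithProbAtMost (half_pos hμ) (R.confidenceGain_mem_Ioo (half_pos hμ) hr)).mono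
      (fun d => (half_lt_self hμ).trans_le)
      (R.exp_neg_decay_div_confidenceGain_le (half_pos hμ) hr)
  · have hpow : μ ^ (9 : ℝ) = μ ^ 9 := by exact_mod_cast Real.rpow_natCast μ 9
    simpa only [hpow] using R.natCeil_horizon_div_confidenceGain_le hμ hr

lemma exists_learningRate {l u η : ℝ} (hl : 0 ≤ l) (hlu : l < u) (hη : 0 ≤ η) (N : ℕ) :
    ∃ pf : ProjectionFacility (lipschitzIHR l u η), Nonempty (LearningRate pf N) := by
  obtain ⟨lo, hi, L, hlo, hlo1, hhi, hL, h⟩ := exists_hasStableDemand hl hlu hη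
  obtain ⟨c⟩ := nonempty_lyapunovConstants hlo hlo1 hhi hL
  exact ⟨_, ⟨c.learningRate h (fun m ⟨f, hf, _⟩ => ⟨hf.isProb, hf.nullSingletonClass⟩) N⟩⟩

end MonopolyLearning

end

theorem mainTheorem1 (N : ℕ) (hN : 0 < N) (l u η : ℝ) (hl : 0 ≤ l) (hlu : l < u) (hη : 0 < η) :
    (∀ m ∈ MonopolyLearning.lipschitzIHR l u η,
      ∃! b, MonopolyLearning.IsOptimalPrice m b) ∧
    ∃ pf : MonopolyLearning.ProjectionFacility (MonopolyLearning.lipschitzIHR l u η),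
      (∃ ε τ ρ abar : ℝ → ℝ,
        (∀ μ > 0, 0 < ε μ ∧ 0 < τ μ ∧ 0 < ρ μ ∧ 0 < abar μ ∧
          ∀ a ∈ Set.Ioo 0 (abar μ),
            MonopolyLearning.FailsWithProbAtMost pf N (ε μ) a ⌈τ μ / a⌉₊ (fun d => 4 * μ < d)
              (Real.exp (-(ρ μ * (⌈τ μ / a⌉₊ : ℝ))))) ∧
        τ =Θ[𝓝[>] 0] (fun μ => -Real.log μ) ∧
        abar =O[𝓝[>] 0] (fun μ => -(μ / Real.log μ))) ∧
      MonopolyLearning.UniformlyLearns pf N := by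
  obtain ⟨pf, ⟨R⟩⟩ := MonopolyLearning.exists_learningRate hl hlu hη.le N
  refine ⟨fun m ⟨f, hf, _⟩ => hf.existsUnique_isOptimalPrice hl hlu, pf,
    ⟨R.noiseWidth, R.horizon, R.exponent, R.maxGain, fun μ hμ => ?_, R.horizon_isTheta,
      R.maxGain_isBigO⟩, R.uniformlyLearns⟩
  exact ⟨R.noiseWidth_pos hμ, R.horizon_pos hμ, R.exponent_pos hμ, R.maxGain_pos hμ,
    fun a ha => R.failsWithProbAtMost_exp hμ ha⟩
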